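/- **Setting.** Let $(\mathcal X,\mathfrak S)$ be a normalized hierarchically hyperbolic space (HHS) in the sense of Behrstock–Hagen–Sisto, with $\delta$-hyperbolic geodesic spaces $\mathcal C(U)$, $U\in\mathfrak S$, projections $\pi_U:\mathcal X\to 2^{\mathcal C(U)}$, relations $\sqsubset$ (nesting), $\perp$, $\pitchfork$, and relative projections $\rho^V_U$; normalized means that every point of $\mathcal C(U)$ is uniformly close to $\pi_U(\mathcal X)$. Fix the list $\mathfrak c$ of the constants of the HHS axioms (quasigeodesicity of $\mathcal X$, $\delta$, the diameter bound $\xi$, the coarse Lipschitz/quasiconvexity constant, the consistency constant, the complexity, the large links constants $\lambda,E$, where $E$ also serves for the bounded geodesic image axiom, the partial realization constant, the uniqueness function, the normalization constant). Write $d_U(x,y)=\operatorname{diam}(\pi_U(x)\cup\pi_U(y))$; the distance of two subsets of a metric space is the infimum of the distances of their points. For $a\in[0,\infty]$ put $[a]_K=a$ if $a\ge K$ and $[a]_K=0$ otherwise. **Rays.** An $L$-hierarchy ray is an $(L,L)$-quasigeodesic ray $h:[0,\infty)\to\mathcal X$ such that each $\pi_U\circ h$ is an unparameterized $(L,L)$-quasigeodesic;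 $\operatorname{supp}(h)$ is the set of $U$ with $\operatorname{diam}\pi_U(h)=\infty$; for such $U$, $h$ determines a point $h_U\in\partial\mathcal C(U)$. For $U\notin\operatorname{supp}(h)$ let $h_U\subset \mathcal C(U)$ be: (i) $\pi_U(h(t_U))$ if $U$ is orthogonal to all of $\operatorname{supp}(h)$, where $t_U$ is a chosen time with $d_U(h(0),h(s))\le d_U(h(0),h(t_U))+1$ for all $s$; (ii) otherwise, $\rho^V_U(h^U_V)$ if $U\sqsubsetneq V\in\operatorname{supp}(h)$, where $h^U_V$ is the set of all points at distance at least $E+M$ from $\rho^U_V$ on $(1,20\delta)$-quasigeodesic rays representing $h_V$ and based at points of $\rho^U_V$; (iii) otherwise, $\bigcup\rho^V_U$ over all $V\in\operatorname{supp}(h)$ with $V\pitchfork U$ or $V\sqsubsetneq U$. Here $M$ is a (sufficiently large) Morse constant. **Hull.** Let $F\subset\mathcal X$ be finite and nonempty and $\Lambda$ a finite set of $L$-hierarchy rays with $h(0)\in F$ for $h\in\Lambda$. Let $H_U\subset\mathcal C(U)$ be the union of all geodesics between points of the sets $\pi_U(a)$ ($a\in F$) and $h_U$ ($h\in\Lambda$,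 $U\notin\operatorname{supp}(h)$), all $(1,20\delta)$-quasigeodesic rays from such points to boundary points $h_U$ ($U\in\operatorname{supp}(h)$), and all bi-infinite $(1,20\delta)$-quasigeodesics between such boundary points. The hull is $H=\{x\in\mathcal X: d(\pi_U(x),H_U)<\theta\text{ for all }U\in\mathfrak S\}$. The set $\mathcal U$ of $K$-relevant domains consists of all $U$ for which the union of these point coordinates $\pi_U(a)$, $h_U$ has diameter $>K$ or $U\in\operatorname{supp}(h)$ for some $h\in\Lambda$. **Trees.** Let a reduced tree system with constant $C$ be given: for $U\in\mathcal U$ a tree ($0$-hyperbolic geodesic metric space) $T_U$ and a $(C,C)$-quasi-isometric embedding $\phi_U:T_U\to\mathcal C(U)$ whose image is at Hausdorff distance at most $C$ from $H_U$; for each $a\in F$, and each $a\in\Lambda$ with $U\notin\operatorname{supp}(a)$, a marked point $a_U\in T_U$ with $\phi_U(a_U)$ within $C$ of the coordinate of $a$ in $\mathcal C(U)$; for $V,U\in\mathcal U$ with $V\sqsubsetneq U$ or $V\pitchfork U$ a nonempty shadow $\delta^V_U\subset T_U$ of diameter at most $C$ with $d(\phi_U(\delta^V_U),\rho^V_U)\le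 C$; and coarse closest-point projections $\psi_U:\mathcal X\to T_U$, that is, for every $x$ some $p\in\pi_U(x)$ satisfies $d(p,\phi_U(\psi_U(x)))\le d(p,\phi_U(s))+C$ for all $s\in T_U$. For $R,r$ let $T^c_U$ be the union of the convex hulls in $T_U$ of all collections, with pairwise distances at most $r$, of the closed $2R$-neighborhoods of the shadows $\delta^V_U$ ($V\in\mathcal U$, $V\sqsubsetneq U$) and of the marked points. Let $q_U:T_U\to\widehat T_U$ collapse every connected component of $T^c_U$ to a point, with the quotient (path) metric $d_{\widehat T_U}$, and write $\hat x_U=q_U(\psi_U(x))$. **Theorem.** Fix $\mathfrak c$, reals $L\ge1$, $\theta$, $C\ge1$ and $n\in\mathbb N$. For all sufficiently large $M$, all $R$ sufficiently large depending on $M$, all $r$ sufficiently large depending on $M,R$, and all $K$ sufficiently large depending on $M,R,r$, there is $K_1>0$ such that for every $K_2\ge K_1$ there are $A\ge1$ and $B\ge0$ with the following property. Each of these thresholds and constants depends only on $\mathfrak c,L,\theta,C,n$ and the constants chosen before it. For every normalized HHS with constants $\mathfrak c$, all $F,\Lambda$ as above with $|F|+|\Lambda|=n$, every choice of times $t_U$,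 every reduced tree system as above and all $x,y\in H$, the sum $\sum_{U\in\mathfrak S}[d_U(x,y)]_{K_2}$ is finite and $$\sum_{U\in\mathfrak S}[d_U(x,y)]_{K_2}\le A\sum_{U\in\mathcal U}d_{\widehat T_U}(\hat x_U,\hat y_U)+B,\qquad \sum_{U\in\mathcal U}d_{\widehat T_U}(\hat x_U,\hat y_U)\le A\sum_{U\in\mathfrak S}[d_U(x,y)]_{K_2}+B .$$ -/

import Mathlib

open Set
open scoped ENNReal NNReal

universe u v w t

/-! ### Metric preliminaries -/

/-- The distance `inf {d(a, b) | a ∈ A, b ∈ B}` between two subsets, in `[0, ∞]`. -/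
noncomputable def setEDist {Z : Type*} [PseudoEMetricSpace Z] (A B : Set Z) : ℝ≥0∞ :=
  ⨅ a ∈ A, ⨅ b ∈ B, edist a b

/-- `f` restricted to `S` is a `(κ, ε)`-quasi-isometric embedding. -/
def IsQIEmbeddingOn {Y Z : Type*} [PseudoMetricSpace Y] [PseudoMetricSpace Z] (κ ε : ℝ)
    (S : Set Y) (f : Y → Z) : Prop :=
  ∀ s ∈ S, ∀ s' ∈ S, κ⁻¹ * dist s s' - ε ≤ dist (f s) (f s') ∧
    dist (f s) (f s') ≤ κ * dist s s' + ε

/-- `γ` is (the image of) a geodesic segment from `x` to `y`. -/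
def IsGeodesicSegment {Z : Type*} [PseudoMetricSpace Z] (x y : Z) (γ : Set Z) : Prop :=
  ∃ σ : ℝ → Z, σ 0 = x ∧ σ (dist x y) = y ∧
    (∀ s ∈ Icc 0 (dist x y), ∀ s' ∈ Icc 0 (dist x y), dist (σ s) (σ s') = |s - s'|) ∧
    γ = σ '' Icc 0 (dist x y)

/-- `δ`-hyperbolic geodesic spaces, by `δ`-slim triangles. -/
structure IsHyperbolicSpace (δ : ℝ) (Z : Type*) [PseudoMetricSpace Z] : Prop where
  geodesic : ∀ x y : Z, ∃ γ, IsGeodesicSegment x y γ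
  slim : ∀ (x y z : Z) (γ₁ γ₂ γ₃ : Set Z), IsGeodesicSegment x y γ₁ →
    IsGeodesicSegment y z γ₂ → IsGeodesicSegment x z γ₃ →
    ∀ p ∈ γ₁, ∃ p' ∈ γ₂ ∪ γ₃, dist p p' ≤ δ

/-- An `ℝ`-tree: a geodesic space all of whose triangles are tripods. Metric simplicial trees are
examples. -/
def IsMetricTree (T : Type*) [PseudoMetricSpace T] : Prop := IsHyperbolicSpace 0 T

/-- A `q`-quasigeodesic space: any two points are joined by a `(q, q)`-quasigeodesic. -/
def IsQuasigeodesicSpace (q : ℝ) (X : Type*) [PseudoMetricSpace X] : Prop :=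
  ∀ x y : X, ∃ (ℓ : ℝ) (σ : ℝ → X), 0 ≤ ℓ ∧ σ 0 = x ∧ σ ℓ = y ∧
    IsQIEmbeddingOn q q (Icc 0 ℓ) σ

/-- `[a]_K`, which is `a` if `a ≥ K` and `0` otherwise. -/
noncomputable def threshold (K : ℝ) (a : ℝ≥0∞) : ℝ≥0∞ :=
  open Classical in if ENNReal.ofReal K ≤ a then a else 0

/-! ### Hierarchically hyperbolic spaces -/

/-- The numerical constants of a normalized hierarchically hyperbolic structure. -/
structure HHSConstants where
  /-- quasigeodesicity of the space -/
  q : ℝ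
  /-- hyperbolicity -/
  δ : ℝ
  /-- diameters of projections and relative projections -/
  ξ : ℝ
  /-- coarse Lipschitz and quasiconvexity constant of the projections -/
  K : ℝ
  /-- consistency -/
  κ₀ : ℝ
  /-- complexity -/
  complexity : ℕ
  /-- large links, multiplicative constant -/
  lam : ℝ
  /-- large links and bounded geodesic image -/
  E : ℝ
  /-- partial realization -/
  α : ℝ
  /-- uniqueness -/
  θu : ℝ → ℝ
  /-- coarse surjectivity of the projections -/
  nrm : ℝ
  one_le_q : 1 ≤ q
  δ_nonneg : 0 ≤ δ
  ξ_nonneg : 0 ≤ ξ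
  K_nonneg : 0 ≤ K
  κ₀_nonneg : 0 ≤ κ₀
  one_le_lam : 1 ≤ lam
  E_pos : 0 < E
  ξ_le_E : ξ ≤ E
  κ₀_le_E : κ₀ ≤ E
  nrm_pos : 0 < nrm

/-- The data of a hierarchical structure on `X` with nesting poset `𝔖` (`V ≤ W` means that `V` is
nested in `W`) and spaces `𝒞 U`: projections `π_U`, orthogonality, the subsets
`rho V W = ρ^V_W ⊆ 𝒞 W` (used for `V` properly nested in `W` or transverse to `W`), and the maps
`rhoMap W V = ρ^W_V : 𝒞 W → 2^{𝒞 V}` (used for `V` properly nested in `W`). -/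
structure HHSData (X : Type u) (𝔖 : Type v) (𝒞 : 𝔖 → Type w) where
  proj : ∀ U : 𝔖, X → Set (𝒞 U)
  Orth : 𝔖 → 𝔖 → Prop
  rho : ∀ _V W : 𝔖, Set (𝒞 W)
  rhoMap : ∀ W V : 𝔖, 𝒞 W → Set (𝒞 V)

namespace HHSData

variable {X : Type u} {𝔖 : Type v} {𝒞 : 𝔖 → Type w}

/-- `d_U(x, y) = diam (π_U(x) ∪ π_U(y))`. -/
noncomputable def d [∀ U, MetricSpace (𝒞 U)] (D : HHSData X 𝔖 𝒞) (U : 𝔖) (x y : X) : ℝ≥0∞ :=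
  Metric.ediam (D.proj U x ∪ D.proj U y)

/-- Transversality: neither orthogonal nor nested. -/
def Transverse [PartialOrder 𝔖] (D : HHSData X 𝔖 𝒞) (V W : 𝔖) : Prop :=
  ¬ D.Orth V W ∧ ¬ V ≤ W ∧ ¬ W ≤ V

end HHSData

/-- The axioms of a normalized hierarchically hyperbolic space with constants `c`. -/
structure IsNormalizedHHS {X : Type u} [MetricSpace X] {𝔖 : Type v} [PartialOrder 𝔖]
    {𝒞 : 𝔖 → Type w} [∀ U, MetricSpace (𝒞 U)] (c : HHSConstants) (D : HHSData X 𝔖 𝒞) : Prop where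
  quasigeodesic : IsQuasigeodesicSpace c.q X
  hyperbolic : ∀ U, IsHyperbolicSpace c.δ (𝒞 U)
  -- projections
  proj_nonempty : ∀ U x, (D.proj U x).Nonempty
  proj_diam : ∀ U x, Metric.ediam (D.proj U x) ≤ ENNReal.ofReal c.ξ
  proj_lipschitz : ∀ U x y, D.d U x y ≤ ENNReal.ofReal (c.K * dist x y + c.K)
  proj_quasiconvex : ∀ U, ∀ p ∈ ⋃ x, D.proj U x, ∀ p' ∈ ⋃ x, D.proj U x,
    ∀ γ, IsGeodesicSegment p p' γ → ∀ z ∈ γ, ∃ p'' ∈ ⋃ x, D.proj U x, dist z p'' ≤ c.K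
  normalized : ∀ U (p : 𝒞 U), ∃ p' ∈ ⋃ x, D.proj U x, dist p p' < c.nrm
  -- nesting
  exists_top : Nonempty 𝔖 → ∃ S : 𝔖, ∀ U, U ≤ S
  rho_nonempty : ∀ V W, V < W ∨ D.Transverse V W → (D.rho V W).Nonempty
  rho_diam : ∀ V W, V < W ∨ D.Transverse V W →
    Metric.ediam (D.rho V W) ≤ ENNReal.ofReal c.ξ
  rhoMap_nonempty : ∀ V W, V < W → ∀ p, (D.rhoMap W V p).Nonempty
  -- orthogonality
  orth_symm : ∀ V W, D.Orth V W → D.Orth W V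
  orth_irrefl : ∀ V, ¬ D.Orth V V
  orth_mono : ∀ V W U, V ≤ W → D.Orth W U → D.Orth V U
  orth_container : ∀ T U, U ≤ T → (∃ V, V ≤ T ∧ D.Orth V U) →
    ∃ W, W < T ∧ ∀ V, D.Orth V U → V ≤ T → V ≤ W
  orth_not_le : ∀ V W, D.Orth V W → ¬ V ≤ W
  -- consistency
  transverse_consistency : ∀ V W x, D.Transverse V W →
    min (setEDist (D.proj W x) (D.rho V W)) (setEDist (D.proj V x) (D.rho W V))
      ≤ ENNReal.ofReal c.κ₀
  nested_consistency : ∀ V W x, V < W →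
    min (setEDist (D.proj W x) (D.rho V W))
      (Metric.ediam (D.proj V x ∪ ⋃ p ∈ D.proj W x, D.rhoMap W V p)) ≤ ENNReal.ofReal c.κ₀
  rho_coherent : ∀ U V W, U < V → (V < W ∨ (D.Transverse V W ∧ ¬ D.Orth W U)) →
    setEDist (D.rho U W) (D.rho V W) ≤ ENNReal.ofReal c.κ₀
  -- finite complexity
  finite_complexity : ∀ s : Set 𝔖, IsChain (· ≤ ·) s → s.encard ≤ c.complexity
  -- large links
  large_links : ∀ (W : 𝔖) (x x' : X), ∃ s : Finset 𝔖,
    (s.card : ℝ) ≤ c.lam * (D.d W x x').toReal + c.lam ∧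
    (∀ T ∈ s, T < W ∧ setEDist (D.proj W x) (D.rho T W)
      ≤ ENNReal.ofReal (c.lam * (D.d W x x').toReal + c.lam)) ∧
    ∀ T, T < W → (∃ T' ∈ s, T ≤ T') ∨ D.d T x x' < ENNReal.ofReal c.E
  -- bounded geodesic image
  bounded_geodesic_image : ∀ V W, V < W → ∀ (p p' : 𝒞 W) (γ : Set (𝒞 W)),
    IsGeodesicSegment p p' γ →
    Metric.ediam (⋃ z ∈ γ, D.rhoMap W V z) ≤ ENNReal.ofReal c.E ∨
      ∃ z ∈ γ, Metric.infEDist z (D.rho V W) < ENNReal.ofReal c.E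
  -- partial realization
  partial_realization : ∀ (s : Set 𝔖), s.Pairwise D.Orth → ∀ p : ∀ V, 𝒞 V,
    (∀ V ∈ s, p V ∈ ⋃ x, D.proj V x) →
    ∃ x : X, ∀ V ∈ s,
      Metric.ediam (insert (p V) (D.proj V x)) ≤ ENNReal.ofReal c.α ∧
      ∀ W, V < W ∨ D.Transverse W V →
        setEDist (D.proj W x) (D.rho V W) ≤ ENNReal.ofReal c.α
  -- uniqueness
  uniqueness : ∀ κ : ℝ, 0 ≤ κ → ∀ x y : X, c.θu κ ≤ dist x y →
    ∃ V, ENNReal.ofReal κ ≤ D.d V x y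

/-! ### Hierarchy rays, ray coordinates and hulls -/

section Rays

variable {X : Type u} [MetricSpace X] {𝔖 : Type v} [PartialOrder 𝔖] {𝒞 : 𝔖 → Type w}
  [∀ U, MetricSpace (𝒞 U)]

/-- `h : [0, ∞) → X` is an `L`-hierarchy ray: an `(L, L)`-quasigeodesic ray in `X` whose projection
to each `𝒞 U` is an unparameterized `(L, L)`-quasigeodesic. The latter is expressed by a monotone
change of parameter `σ`, whose image is `L`-dense in the intervals it spans. -/
structure IsHierarchyRay (D : HHSData X 𝔖 𝒞) (L : ℝ) (h : ℝ≥0 → X) : Prop where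
  quasigeodesic : IsQIEmbeddingOn L L univ h
  unparameterized : ∀ U, ∃ σ : ℝ≥0 → ℝ, Monotone σ ∧
    (∀ s s', ENNReal.ofReal (L⁻¹ * |σ s - σ s'| - L) ≤ D.d U (h s) (h s') ∧
      D.d U (h s) (h s') ≤ ENNReal.ofReal (L * |σ s - σ s'| + L)) ∧
    ∀ s, ∀ a ∈ Icc (σ 0) (σ s), ∃ s', |σ s' - a| ≤ L

/-- `supp(h)`: the domains to which `h` projects with infinite diameter. -/
def raySupp (D : HHSData X 𝔖 𝒞) (h : ℝ≥0 → X) : Set 𝔖 :=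
  {U | Metric.ediam (⋃ s, D.proj U (h s)) = ⊤}

/-- The domains orthogonal to all of `supp(h)`. -/
def raySuppPerp (D : HHSData X 𝔖 𝒞) (h : ℝ≥0 → X) : Set 𝔖 :=
  {U | ∀ V ∈ raySupp D h, D.Orth U V}

/-- `γ` is a `(1, 20δ)`-quasigeodesic ray in `𝒞 U` representing the point `h_U ∈ ∂𝒞 U` that is
determined by `π_U(h)`, where `U ∈ supp(h)`: its image is at finite Hausdorff distance from
`π_U(h)`. -/
def RepresentsRay (D : HHSData X 𝔖 𝒞) (c : HHSConstants) (U : 𝔖) (h : ℝ≥0 → X)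
    (γ : ℝ≥0 → 𝒞 U) : Prop :=
  IsQIEmbeddingOn 1 (20 * c.δ) univ γ ∧
    Metric.hausdorffEDist (range γ) (⋃ s, D.proj U (h s)) ≠ ⊤

/-- For `V ∈ supp(h)` and `U` properly nested in `V`: all points at distance at least `E + M` from
`ρ^U_V` on all `(1, 20δ)`-quasigeodesic rays that represent `h_V` and are based in `ρ^U_V`. -/
def rayTail (D : HHSData X 𝔖 𝒞) (c : HHSConstants) (M : ℝ) (h : ℝ≥0 → X) (U V : 𝔖) :
    Set (𝒞 V) :=
  {p | ∃ γ : ℝ≥0 → 𝒞 V, RepresentsRay D c V h γ ∧ γ 0 ∈ D.rho U V ∧ p ∈ range γ ∧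
    ENNReal.ofReal (c.E + M) ≤ Metric.infEDist p (D.rho U V)}

/-- A nonempty finite set `F` of points and a finite set `Λ` of `L`-hierarchy rays based in `F`,
with a choice of the times `t_U` at which a ray nearly attains its maximal displacement in a domain
`U` orthogonal to its support. -/
structure HullInput (c : HHSConstants) (D : HHSData X 𝔖 𝒞) (L : ℝ) where
  F : Finset X
  Λ : Finset (ℝ≥0 → X)
  F_nonempty : F.Nonempty
  ray : ∀ h ∈ Λ, IsHierarchyRay D L h
  base : ∀ h ∈ Λ, h 0 ∈ F
  time : (ℝ≥0 → X) → 𝔖 → ℝ≥0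
  time_spec : ∀ h ∈ Λ, ∀ U ∈ raySuppPerp D h, ∀ s,
    D.d U (h 0) (h s) ≤ D.d U (h 0) (h (time h U)) + 1

namespace HullInput

variable {c : HHSConstants} {D : HHSData X 𝔖 𝒞} {L : ℝ} (P : HullInput c D L)

/-- `|F ∪ Λ|`. -/
def card : ℕ := P.F.card + P.Λ.card

/-- The coordinate `π_U(h) ⊆ 𝒞 U` of a ray `h` in a domain `U ∉ supp(h)`, where `M` is the Morse
constant. -/
noncomputable def rayCoord (M : ℝ) (U : 𝔖) (h : ℝ≥0 → X) : Set (𝒞 U) :=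
  open Classical in
  if U ∈ raySuppPerp D h then D.proj U (h (P.time h U))
  else if ∃ V ∈ raySupp D h, U < V then
    ⋃ V ∈ {V ∈ raySupp D h | U < V}, ⋃ p ∈ rayTail D c M h U V, D.rhoMap V U p
  else ⋃ V ∈ {V ∈ raySupp D h | D.Transverse V U ∨ V < U}, D.rho V U

/-- The projections to `𝒞 U` of the points of `F` and of the rays in `Λ` that are not supported on
`U`. -/
def marked (M : ℝ) (U : 𝔖) : Set (𝒞 U) :=
  (⋃ a ∈ P.F, D.proj U a) ∪ ⋃ h ∈ {h | h ∈ P.Λ ∧ U ∉ raySupp D h}, P.rayCoord M U h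

/-- `H_U`, the hyperbolic hull of `π_U(F ∪ Λ)`: all geodesics between interior points, all
`(1, 20δ)`-quasigeodesic rays from interior points to boundary points, and all bi-infinite
`(1, 20δ)`-quasigeodesics between boundary points. -/
def hypHull (M : ℝ) (U : 𝔖) : Set (𝒞 U) :=
  {z | ∃ p ∈ P.marked M U, ∃ p' ∈ P.marked M U, ∃ γ, IsGeodesicSegment p p' γ ∧ z ∈ γ} ∪
  {z | ∃ p ∈ P.marked M U, ∃ h ∈ P.Λ, U ∈ raySupp D h ∧
    ∃ γ : ℝ≥0 → 𝒞 U, RepresentsRay D c U h γ ∧ γ 0 = p ∧ z ∈ range γ} ∪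
  {z | ∃ h ∈ P.Λ, ∃ h' ∈ P.Λ, U ∈ raySupp D h ∧ U ∈ raySupp D h' ∧
    ∃ γ : ℝ → 𝒞 U, IsQIEmbeddingOn 1 (20 * c.δ) univ γ ∧
      RepresentsRay D c U h (fun s => γ s) ∧ RepresentsRay D c U h' (fun s => γ (-s)) ∧
      z ∈ range γ}

/-- The set `𝒰 = Rel_K(F ∪ Λ)` of `K`-relevant domains: those where the projection of `F ∪ Λ` has
diameter more than `K` (infinite if some ray is supported there). -/
def relevant (M K : ℝ) : Set 𝔖 :=
  {U | ENNReal.ofReal K < Metric.ediam (P.marked M U) ∨ ∃ h ∈ P.Λ, U ∈ raySupp D h}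

/-- The `θ`-hull of `F ∪ Λ` in `X`. -/
def hull (M θ : ℝ) : Set X :=
  {x | ∀ U, setEDist (D.proj U x) (P.hypHull M U) < ENNReal.ofReal θ}

end HullInput

end Rays

/-! ### Clusters and collapsed trees -/

section Collapse

variable {T : Type*} [MetricSpace T]

/-- The convex hull of a subset of a tree. -/
def treeHull (A : Set T) : Set T :=
  {p | ∃ x ∈ A, ∃ y ∈ A, dist x p + dist p y = dist x y}

/-- The union of the convex hulls of all collections of sets from the family `𝒩` that are within
distance `r` of each other. -/
def clusterUnion (r : ℝ) (𝒩 : Set (Set T)) : Set T :=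
  {p | ∃ 𝒜 ⊆ 𝒩, (∀ A ∈ 𝒜, ∀ B ∈ 𝒜, setEDist A B ≤ ENNReal.ofReal r) ∧ p ∈ treeHull (⋃₀ 𝒜)}

/-- Two points are identified if they are equal or lie in the same component of `A`. -/
def collapseSetoid (A : Set T) : Setoid T where
  r x y := x = y ∨ y ∈ connectedComponentIn A x
  iseqv := by
    refine ⟨fun x => Or.inl rfl, ?_, ?_⟩
    · rintro x y (rfl | h)
      · exact Or.inl rfl
      · have hx : x ∈ A := connectedComponentIn_nonempty_iff.1 ⟨y, h⟩
        exact Or.inr (connectedComponentIn_eq h ▸ mem_connectedComponentIn hx)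
    · rintro x y z (rfl | h) (rfl | h')
      · exact Or.inl rfl
      · exact Or.inr h'
      · exact Or.inr h
      · exact Or.inr (connectedComponentIn_eq h ▸ h')

/-- The quotient of `T` in which each component of `A` is collapsed to a point. -/
def Collapse (A : Set T) : Type _ := Quotient (collapseSetoid A)

/-- The quotient map `q`. -/
def Collapse.mk (A : Set T) (x : T) : Collapse A := Quotient.mk (collapseSetoid A) x

/-- The quotient (pseudo)metric: the infimum of `∑ d(pᵢ, p'ᵢ)` over all chains with
`q(p₀) = x`, `q(p'ᵢ) = q(pᵢ₊₁)` and `q(p'ₙ) = y`. -/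
noncomputable def Collapse.eDist {A : Set T} (x y : Collapse A) : ℝ≥0∞ :=
  ⨅ (n : ℕ) (p : ℕ → T) (p' : ℕ → T)
    (_ : Collapse.mk A (p 0) = x ∧ Collapse.mk A (p' n) = y ∧
      ∀ i < n, Collapse.mk A (p' i) = Collapse.mk A (p (i + 1))),
    ∑ i ∈ Finset.range (n + 1), edist (p i) (p' i)

end Collapse

/-! ### Reduced tree systems -/

section Trees

variable {X : Type u} [MetricSpace X] {𝔖 : Type v} [PartialOrder 𝔖] {𝒞 : 𝔖 → Type w}
  [∀ U, MetricSpace (𝒞 U)] {c : HHSConstants} {D : HHSData X 𝔖 𝒞} {L : ℝ}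

/-- A system of trees, with constant `C`, modelling the hulls `H_U` for the `K`-relevant domains
`U`: trees `T U` with `(C, C)`-quasi-isometric embeddings `φ U` onto the hulls up to `C`, marked
points for the points of `F` and for the rays not supported on `U`, shadows `shadow U V = δ^V_U` of
the sets `ρ^V_U`, and coarse closest-point projections `ψ U` of `X` to `T U`. -/
structure ReducedTreeSystem (P : HullInput c D L) (M K C : ℝ) where
  T : P.relevant M K → Type t
  [metric : ∀ U, MetricSpace (T U)]
  tree : ∀ U, IsMetricTree (T U)
  φ : ∀ U, T U → 𝒞 U
  φ_qi : ∀ U, IsQIEmbeddingOn C C univ (φ U)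
  φ_hull : ∀ U, Metric.hausdorffEDist (range (φ U)) (P.hypHull M U) ≤ ENNReal.ofReal C
  mark : ∀ U, X → T U
  mark_spec : ∀ U, ∀ a ∈ P.F, Metric.infEDist (φ U (mark U a)) (D.proj U a) ≤ ENNReal.ofReal C
  rayMark : ∀ U, (ℝ≥0 → X) → T U
  rayMark_spec : ∀ U, ∀ h ∈ P.Λ, U.1 ∉ raySupp D h →
    Metric.infEDist (φ U (rayMark U h)) (P.rayCoord M U h) ≤ ENNReal.ofReal C
  shadow : ∀ U, P.relevant M K → Set (T U)
  shadow_nonempty : ∀ U V, V.1 < U.1 ∨ D.Transverse V.1 U.1 → (shadow U V).Nonempty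
  shadow_diam : ∀ U V, V.1 < U.1 ∨ D.Transverse V.1 U.1 →
    Metric.ediam (shadow U V) ≤ ENNReal.ofReal C
  shadow_spec : ∀ U V, V.1 < U.1 ∨ D.Transverse V.1 U.1 →
    setEDist (φ U '' shadow U V) (D.rho V U) ≤ ENNReal.ofReal C
  ψ : ∀ U, X → T U
  ψ_spec : ∀ (U : P.relevant M K) (x : X), ∃ p ∈ D.proj U x, ∀ s : T U,
    dist p (φ U (ψ U x)) ≤ dist p (φ U s) + C

attribute [instance] ReducedTreeSystem.metric

namespace ReducedTreeSystem

variable {P : HullInput c D L} {M K C : ℝ} (𝒯 : ReducedTreeSystem.{u, v, w, t} P M K C)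

/-- The `2R`-neighborhoods of the shadows of the relevant domains properly nested in `U`, and of
the marked points. -/
def nbhds (R : ℝ) (U : P.relevant M K) : Set (Set (𝒯.T U)) :=
  {A | ∃ V : P.relevant M K, V.1 < U.1 ∧ A = Metric.cthickening (2 * R) (𝒯.shadow U V)} ∪
  {A | ∃ a ∈ P.F, A = Metric.cthickening (2 * R) {𝒯.mark U a}} ∪
  {A | ∃ h ∈ P.Λ, U.1 ∉ raySupp D h ∧ A = Metric.cthickening (2 * R) {𝒯.rayMark U h}}

/-- `T^c_U`, whose components are the clusters. -/
def clusters (R r : ℝ) (U : P.relevant M K) : Set (𝒯.T U) := clusterUnion r (𝒯.nbhds R U)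

/-- The coordinate `x̂_U = q_U(ψ_U(x))` in the collapsed tree. -/
def hat (R r : ℝ) (U : P.relevant M K) (x : X) : Collapse (𝒯.clusters R r U) :=
  Collapse.mk _ (𝒯.ψ U x)

/-- The `ℓ¹` distance `∑_{U ∈ 𝒰} d(x̂_U, ŷ_U)`. -/
noncomputable def modelDist (R r : ℝ) (x y : X) : ℝ≥0∞ :=
  ∑' U : P.relevant M K, Collapse.eDist (𝒯.hat R r U x) (𝒯.hat R r U y)

end ReducedTreeSystem

end Trees

/-! The two sums are compared directly, domain by domain. Rays are first traded for points: outside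
supp(h) the coordinate of h is within `rayConst` of π_U(h(t)) for all large t, and inside supp(h)
the points π_U(h(t)) diverge (`eventually_dist_rayCoord_le`, `eventually_le_dist_of_mem_raySupp`).
Every statement about F ∪ Λ thus becomes one about n points of X, valid for all large t, to which
consistency and bounded geodesic image apply; in each 𝒞 U a point of the hull lies coarsely between
two of them.

Upper bound for the model. Collapsing does not increase distances, so each summand is at most
C·d_U(x, y) plus a constant. The number of domains with d_U ≥ E is linear in the thresholded sum, by
iterating large links (`exists_finset_large`). If d_U < E and the summand is not zero, the short
segment from ψ_U(x) to ψ_U(y) leaves the clusters, so x is far in U from all marked points and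
shadows (`isFar_of_eDist_ne_zero`). Such domains are pairwise orthogonal (`pairwise_orth_isFar`), so
the complexity bounds their number.

Lower bound. A domain with d_U ≥ K₂ is relevant and its tree segment is long. A collapse shortens a
tree segment by at most the size of any cover of the collapsed part
(`IsMetricTree.dist_le_eDist_add`). Here the cover consists of a bounded number of sets and one more
for each relevant V nested in U, met by the segment, in which x and y are themselves far apart
(`dist_ψ_le_eDist_add`). The reason: unless ρ^V_U is a coarse center of a triangle x, y, i with i in
F ∪ Λ, bounded geodesic image places i near x or y in 𝒞 V; if this holds for all i, relevance of V
makes d_V(x, y) large. The domains U that charge a fixed V form a chain (`isChain_of_far`), so there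
are few of them. Double counting (`sum_le_of_charging`) shows that at least half of the long
segments keep length at least 1, and these pay for all the length that is lost. -/

/-! ### Gromov products in hyperbolic spaces -/

section Hyperbolic

variable {Z : Type*} [PseudoMetricSpace Z]

/-- The Gromov product `(x | y)_w`. -/
noncomputable def gromovProduct (w x y : Z) : ℝ := (dist w x + dist w y - dist x y) / 2

theorem gromovProduct_comm (w x y : Z) : gromovProduct w x y = gromovProduct w y x := by
  unfold gromovProduct; rw [dist_comm x y]; ring

theorem gromovProduct_nonneg (w x y : Z) : 0 ≤ gromovProduct w x y := by
  unfold gromovProduct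
  linarith [dist_triangle_left x y w]

theorem gromovProduct_le_left (w x y : Z) : gromovProduct w x y ≤ dist w x := by
  unfold gromovProduct
  linarith [dist_triangle w x y]

theorem gromovProduct_add_swap (w x y : Z) :
    gromovProduct w x y + gromovProduct x w y = dist w x := by
  unfold gromovProduct
  rw [dist_comm x w]; ring

theorem dist_sub_dist_le_gromovProduct (w x y : Z) :
    dist w x - dist x y ≤ gromovProduct w x y := by
  unfold gromovProduct
  linarith [dist_triangle_right w x y, dist_triangle w y x, dist_comm x y]

theorem gromovProduct_base_le (w w' x y : Z) :
    gromovProduct w x y ≤ gromovProduct w' x y + dist w w' := by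
  unfold gromovProduct
  linarith [dist_triangle w w' x, dist_triangle w w' y]

theorem gromovProduct_left_le (w x x' y : Z) :
    gromovProduct w x y ≤ gromovProduct w x' y + dist x x' := by
  unfold gromovProduct
  linarith [dist_triangle w x' x, dist_triangle x' x y, dist_comm x x']

theorem gromovProduct_right_le (w x y y' : Z) :
    gromovProduct w x y ≤ gromovProduct w x y' + dist y y' := by
  rw [gromovProduct_comm w x y, gromovProduct_comm w x y']
  exact gromovProduct_left_le w y y' x

theorem IsGeodesicSegment.dist_add {x y z : Z} {γ : Set Z} (h : IsGeodesicSegment x y γ)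
    (hz : z ∈ γ) : dist x z + dist z y = dist x y := by
  obtain ⟨σ, h0, h1, hσ, rfl⟩ := h
  obtain ⟨s, hs, rfl⟩ := hz
  have a := hσ 0 ⟨le_rfl, dist_nonneg⟩ s hs
  have b := hσ s hs (dist x y) ⟨dist_nonneg, le_rfl⟩
  rw [h0] at a; rw [h1] at b
  rw [a, b, abs_sub_comm, abs_of_nonneg (by linarith [hs.1]), abs_sub_comm,
    abs_of_nonneg (by linarith [hs.2])]
  ring

theorem IsGeodesicSegment.left_mem {x y : Z} {γ : Set Z} (h : IsGeodesicSegment x y γ) :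
    x ∈ γ := by
  obtain ⟨σ, h0, h1, hσ, rfl⟩ := h
  exact ⟨0, ⟨le_rfl, dist_nonneg⟩, h0⟩

theorem IsGeodesicSegment.right_mem {x y : Z} {γ : Set Z} (h : IsGeodesicSegment x y γ) :
    y ∈ γ := by
  obtain ⟨σ, h0, h1, hσ, rfl⟩ := h
  exact ⟨_, ⟨dist_nonneg, le_rfl⟩, h1⟩

theorem IsGeodesicSegment.isPreconnected {x y : Z} {γ : Set Z} (h : IsGeodesicSegment x y γ) :
    IsPreconnected γ := by
  obtain ⟨σ, h0, h1, hσ, rfl⟩ := h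
  refine isPreconnected_Icc.image σ ?_
  refine Metric.continuousOn_iff.2 fun b hb ε hε => ⟨ε, hε, fun a ha hab => ?_⟩
  rw [hσ a ha b hb]; rwa [Real.dist_eq] at hab

theorem IsGeodesicSegment.gromovProduct_le {w x y z : Z} {γ : Set Z}
    (h : IsGeodesicSegment x y γ) (hz : z ∈ γ) : gromovProduct w x y ≤ dist w z := by
  unfold gromovProduct
  linarith [h.dist_add hz, dist_triangle w z x, dist_triangle w z y, dist_comm z x]

/-- A geodesic that is covered by the `D`-neighborhoods of two sets which contain its respective
endpoints has a point near both sets. -/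
theorem IsGeodesicSegment.exists_near_both {x y : Z} {γ : Set Z} (h : IsGeodesicSegment x y γ)
    {A B : Set Z} {D ε : ℝ} (hε : 0 < ε) (hD : 0 ≤ D) (hx : x ∈ A) (hy : y ∈ B)
    (hc : ∀ z ∈ γ, Metric.infDist z A ≤ D ∨ Metric.infDist z B ≤ D) :
    ∃ z ∈ γ, (∃ a ∈ A, dist z a ≤ D + ε) ∧ ∃ b ∈ B, dist z b ≤ D + ε := by
  have key := isPreconnected_closed_iff.1 h.isPreconnected
    {z | Metric.infDist z A ≤ D} {z | Metric.infDist z B ≤ D}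
    (isClosed_le (Metric.continuous_infDist_pt A) continuous_const)
    (isClosed_le (Metric.continuous_infDist_pt B) continuous_const)
    (fun z hz => hc z hz)
    ⟨x, h.left_mem, by simpa [Metric.infDist_zero_of_mem hx] using hD⟩
    ⟨y, h.right_mem, by simpa [Metric.infDist_zero_of_mem hy] using hD⟩
  obtain ⟨z, hz, hzA, hzB⟩ := key
  refine ⟨z, hz, ?_, ?_⟩
  · obtain ⟨a, ha, h'⟩ := (Metric.infDist_lt_iff ⟨x, hx⟩).1
      (lt_of_le_of_lt (show Metric.infDist z A ≤ D from hzA) (lt_add_of_pos_right D hε))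
    exact ⟨a, ha, h'.le⟩
  · obtain ⟨a, ha, h'⟩ := (Metric.infDist_lt_iff ⟨y, hy⟩).1
      (lt_of_le_of_lt (show Metric.infDist z B ≤ D from hzB) (lt_add_of_pos_right D hε))
    exact ⟨a, ha, h'.le⟩

variable {δ : ℝ}

/-- By slimness the side [x, y] is covered by neighborhoods of the other two sides. Connectedness
gives a point m near both at once, and its neighbors on those sides compute the Gromov product. -/
theorem IsHyperbolicSpace.exists_near (hZ : IsHyperbolicSpace δ Z) (hδ : 0 ≤ δ) (w x y : Z)
    {γ : Set Z} (h : IsGeodesicSegment x y γ) {ε : ℝ} (hε : 0 < ε) :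
    ∃ m ∈ γ, dist w m ≤ gromovProduct w x y + 2 * δ + ε := by
  obtain ⟨γ₂, h₂⟩ := hZ.geodesic y w
  obtain ⟨γ₃, h₃⟩ := hZ.geodesic x w
  obtain ⟨m, hm, ⟨a, ha, hma⟩, b, hb, hmb⟩ := h.exists_near_both (half_pos hε) hδ h₃.left_mem
    h₂.left_mem (fun z hz => by
      obtain ⟨p, hp, hzp⟩ := hZ.slim x y w γ γ₂ γ₃ h h₂ h₃ z hz
      rcases hp with hp | hp
      · exact Or.inr ((Metric.infDist_le_dist_of_mem hp).trans hzp)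
      · exact Or.inl ((Metric.infDist_le_dist_of_mem hp).trans hzp))
  refine ⟨m, hm, ?_⟩
  have e1 := h.dist_add hm
  have e2 := h₂.dist_add hb
  have e3 := h₃.dist_add ha
  unfold gromovProduct
  linarith [dist_triangle w a m, dist_triangle m a x, dist_triangle w b m, dist_triangle m b y,
    dist_comm m a, dist_comm m b, dist_comm w a, dist_comm w b, dist_comm a x, dist_comm b y,
    dist_comm w x, dist_comm w y, dist_comm m x]

/-- The four point inequality. -/
theorem IsHyperbolicSpace.min_le_gromovProduct (hZ : IsHyperbolicSpace δ Z) (hδ : 0 ≤ δ)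
    (w x y z : Z) :
    min (gromovProduct w x y) (gromovProduct w y z) ≤ gromovProduct w x z + 3 * δ := by
  refine le_of_forall_pos_le_add fun ε hε => ?_
  obtain ⟨γ₁, h₁⟩ := hZ.geodesic x z
  obtain ⟨γ₂, h₂⟩ := hZ.geodesic z y
  obtain ⟨γ₃, h₃⟩ := hZ.geodesic x y
  obtain ⟨m, hm, hwm⟩ := hZ.exists_near hδ w x z h₁ hε
  -- The point p lies on a side from y to x or to z, and the distance from w to any point of a side
  -- bounds the corresponding product.
  obtain ⟨p, hp, hmp⟩ := hZ.slim x z y γ₁ γ₂ γ₃ h₁ h₂ h₃ m hm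
  have := dist_triangle w m p
  rcases hp with hp | hp
  · refine (min_le_right _ _).trans ?_
    rw [gromovProduct_comm]
    linarith [h₂.gromovProduct_le (w := w) hp]
  · refine (min_le_left _ _).trans ?_
    linarith [h₃.gromovProduct_le (w := w) hp]

/-- Cutting the chain in half and using the four point inequality at the midpoint costs 3δ, so the
loss is only logarithmic in the length of the chain. This drives the Morse lemma. -/
theorem IsHyperbolicSpace.le_gromovProduct_of_chain (hZ : IsHyperbolicSpace δ Z) (hδ : 0 ≤ δ)
    (w : Z) (c : ℝ) (k : ℕ) : ∀ (n : ℕ) (x : ℕ → Z), n ≠ 0 → n ≤ 2 ^ k →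
      (∀ i < n, c ≤ gromovProduct w (x i) (x (i + 1))) →
      c - k * (3 * δ) ≤ gromovProduct w (x 0) (x n) := by
  induction k with
  | zero =>
    intro n x h0 hn hx
    obtain rfl : n = 1 := by simp at hn; omega
    simpa using hx 0 one_pos
  | succ k ih =>
    intro n x h0 hn hx
    rcases Nat.lt_or_ge n 2 with h2 | h2
    · obtain rfl : n = 1 := by omega
      have := hx 0 one_pos
      have h3 : 0 ≤ ((k + 1 : ℕ) : ℝ) * (3 * δ) := by positivity
      simp only [zero_add] at this
      linarith
    · have hp : 2 ^ (k + 1) = 2 * 2 ^ k := by ring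
      have a := ih (n / 2) x (by omega) (by omega) (fun i hi => hx i (by omega))
      have b := ih (n - n / 2) (fun i => x (n / 2 + i)) (by omega) (by omega)
        (fun i hi => hx (n / 2 + i) (by omega))
      simp only [add_zero] at b
      rw [show n / 2 + (n - n / 2) = n by omega] at b
      have := hZ.min_le_gromovProduct hδ w (x 0) (x (n / 2)) (x n)
      have := le_min a b
      push_cast
      linarith

end Hyperbolic

/-! ### The Morse lemma -/

theorem exists_linear_le_two_pow (a b : ℝ) : ∃ N : ℕ, ∀ k ≥ N, a * k + b ≤ 2 ^ k := by
  have h1 : Filter.Tendsto (fun k : ℕ => a * ((k : ℝ) ^ 1 / 2 ^ k) + b * (1 / 2 ^ k : ℝ))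
      Filter.atTop (nhds (a * 0 + b * 0)) := by
    refine (Filter.Tendsto.const_mul a ?_).add (Filter.Tendsto.const_mul b ?_)
    · exact tendsto_pow_const_div_const_pow_of_one_lt 1 (by norm_num)
    · have := tendsto_pow_const_div_const_pow_of_one_lt 0 (r := (2 : ℝ)) (by norm_num)
      simpa using this
  have h2 := h1.eventually (gt_mem_nhds (show a * 0 + b * 0 < (1 : ℝ) by norm_num))
  obtain ⟨N, hN⟩ := Filter.eventually_atTop.1 h2
  refine ⟨N, fun k hk => ?_⟩
  have h3 := hN k hk
  have h4 : (0 : ℝ) < 2 ^ k := by positivity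
  have h5 : a * ((k : ℝ) ^ 1 / 2 ^ k) + b * (1 / 2 ^ k : ℝ) = (a * k + b) / 2 ^ k := by
    field_simp
  rw [h5, div_lt_one h4] at h3
  exact h3.le

/-- With k of order D / (3|δ| + 1), the loss k · 3δ stays below D while 2 ^ k outgrows every linear
function of D. All large D are covered because D will be an unknown supremum. -/
theorem exists_morse_bound (δ κ ε : ℝ) : ∃ D₀ : ℝ, 0 ≤ D₀ ∧ ∀ D ≥ D₀, ∃ k : ℕ,
    κ * (6 * D + 2 + ε) + 3 ≤ 2 ^ k ∧ 1 + κ + ε + (k + 2) * (3 * δ) < D := by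
  obtain ⟨N, hN⟩ := exists_linear_le_two_pow (|κ| * (6 * (3 * |δ| + 1)))
    (|κ| * (6 * (3 * |δ| + 1 + (1 + |κ| + |ε| + 2 * (3 * |δ|) + 1)) + 2 + |ε|) + 3)
  set e := 1 + |κ| + |ε| + 2 * (3 * |δ|) + 1 with he
  set g := 3 * |δ| + 1 with hg
  have hg0 : 0 < g := by positivity
  have he0 : 0 < e := by positivity
  refine ⟨e + g * N, by positivity, fun D hD => ⟨⌊(D - e) / g⌋₊, ?_, ?_⟩⟩
  · have h0 : (N : ℝ) ≤ (D - e) / g := by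
      rw [le_div_iff₀ hg0]; linarith
    have hk : N ≤ ⌊(D - e) / g⌋₊ := Nat.le_floor h0
    have h1 := hN _ hk
    set k := ⌊(D - e) / g⌋₊
    have h2 : (D - e) / g < k + 1 := Nat.lt_floor_add_one _
    rw [div_lt_iff₀ hg0] at h2
    have hD0 : 0 ≤ D := le_trans (by positivity) hD
    have hκ := le_abs_self κ
    have hε := le_abs_self ε
    calc κ * (6 * D + 2 + ε) + 3 ≤ |κ| * (6 * D + 2 + |ε|) + 3 := by
          have : κ * (6 * D + 2 + ε) ≤ |κ * (6 * D + 2 + ε)| := le_abs_self _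
          rw [abs_mul] at this
          have h3 : |6 * D + 2 + ε| ≤ 6 * D + 2 + |ε| := by
            refine (abs_add_le _ _).trans ?_
            rw [abs_of_nonneg (by positivity : (0 : ℝ) ≤ 6 * D + 2)]
          have := mul_le_mul_of_nonneg_left h3 (abs_nonneg κ)
          linarith
      _ ≤ |κ| * (6 * (g * (k + 1) + e) + 2 + |ε|) + 3 := by
          gcongr
          nlinarith
      _ = |κ| * (6 * g) * k + (|κ| * (6 * (g + e) + 2 + |ε|) + 3) := by ring
      _ ≤ 2 ^ k := h1
  · have h3 : (⌊(D - e) / g⌋₊ : ℝ) ≤ (D - e) / g := Nat.floor_le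
      (div_nonneg (by nlinarith [hD, mul_nonneg hg0.le (Nat.cast_nonneg (α := ℝ) N)]) hg0.le)
    rw [le_div_iff₀ hg0] at h3
    set k := ⌊(D - e) / g⌋₊
    have h4 : (k : ℝ) * (3 * δ) ≤ k * g := by
      gcongr
      linarith [le_abs_self δ]
    linarith [le_abs_self κ, le_abs_self ε, le_abs_self δ]

/-- The distance from a geodesic to a `(κ, ε)`-quasigeodesic with the same endpoints. -/
noncomputable def morseDist (δ κ ε : ℝ) : ℝ := (exists_morse_bound δ κ ε).choose

theorem morseDist_nonneg (δ κ ε : ℝ) : 0 ≤ morseDist δ κ ε :=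
  (exists_morse_bound δ κ ε).choose_spec.1

theorem morseDist_spec (δ κ ε : ℝ) : ∀ D ≥ morseDist δ κ ε, ∃ k : ℕ,
    κ * (6 * D + 2 + ε) + 3 ≤ 2 ^ k ∧ 1 + κ + ε + (k + 2) * (3 * δ) < D :=
  (exists_morse_bound δ κ ε).choose_spec.2

section Morse

variable {Z : Type*} [PseudoMetricSpace Z] {δ κ ε : ℝ}

theorem IsQIEmbeddingOn.exists_chain {f : ℝ → Z} {S : Set ℝ} (hκ : 0 < κ)
    (hf : IsQIEmbeddingOn κ ε S f) (hS : S.OrdConnected) {s₁ s₂ : ℝ} (h₁ : s₁ ∈ S)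
    (h₂ : s₂ ∈ S) :
    ∃ (m : ℕ) (x : ℕ → Z), m ≠ 0 ∧ (m : ℝ) ≤ κ * (dist (f s₁) (f s₂) + ε) + 2 ∧
      x 0 = f s₁ ∧ x m = f s₂ ∧ (∀ i ≤ m, x i ∈ f '' S) ∧
      ∀ i < m, dist (x i) (x (i + 1)) ≤ κ + ε := by
  have hl := (hf s₁ h₁ s₂ h₂).1
  set m := ⌈|s₁ - s₂|⌉₊ + 1
  have hm : (0 : ℝ) < m := by positivity
  have hm1 : |s₁ - s₂| ≤ m := (Nat.le_ceil _).trans (by simp [m])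
  have hmem : ∀ i ≤ m, s₁ + i * ((s₂ - s₁) / m) ∈ S := by
    intro i hi
    have hi' : (i : ℝ) / m ≤ 1 := (div_le_one hm).2 (by exact_mod_cast hi)
    have hi0 : (0 : ℝ) ≤ (i : ℝ) / m := by positivity
    have := hS.uIcc_subset h₁ h₂
    refine this ?_
    rw [show s₁ + i * ((s₂ - s₁) / m) = s₁ + (i / m) * (s₂ - s₁) by ring]
    rw [mem_uIcc]
    rcases le_total s₁ s₂ with h | h
    · left; constructor <;> nlinarith
    · right; constructor <;> nlinarith
  refine ⟨m, fun i => f (s₁ + i * ((s₂ - s₁) / m)), by positivity, ?_, by simp, ?_, ?_, ?_⟩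
  · have h1 : (m : ℝ) ≤ |s₁ - s₂| + 2 := by
      have := Nat.ceil_lt_add_one (abs_nonneg (s₁ - s₂))
      simp only [m]; push_cast; linarith
    rw [Real.dist_eq] at hl
    have h2 : κ⁻¹ * |s₁ - s₂| ≤ dist (f s₁) (f s₂) + ε := by linarith
    rw [inv_mul_le_iff₀ hκ] at h2
    linarith
  · simp only
    congr 1
    field_simp
    ring
  · intro i hi
    exact ⟨_, hmem i hi, rfl⟩
  · intro i hi
    have h := (hf _ (hmem i hi.le) _ (hmem (i + 1) hi)).2
    refine h.trans ?_
    rw [Real.dist_eq, show s₁ + i * ((s₂ - s₁) / m) - (s₁ + (i + 1 : ℕ) * ((s₂ - s₁) / m))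
      = (s₁ - s₂) / m by push_cast; ring, abs_div, abs_of_pos hm]
    have : |s₁ - s₂| / m ≤ 1 := (div_le_one hm).2 hm1
    nlinarith

/-- The first half of the Morse lemma: geodesics are close to quasigeodesics. -/
theorem IsHyperbolicSpace.infDist_le_morseDist (hZ : IsHyperbolicSpace δ Z) (hδ : 0 ≤ δ)
    (hκ : 0 < κ) (hε : 0 ≤ ε) {f : ℝ → Z} {a b : ℝ} (hab : a ≤ b)
    (hf : IsQIEmbeddingOn κ ε (Icc a b) f) {γ : Set Z} (hγ : IsGeodesicSegment (f a) (f b) γ)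
    {z : Z} (hz : z ∈ γ) : Metric.infDist z (f '' Icc a b) ≤ morseDist δ κ ε := by
  obtain ⟨σ, h0, h1, hσ, rfl⟩ := hγ
  set d := dist (f a) (f b)
  have hd : 0 ≤ d := dist_nonneg
  set Q := f '' Icc a b
  have hQa : f a ∈ Q := ⟨a, ⟨le_rfl, hab⟩, rfl⟩
  have hQb : f b ∈ Q := ⟨b, ⟨hab, le_rfl⟩, rfl⟩
  set I := (fun u => Metric.infDist (σ u) Q) '' Icc 0 d
  have hbdd : BddAbove I := by
    refine ⟨d, ?_⟩
    rintro _ ⟨u, hu, rfl⟩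
    refine (Metric.infDist_le_dist_of_mem hQa).trans ?_
    rw [← h0, hσ u hu 0 ⟨le_rfl, hd⟩, sub_zero, abs_of_nonneg hu.1]
    exact hu.2
  have hne : I.Nonempty := ⟨_, 0, ⟨le_rfl, hd⟩, rfl⟩
  obtain ⟨u₀, hu₀, rfl⟩ := hz
  refine (le_csSup hbdd (mem_image_of_mem _ hu₀)).trans ?_
  -- D is the largest distance from the geodesic to Q. At a point w that nearly attains it, Q stays
  -- D - 1 away from w, so a chain in Q has large Gromov products based at w, although its ends are
  -- near points on opposite sides of w.
  set D := sSup I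
  by_contra! hD
  obtain ⟨k, hk1, hk2⟩ := morseDist_spec δ κ ε D hD.le
  have hD0 : 0 ≤ D := (morseDist_nonneg δ κ ε).trans hD.le
  obtain ⟨_, ⟨u, hu, rfl⟩, hDu⟩ := exists_lt_of_lt_csSup hne (show D - 1 < D by linarith)
  simp only at hDu
  set w := σ u
  have hfar : ∀ q ∈ Q, D - 1 < dist w q := fun q hq =>
    hDu.trans_le (Metric.infDist_le_dist_of_mem hq)
  have hnear : ∀ v ∈ Icc 0 d, ∃ q ∈ Q, dist (σ v) q < D + 1 := fun v hv =>
    (Metric.infDist_lt_iff ⟨_, hQa⟩).1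
      ((le_csSup hbdd (mem_image_of_mem _ hv)).trans_lt (lt_add_one D))
  -- Going back 2D along the geodesic and then at most D + 1 to Q leaves a Gromov product of at
  -- least D - 1. If the geodesic ends earlier, its endpoint already lies in Q.
  have hY : ∃ v ∈ Icc 0 u, u - v ≤ 2 * D ∧ ∃ q ∈ Q, dist (σ v) q ≤ D + 1 ∧
      D - 1 ≤ gromovProduct w (σ v) q := by
    rcases le_total u (2 * D) with h | h
    · refine ⟨0, ⟨le_rfl, hu.1⟩, by linarith, f a, hQa, ?_, ?_⟩
      · rw [h0, dist_self]; linarith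
      · have := hfar _ hQa
        rw [h0]; simp only [gromovProduct, dist_self]; linarith
    · have hv : u - 2 * D ∈ Icc 0 d := ⟨by linarith, by linarith [hu.2]⟩
      obtain ⟨q, hq, hq'⟩ := hnear _ hv
      refine ⟨u - 2 * D, ⟨by linarith, by linarith⟩, by linarith, q, hq, hq'.le, ?_⟩
      refine le_trans ?_ (dist_sub_dist_le_gromovProduct _ _ _)
      rw [hσ u hu _ hv, show u - (u - 2 * D) = 2 * D by ring, abs_of_nonneg (by linarith)]
      linarith
  have hW : ∃ v ∈ Icc u d, v - u ≤ 2 * D ∧ ∃ q ∈ Q, dist (σ v) q ≤ D + 1 ∧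
      D - 1 ≤ gromovProduct w (σ v) q := by
    rcases le_total (d - u) (2 * D) with h | h
    · refine ⟨d, ⟨hu.2, le_rfl⟩, by linarith, f b, hQb, ?_, ?_⟩
      · rw [h1, dist_self]; linarith
      · have := hfar _ hQb
        rw [h1]; simp only [gromovProduct, dist_self]; linarith
    · have hv : u + 2 * D ∈ Icc 0 d := ⟨by linarith [hu.1], by linarith⟩
      obtain ⟨q, hq, hq'⟩ := hnear _ hv
      refine ⟨u + 2 * D, ⟨by linarith, by linarith⟩, by linarith, q, hq, hq'.le, ?_⟩
      refine le_trans ?_ (dist_sub_dist_le_gromovProduct _ _ _)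
      rw [hσ u hu _ hv, show u - (u + 2 * D) = -(2 * D) by ring, abs_neg,
        abs_of_nonneg (by linarith)]
      linarith
  obtain ⟨v₁, hv₁, hv₁', q₁, hq₁, hd₁, hg₁⟩ := hY
  obtain ⟨v₂, hv₂, hv₂', q₂, hq₂, hd₂, hg₂⟩ := hW
  have m₁ : v₁ ∈ Icc 0 d := ⟨hv₁.1, hv₁.2.trans hu.2⟩
  have m₂ : v₂ ∈ Icc 0 d := ⟨hu.1.trans hv₂.1, hv₂.2⟩
  have hv12 : dist (σ v₁) (σ v₂) = v₂ - v₁ := by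
    rw [hσ _ m₁ _ m₂, abs_sub_comm, abs_of_nonneg (by linarith [hv₁.2, hv₂.1])]
  have hzero : gromovProduct w (σ v₁) (σ v₂) = 0 := by
    unfold gromovProduct
    rw [hσ _ hu _ m₁, hσ _ hu _ m₂, hv12, abs_of_nonneg (by linarith [hv₁.2]), abs_sub_comm,
      abs_of_nonneg (by linarith [hv₂.1])]
    ring
  obtain ⟨s₁, hs₁, rfl⟩ := hq₁
  obtain ⟨s₂, hs₂, rfl⟩ := hq₂
  obtain ⟨m, x, hm0, hm, hx0, hxm, hxQ, hx⟩ := hf.exists_chain hκ ordConnected_Icc hs₁ hs₂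
  have hq12 : dist (f s₁) (f s₂) ≤ 6 * D + 2 := by
    linarith [dist_triangle (f s₁) (σ v₁) (f s₂), dist_triangle (σ v₁) (σ v₂) (f s₂),
      dist_comm (f s₁) (σ v₁)]
  have hm' : (m : ℝ) ≤ 2 ^ k := by
    have : κ * (dist (f s₁) (f s₂) + ε) ≤ κ * (6 * D + 2 + ε) := by gcongr
    linarith
  have hc := hZ.le_gromovProduct_of_chain hδ w (D - 1 - κ - ε) k m x hm0 (by exact_mod_cast hm')
    (fun i hi => by
      have h1 := dist_sub_dist_le_gromovProduct w (x i) (x (i + 1))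
      linarith [hx i hi, hfar _ (hxQ i hi.le)])
  rw [hx0, hxm] at hc
  -- Two more four point inequalities join the chain to the geodesic, whence k + 2 in
  -- `morseDist_spec`; the resulting lower bound contradicts `hzero`.
  have t1 := hZ.min_le_gromovProduct hδ w (σ v₁) (f s₁) (f s₂)
  have t2 := hZ.min_le_gromovProduct hδ w (σ v₁) (f s₂) (σ v₂)
  rw [gromovProduct_comm w (f s₂)] at t2
  have hk0 : 0 ≤ (k : ℝ) * (3 * δ) := by positivity
  have t3 := le_min (show D - 1 - κ - ε - k * (3 * δ) ≤ gromovProduct w (σ v₁) (f s₁) by linarith)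
    hc
  have t4 := le_min (show D - 1 - κ - ε - k * (3 * δ) - 3 * δ ≤ gromovProduct w (σ v₁) (f s₂) by
    linarith) (show D - 1 - κ - ε - k * (3 * δ) - 3 * δ ≤ gromovProduct w (σ v₂) (f s₂) by
    linarith)
  linarith

/-- The constant of the Morse lemma for `(κ, ε)`-quasigeodesics in `δ`-hyperbolic spaces. -/
noncomputable def morseConst (δ κ ε : ℝ) : ℝ :=
  κ * (κ * (2 * morseDist δ κ ε + 2 + ε)) + ε + morseDist δ κ ε + 1

theorem morseConst_nonneg (hκ : 0 ≤ κ) (hε : 0 ≤ ε) : 0 ≤ morseConst δ κ ε := by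
  have := morseDist_nonneg δ κ ε
  unfold morseConst
  positivity

/-- The Morse lemma: quasigeodesics are close to geodesics. -/
theorem IsHyperbolicSpace.gromovProduct_le_morseConst (hZ : IsHyperbolicSpace δ Z) (hδ : 0 ≤ δ)
    (hκ : 0 < κ) (hε : 0 ≤ ε) {f : ℝ → Z} {a b s : ℝ} (hs : s ∈ Icc a b)
    (hf : IsQIEmbeddingOn κ ε (Icc a b) f) :
    gromovProduct (f s) (f a) (f b) ≤ morseConst δ κ ε := by
  have hab : a ≤ b := hs.1.trans hs.2
  obtain ⟨γ, hγ⟩ := hZ.geodesic (f a) (f b)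
  -- Neighborhoods of the parts of the quasigeodesic before and after s cover the geodesic. A point
  -- near both parts traps s between two close parameters.
  obtain ⟨z, hz, ⟨_, ⟨s₁, h₁, rfl⟩, hd₁⟩, _, ⟨s₂, h₂, rfl⟩, hd₂⟩ :=
    hγ.exists_near_both (A := f '' Icc a s) (B := f '' Icc s b) one_pos (morseDist_nonneg δ κ ε)
      ⟨a, ⟨le_rfl, hs.1⟩, rfl⟩ ⟨b, ⟨hs.2, le_rfl⟩, rfl⟩ (fun z hz => by
        have h := hZ.infDist_le_morseDist hδ hκ hε hab hf hγ hz
        by_contra! hc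
        have hne : (f '' Icc a b).Nonempty := ⟨f a, a, ⟨le_rfl, hab⟩, rfl⟩
        obtain ⟨_, ⟨s', hs', rfl⟩, hlt⟩ := (Metric.infDist_lt_iff hne).1
          (h.trans_lt (lt_min hc.1 hc.2))
        rcases le_total s' s with h' | h'
        · exact absurd ((Metric.infDist_le_dist_of_mem (s := f '' Icc a s)
            ⟨s', ⟨hs'.1, h'⟩, rfl⟩).trans_lt hlt) (not_lt.2 (min_le_left _ _))
        · exact absurd ((Metric.infDist_le_dist_of_mem (s := f '' Icc s b)
            ⟨s', ⟨h', hs'.2⟩, rfl⟩).trans_lt hlt) (not_lt.2 (min_le_right _ _)))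
  refine (hγ.gromovProduct_le hz).trans ?_
  have m₁ : s₁ ∈ Icc a b := ⟨h₁.1, h₁.2.trans hs.2⟩
  have m₂ : s₂ ∈ Icc a b := ⟨hs.1.trans h₂.1, h₂.2⟩
  have e1 := (hf _ m₁ _ m₂).1
  have e2 := (hf _ hs _ m₁).2
  rw [Real.dist_eq, abs_sub_comm, abs_of_nonneg (by linarith [h₁.2, h₂.1])] at e1
  rw [Real.dist_eq, abs_of_nonneg (by linarith [h₁.2])] at e2
  have e3 : κ⁻¹ * (s₂ - s₁) ≤ 2 * morseDist δ κ ε + 2 + ε := by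
    linarith [dist_triangle (f s₁) z (f s₂), dist_comm (f s₁) z]
  rw [inv_mul_le_iff₀ hκ] at e3
  have e4 : κ * (s - s₁) ≤ κ * (κ * (2 * morseDist δ κ ε + 2 + ε)) := by
    gcongr
    linarith [h₂.1]
  unfold morseConst
  linarith [dist_triangle (f s) (f s₁) z, dist_comm (f s₁) z]

end Morse

/-! ### Set distances and diameters -/

theorem setEDist_le_edist {Z : Type*} [PseudoEMetricSpace Z] {A B : Set Z} {a b : Z} (ha : a ∈ A)
    (hb : b ∈ B) : setEDist A B ≤ edist a b :=
  (iInf₂_le a ha).trans (iInf₂_le b hb)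

theorem exists_edist_lt_of_setEDist_lt {Z : Type*} [PseudoEMetricSpace Z] {A B : Set Z}
    {e : ℝ≥0∞} (h : setEDist A B < e) : ∃ a ∈ A, ∃ b ∈ B, edist a b < e := by
  simp only [setEDist, iInf_lt_iff] at h
  obtain ⟨a, ha, b, hb, h⟩ := h
  exact ⟨a, ha, b, hb, h⟩

theorem exists_dist_lt_of_setEDist_lt {Z : Type*} [PseudoMetricSpace Z] {A B : Set Z}
    {κ : ℝ} (h : setEDist A B < ENNReal.ofReal κ) : ∃ a ∈ A, ∃ b ∈ B, dist a b < κ := by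
  obtain ⟨a, ha, b, hb, hab⟩ := exists_edist_lt_of_setEDist_lt h
  refine ⟨a, ha, b, hb, ?_⟩
  rw [edist_dist] at hab
  exact (ENNReal.ofReal_lt_ofReal_iff_of_nonneg dist_nonneg).1 hab

theorem exists_dist_lt_of_setEDist_le {Z : Type*} [PseudoMetricSpace Z] {A B : Set Z}
    {κ : ℝ} (hκ : 0 ≤ κ) (h : setEDist A B ≤ ENNReal.ofReal κ) :
    ∃ a ∈ A, ∃ b ∈ B, dist a b < κ + 1 :=
  exists_dist_lt_of_setEDist_lt
    (h.trans_lt ((ENNReal.ofReal_lt_ofReal_iff (by linarith)).2 (lt_add_one κ)))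

theorem exists_dist_lt_of_infEDist_le {Z : Type*} [PseudoMetricSpace Z] {a : Z} {B : Set Z}
    {κ : ℝ} (hκ : 0 ≤ κ) (h : Metric.infEDist a B ≤ ENNReal.ofReal κ) :
    ∃ b ∈ B, dist a b < κ + 1 := by
  obtain ⟨b, hb, hab⟩ := Metric.infEDist_lt_iff.1
    (h.trans_lt ((ENNReal.ofReal_lt_ofReal_iff (by linarith)).2 (lt_add_one κ)))
  refine ⟨b, hb, ?_⟩
  rw [edist_dist] at hab
  exact (ENNReal.ofReal_lt_ofReal_iff_of_nonneg dist_nonneg).1 hab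

theorem dist_le_of_ediam_le {Z : Type*} [PseudoMetricSpace Z] {A : Set Z} {ξ : ℝ} (hξ : 0 ≤ ξ)
    (h : Metric.ediam A ≤ ENNReal.ofReal ξ) {a b : Z} (ha : a ∈ A) (hb : b ∈ A) :
    dist a b ≤ ξ := by
  have := (Metric.edist_le_ediam_of_mem ha hb).trans h
  rw [edist_dist] at this
  exact (ENNReal.ofReal_le_ofReal_iff hξ).1 this

theorem ediam_le_ofReal {Z : Type*} [PseudoMetricSpace Z] {A : Set Z} {ξ : ℝ}
    (h : ∀ a ∈ A, ∀ b ∈ A, dist a b ≤ ξ) : Metric.ediam A ≤ ENNReal.ofReal ξ :=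
  Metric.ediam_le fun a ha b hb => by
    rw [edist_dist]; exact ENNReal.ofReal_le_ofReal (h a ha b hb)

theorem IsQIEmbeddingOn.dist_le {Y Z : Type*} [PseudoMetricSpace Y] [PseudoMetricSpace Z]
    {κ ε : ℝ} (hκ : 0 < κ) {S : Set Y} {f : Y → Z} (h : IsQIEmbeddingOn κ ε S f) {s s' : Y}
    (hs : s ∈ S) (hs' : s' ∈ S) : dist s s' ≤ κ * (dist (f s) (f s') + ε) := by
  have := (h s hs s' hs').1
  rw [← inv_mul_le_iff₀ hκ]
  linarith

/-! ### Hierarchically hyperbolic spaces: points -/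

namespace HHSConstants

/-- A bound for the failure of the consistency inequalities. -/
noncomputable def cons (c : HHSConstants) : ℝ := c.κ₀ + 2 * c.ξ + 1

/-- If the Gromov product of two points based at `ρ^V_U` is at least this number, then the bounded
geodesic image axiom applies to the geodesics between them. -/
noncomputable def bgi (c : HHSConstants) : ℝ := 4 * c.E + 2

theorem cons_pos (c : HHSConstants) : 0 < c.cons := by
  have := c.κ₀_nonneg; have := c.ξ_nonneg
  unfold cons; positivity

theorem cons_lt_bgi (c : HHSConstants) : c.cons < c.bgi := by
  have := c.κ₀_le_E; have := c.ξ_le_E; have := c.E_pos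
  unfold cons bgi; linarith

theorem bgi_pos (c : HHSConstants) : 0 < c.bgi := c.cons_pos.trans c.cons_lt_bgi

end HHSConstants

namespace IsNormalizedHHS

variable {X : Type u} [MetricSpace X] {𝔖 : Type v} [PartialOrder 𝔖] {𝒞 : 𝔖 → Type w}
  [∀ U, MetricSpace (𝒞 U)] {c : HHSConstants} {D : HHSData X 𝔖 𝒞}

/-- A point of the set `π_U(x)`. -/
noncomputable def pr (hD : IsNormalizedHHS c D) (U : 𝔖) (x : X) : 𝒞 U :=
  (hD.proj_nonempty U x).some

variable (hD : IsNormalizedHHS c D)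
include hD

theorem pr_mem (U : 𝔖) (x : X) : hD.pr U x ∈ D.proj U x := (hD.proj_nonempty U x).some_mem

theorem dist_pr_le {U : 𝔖} {x : X} {p : 𝒞 U} (hp : p ∈ D.proj U x) :
    dist p (hD.pr U x) ≤ c.ξ :=
  dist_le_of_ediam_le c.ξ_nonneg (hD.proj_diam U x) hp (hD.pr_mem U x)

theorem dist_rho_le {V U : 𝔖} (h : V < U ∨ D.Transverse V U) {p q : 𝒞 U} (hp : p ∈ D.rho V U)
    (hq : q ∈ D.rho V U) : dist p q ≤ c.ξ :=
  dist_le_of_ediam_le c.ξ_nonneg (hD.rho_diam V U h) hp hq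

theorem ofReal_dist_le_d (U : 𝔖) (x y : X) :
    ENNReal.ofReal (dist (hD.pr U x) (hD.pr U y)) ≤ D.d U x y := by
  rw [← edist_dist]
  exact Metric.edist_le_ediam_of_mem (Or.inl (hD.pr_mem U x)) (Or.inr (hD.pr_mem U y))

theorem d_le (U : 𝔖) (x y : X) :
    D.d U x y ≤ ENNReal.ofReal (dist (hD.pr U x) (hD.pr U y) + 2 * c.ξ) := by
  have hξ := c.ξ_nonneg
  have hxy : 0 ≤ dist (hD.pr U x) (hD.pr U y) := dist_nonneg
  refine ediam_le_ofReal ?_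
  rintro a (ha | ha) b (hb | hb)
  · linarith [dist_triangle_right a b (hD.pr U x), hD.dist_pr_le ha, hD.dist_pr_le hb]
  · linarith [dist_triangle4_right a b (hD.pr U x) (hD.pr U y), hD.dist_pr_le ha,
      hD.dist_pr_le hb]
  · linarith [dist_triangle4_right a b (hD.pr U y) (hD.pr U x), hD.dist_pr_le ha,
      hD.dist_pr_le hb, dist_comm (hD.pr U x) (hD.pr U y)]
  · linarith [dist_triangle_right a b (hD.pr U y), hD.dist_pr_le ha, hD.dist_pr_le hb]

theorem d_ne_top (U : 𝔖) (x y : X) : D.d U x y ≠ ⊤ :=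
  ((hD.d_le U x y).trans_lt ENNReal.ofReal_lt_top).ne

theorem transverse_symm {V U : 𝔖} (h : D.Transverse V U) : D.Transverse U V :=
  ⟨fun h' => h.1 (hD.orth_symm _ _ h'), h.2.2, h.2.1⟩

theorem dist_pr_rho_lt {V U : 𝔖} (h : V < U ∨ D.Transverse V U) {x : X} {w : 𝒞 U}
    (hw : w ∈ D.rho V U)
    (h' : setEDist (D.proj U x) (D.rho V U) ≤ ENNReal.ofReal c.κ₀) :
    dist (hD.pr U x) w < c.cons := by
  obtain ⟨a, ha, b, hb, hab⟩ := exists_dist_lt_of_setEDist_le c.κ₀_nonneg h'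
  unfold HHSConstants.cons
  linarith [dist_triangle4 (hD.pr U x) a b w, hD.dist_pr_le ha, hD.dist_rho_le h hb hw,
    dist_comm a (hD.pr U x)]

theorem transverse_dist_lt {V W : 𝔖} (h : D.Transverse V W) (x : X) {w : 𝒞 W} {w' : 𝒞 V}
    (hw : w ∈ D.rho V W) (hw' : w' ∈ D.rho W V) :
    dist (hD.pr W x) w < c.cons ∨ dist (hD.pr V x) w' < c.cons := by
  rcases min_le_iff.1 (hD.transverse_consistency V W x h) with h' | h'
  · exact Or.inl (hD.dist_pr_rho_lt (Or.inr h) hw h')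
  · exact Or.inr (hD.dist_pr_rho_lt (Or.inr (hD.transverse_symm h)) hw' h')

theorem nested_dist_le {V U : 𝔖} (h : V < U) {x : X} {w : 𝒞 U} (hw : w ∈ D.rho V U)
    (hx : c.cons ≤ dist (hD.pr U x) w) {p : 𝒞 V} (hp : p ∈ D.rhoMap U V (hD.pr U x)) :
    dist (hD.pr V x) p ≤ c.E := by
  rcases min_le_iff.1 (hD.nested_consistency V U x h) with h' | h'
  · exact absurd (hD.dist_pr_rho_lt (Or.inl h) hw h') (not_lt.2 hx)
  · exact (dist_le_of_ediam_le c.κ₀_nonneg h' (Or.inl (hD.pr_mem V x))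
      (Or.inr (mem_biUnion (hD.pr_mem U x) hp))).trans c.κ₀_le_E

/-- A geodesic that is far from `ρ^V_U` has a bounded image in `𝒞 V`. -/
theorem dist_rhoMap_le {V U : 𝔖} (h : V < U) {z z' w : 𝒞 U} (hw : w ∈ D.rho V U)
    (hg : c.bgi ≤ gromovProduct w z z') {p p' : 𝒞 V} (hp : p ∈ D.rhoMap U V z)
    (hp' : p' ∈ D.rhoMap U V z') : dist p p' ≤ c.E := by
  obtain ⟨γ, hγ⟩ := (hD.hyperbolic U).geodesic z z'
  rcases hD.bounded_geodesic_image V U h z z' γ hγ with h' | ⟨y, hy, h'⟩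
  · exact dist_le_of_ediam_le c.E_pos.le h' (mem_biUnion hγ.left_mem hp)
      (mem_biUnion hγ.right_mem hp')
  · exfalso
    obtain ⟨b, hb, hyb⟩ := Metric.infEDist_lt_iff.1 h'
    rw [edist_dist, ENNReal.ofReal_lt_ofReal_iff c.E_pos] at hyb
    have := hγ.gromovProduct_le (w := w) hy
    have := hD.dist_rho_le (Or.inl h) hw hb
    have := c.ξ_le_E
    have := c.E_pos
    unfold HHSConstants.bgi at hg
    linarith [dist_triangle_right w y b]

theorem dist_rhoMap_pr_le {V U : 𝔖} (h : V < U) {z w : 𝒞 U} (hw : w ∈ D.rho V U) {x : X}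
    (hg : c.bgi ≤ gromovProduct w z (hD.pr U x)) {p : 𝒞 V} (hp : p ∈ D.rhoMap U V z) :
    dist p (hD.pr V x) ≤ 2 * c.E := by
  obtain ⟨q, hq⟩ := hD.rhoMap_nonempty V U h (hD.pr U x)
  have h1 := hD.dist_rhoMap_le h hw hg hp hq
  have h2 : c.cons ≤ dist (hD.pr U x) w := by
    rw [gromovProduct_comm] at hg
    rw [dist_comm]
    linarith [gromovProduct_le_left w (hD.pr U x) z, c.cons_lt_bgi]
  linarith [dist_triangle_right p (hD.pr V x) q, hD.nested_dist_le h hw h2 hq]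

/-- Bounded geodesic image in the form used for points of X. As `bgi` exceeds `cons`, both ends are
far enough from ρ^V_U for nested consistency: the bound is E for the geodesic and E for each end. -/
theorem dist_pr_pr_le {V U : 𝔖} (h : V < U) {w : 𝒞 U} (hw : w ∈ D.rho V U) {x y : X}
    (hg : c.bgi ≤ gromovProduct w (hD.pr U x) (hD.pr U y)) :
    dist (hD.pr V x) (hD.pr V y) ≤ 3 * c.E := by
  obtain ⟨q, hq⟩ := hD.rhoMap_nonempty V U h (hD.pr U x)
  have h1 := hD.dist_rhoMap_pr_le h hw hg hq
  have h2 : c.cons ≤ dist (hD.pr U x) w := by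
    rw [dist_comm]
    linarith [gromovProduct_le_left w (hD.pr U x) (hD.pr U y), c.cons_lt_bgi]
  linarith [dist_triangle (hD.pr V x) q (hD.pr V y), hD.nested_dist_le h hw h2 hq]

/-- The domains `U` containing `V` such that `x` is far from `ρ^V_U` form a chain. -/
theorem isChain_of_far (V : 𝔖) (x : X) {s : Set 𝔖}
    (hs : ∀ U ∈ s, V < U ∧ ∀ w ∈ D.rho V U, 2 * c.cons ≤ dist (hD.pr U x) w) :
    IsChain (· ≤ ·) s := by
  have key : ∀ U₁ ∈ s, ∀ U₂ ∈ s, D.Transverse U₁ U₂ → ∀ w ∈ D.rho U₁ U₂,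
      ¬ dist (hD.pr U₂ x) w < c.cons := by
    intro U₁ h₁ U₂ h₂ hT w hw hlt
    have ho : ¬ D.Orth U₂ V := fun h =>
      hD.orth_not_le _ _ (hD.orth_symm _ _ h) (hs U₂ h₂).1.le
    -- Since V is nested in U₁, the relative projections of V and U₁ to U₂ nearly coincide, so x
    -- cannot be near one and far from the other.
    obtain ⟨a, ha, b, hb, hab⟩ := exists_dist_lt_of_setEDist_le c.κ₀_nonneg
      (hD.rho_coherent V U₁ U₂ (hs U₁ h₁).1 (Or.inr ⟨hT, ho⟩))
    have h3 := (hs U₂ h₂).2 a ha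
    have h4 := hD.dist_rho_le (Or.inr hT) hb hw
    have h5 := c.ξ_nonneg
    unfold HHSConstants.cons at *
    linarith [dist_triangle4 (hD.pr U₂ x) w b a, dist_comm a b, dist_comm b w]
  intro U₁ h₁ U₂ h₂ _
  by_contra hc
  push Not at hc
  -- Orthogonality of U₁ and U₂ would pass to V and U₂, although V is nested in U₂.
  have hT : D.Transverse U₁ U₂ := by
    refine ⟨fun ho => ?_, hc.1, hc.2⟩
    exact hD.orth_not_le V U₂ (hD.orth_mono V U₁ U₂ (hs U₁ h₁).1.le ho) (hs U₂ h₂).1.le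
  have hT' := hD.transverse_symm hT
  obtain ⟨w, hw⟩ := hD.rho_nonempty U₁ U₂ (Or.inr hT)
  obtain ⟨w', hw'⟩ := hD.rho_nonempty U₂ U₁ (Or.inr hT')
  rcases hD.transverse_dist_lt hT x hw hw' with h | h
  · exact key U₁ h₁ U₂ h₂ hT w hw h
  · exact key U₂ h₂ U₁ h₁ hT' w' hw' h

/-- After removing one element a, the others are nested in a container properly below T. Induction
inside the container gives a chain, and T is put on top. -/
theorem exists_chain_of_orth (s : Finset 𝔖) : ∀ T : 𝔖, s.Nonempty → (∀ V ∈ s, V ≤ T) →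
    (s : Set 𝔖).Pairwise D.Orth →
    ∃ C : Set 𝔖, IsChain (· ≤ ·) C ∧ (∀ W ∈ C, W ≤ T) ∧ (s.card : ℕ∞) ≤ C.encard := by
  classical
  induction s using Finset.induction_on with
  | empty => intro T h; simp at h
  | insert a s ha ih =>
    intro T _ hT hp
    rcases s.eq_empty_or_nonempty with rfl | hne
    · exact ⟨{T}, by simp, by simp, by simp⟩
    · have hpa : ∀ V ∈ s, D.Orth V a := fun V hV =>
        hp (by simp [hV]) (by simp) (fun h => ha (h ▸ hV))
      obtain ⟨V₀, hV₀⟩ := hne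
      obtain ⟨W, hW, hW'⟩ := hD.orth_container T a (hT a (by simp))
        ⟨V₀, hT V₀ (by simp [hV₀]), hpa V₀ hV₀⟩
      obtain ⟨C, hC, hCW, hcard⟩ := ih W ⟨V₀, hV₀⟩
        (fun V hV => hW' V (hpa V hV) (hT V (by simp [hV])))
        (hp.mono (by simp))
      refine ⟨insert T C, ?_, ?_, ?_⟩
      · exact hC.insert fun b hb _ => Or.inr ((hCW b hb).trans hW.le)
      · rintro b (rfl | hb)
        · exact le_rfl
        · exact (hCW b hb).trans hW.le
      · rw [Set.encard_insert_of_notMem (fun h => hW.not_ge (hCW T h)),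
          Finset.card_insert_of_notMem ha]
        push_cast
        gcongr

theorem encard_le_of_orth {s : Set 𝔖} (hs : s.Pairwise D.Orth) :
    s.encard ≤ c.complexity := by
  by_contra! h
  obtain ⟨t, hts, ht⟩ := Set.exists_subset_encard_eq (s := s) (k := c.complexity + 1)
    (Order.add_one_le_of_lt h)
  have htf : t.Finite := Set.finite_of_encard_eq_coe (k := c.complexity + 1) (by simpa using ht)
  have hcard : (htf.toFinset.card : ℕ∞) = c.complexity + 1 := by
    rw [← ht, htf.encard_eq_coe_toFinset_card]
  have hne : htf.toFinset.Nonempty := by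
    rw [← Finset.card_pos]
    have : htf.toFinset.card = c.complexity + 1 := by exact_mod_cast hcard
    omega
  obtain ⟨V₀, _⟩ := hne
  obtain ⟨S, hS⟩ := hD.exists_top ⟨V₀⟩
  obtain ⟨C, hC, _, hle⟩ := hD.exists_chain_of_orth htf.toFinset S ⟨V₀, by assumption⟩
    (fun V _ => hS V) (by simpa using hs.mono hts)
  have := hle.trans (hD.finite_complexity C hC)
  rw [hcard] at this
  exact absurd this (not_le.2 (by exact_mod_cast Nat.lt_succ_self _))

end IsNormalizedHHS

/-! ### Counting domains with large projections -/

theorem threshold_le (K : ℝ) (a : ℝ≥0∞) : threshold K a ≤ a := by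
  unfold threshold; split_ifs <;> simp

theorem le_threshold_add (K : ℝ) (a : ℝ≥0∞) : a ≤ threshold K a + ENNReal.ofReal K := by
  unfold threshold
  split_ifs with h
  · exact le_self_add
  · simpa using (not_le.1 h).le

/-- The factor in the bound for the number of domains in the `k`-th iteration of the large links
axiom. -/
noncomputable def linkConst (c : HHSConstants) (K₂ : ℝ) : ℕ → ℝ≥0
  | 0 => 1
  | k + 1 => c.lam.toNNReal + (c.lam.toNNReal * K₂.toNNReal + c.lam.toNNReal) * linkConst c K₂ k

/-- The factor in the bound for the number of domains with large projections. -/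
noncomputable def countConst (c : HHSConstants) (K₂ : ℝ) : ℝ≥0 :=
  ∑ k ∈ Finset.range (c.complexity + 1), linkConst c K₂ k

namespace IsNormalizedHHS

variable {X : Type u} [MetricSpace X] {𝔖 : Type v} [PartialOrder 𝔖] {𝒞 : 𝔖 → Type w}
  [∀ U, MetricSpace (𝒞 U)] {c : HHSConstants} {D : HHSData X 𝔖 𝒞}

/-- The domains provided by the large links axiom. -/
noncomputable def links (hD : IsNormalizedHHS c D) (x y : X) (W : 𝔖) : Finset 𝔖 :=
  (hD.large_links W x y).choose

/-- The domains obtained from `S` by iterating the large links axiom. -/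
noncomputable def linkLevel (hD : IsNormalizedHHS c D) (x y : X) (S : 𝔖) : ℕ → Finset 𝔖
  | 0 => {S}
  | k + 1 => open Classical in (linkLevel hD x y S k).biUnion (hD.links x y)

variable (hD : IsNormalizedHHS c D)
include hD

theorem card_links_le (x y : X) (W : 𝔖) : ((hD.links x y W).card : ℝ≥0∞) ≤
    c.lam.toNNReal * D.d W x y + c.lam.toNNReal := by
  have h : ((hD.links x y W).card : ℝ) ≤ c.lam * (D.d W x y).toReal + c.lam :=
    (hD.large_links W x y).choose_spec.1
  have hl : 0 ≤ c.lam := zero_le_one.trans c.one_le_lam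
  have h2 := ENNReal.ofReal_le_ofReal h
  rw [ENNReal.ofReal_natCast, ENNReal.ofReal_add (by positivity) hl, ENNReal.ofReal_mul hl,
    ENNReal.ofReal_toReal (hD.d_ne_top W x y)] at h2
  exact h2

theorem exists_links {x y : X} {W T : 𝔖} (h : T < W)
    (hT : ENNReal.ofReal c.E ≤ D.d T x y) : ∃ T' ∈ hD.links x y W, T' < W ∧ T ≤ T' := by
  obtain ⟨_, h1, h2⟩ := (hD.large_links W x y).choose_spec
  rcases h2 T h with ⟨T', hT', hle⟩ | h3
  · exact ⟨T', hT', (h1 T' hT').1, hle⟩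
  · exact absurd h3 (not_lt.2 hT)

/-- Each d_T is at most its thresholded value plus K₂. The thresholded values sum to at most `Q`,
and the remainder costs a multiple of the size of the level, so the bound stays linear in Q + 1. -/
theorem card_linkLevel_le (x y : X) (S : 𝔖) (K₂ : ℝ) (k : ℕ) :
    ((hD.linkLevel x y S k).card : ℝ≥0∞) ≤
      linkConst c K₂ k * ((∑' U, threshold K₂ (D.d U x y)) + 1) := by
  classical
  set Q := ∑' U, threshold K₂ (D.d U x y)
  induction k with
  | zero => simp [linkLevel, linkConst]
  | succ k ih =>
    set s := hD.linkLevel x y S k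
    set l : ℝ≥0∞ := ENNReal.ofReal c.lam
    set b : ℝ≥0∞ := l * ENNReal.ofReal K₂ + l
    calc ((hD.linkLevel x y S (k + 1)).card : ℝ≥0∞)
        ≤ ((∑ T ∈ s, (hD.links x y T).card : ℕ) : ℝ≥0∞) := by
          have := Finset.card_biUnion_le (s := s) (t := hD.links x y)
          simp only [linkLevel]
          exact_mod_cast this
      _ ≤ ∑ T ∈ s, (l * threshold K₂ (D.d T x y) + b) := by
          push_cast
          refine Finset.sum_le_sum fun T _ => (hD.card_links_le x y T).trans ?_
          calc l * D.d T x y + l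
              ≤ l * (threshold K₂ (D.d T x y) + ENNReal.ofReal K₂) + l := by
                gcongr; exact le_threshold_add _ _
            _ = _ := by simp only [b]; ring
      _ = l * ∑ T ∈ s, threshold K₂ (D.d T x y) + s.card * b := by
          rw [Finset.sum_add_distrib, Finset.mul_sum]; simp
      _ ≤ l * (Q + 1) + (linkConst c K₂ k * (Q + 1)) * b := by
          gcongr
          exact (ENNReal.sum_le_tsum s).trans le_self_add
      _ = linkConst c K₂ (k + 1) * (Q + 1) := by
          simp only [linkConst, b, l, ENNReal.ofReal]
          push_cast
          ring

/-- As long as U lies properly below a member T of the current level, large links provides a smaller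
member of the next level that still contains U. A domain that is not reached therefore produces a
growing chain, which finite complexity stops. -/
theorem mem_linkLevel_or {x y : X} {S U : 𝔖} (hS : U ≤ S)
    (hU : ENNReal.ofReal c.E ≤ D.d U x y) (k : ℕ) :
    (∃ j ≤ k, U ∈ hD.linkLevel x y S j) ∨ ∃ T ∈ hD.linkLevel x y S k, U < T ∧
      ∃ C : Set 𝔖, IsChain (· ≤ ·) C ∧ (∀ W ∈ C, T ≤ W) ∧ (k + 1 : ℕ∞) ≤ C.encard := by
  classical
  induction k with
  | zero =>
    rcases hS.eq_or_lt with rfl | h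
    · exact Or.inl ⟨0, le_rfl, by simp [linkLevel]⟩
    · exact Or.inr ⟨S, by simp [linkLevel], h, {S}, by simp, by simp, by simp⟩
  | succ k ih =>
    rcases ih with ⟨j, hj, h⟩ | ⟨T, hT, hUT, C, hC, hTC, hcard⟩
    · exact Or.inl ⟨j, by omega, h⟩
    · obtain ⟨T', hT', hlt, hle⟩ := hD.exists_links hUT hU
      have hmem : T' ∈ hD.linkLevel x y S (k + 1) := by
        simp only [linkLevel, Finset.mem_biUnion]
        exact ⟨T, hT, hT'⟩
      rcases hle.eq_or_lt with rfl | hlt'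
      · exact Or.inl ⟨k + 1, le_rfl, hmem⟩
      · refine Or.inr ⟨T', hmem, hlt', insert T' C, ?_, ?_, ?_⟩
        · exact hC.insert fun b hb _ => Or.inl (hlt.le.trans (hTC b hb))
        · rintro b (rfl | hb)
          · exact le_rfl
          · exact hlt.le.trans (hTC b hb)
        · rw [Set.encard_insert_of_notMem (fun h => hlt.not_ge (hTC T' h))]
          push_cast
          gcongr

/-- The number of domains with large projections is finite and bounded linearly by any sum of
thresholded projections. -/
theorem exists_finset_large (x y : X) (K₂ : ℝ) : ∃ s : Finset 𝔖,
    (∀ U, ENNReal.ofReal c.E ≤ D.d U x y → U ∈ s) ∧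
    (s.card : ℝ≥0∞) ≤ countConst c K₂ * ((∑' U, threshold K₂ (D.d U x y)) + 1) := by
  classical
  rcases isEmpty_or_nonempty 𝔖 with h | h
  · exact ⟨∅, fun U => isEmptyElim U, by simp⟩
  obtain ⟨S, hS⟩ := hD.exists_top h
  refine ⟨(Finset.range (c.complexity + 1)).biUnion (hD.linkLevel x y S), fun U hU => ?_, ?_⟩
  · rcases hD.mem_linkLevel_or (hS U) hU c.complexity with ⟨j, hj, h⟩ | ⟨T, _, _, C, hC, _, h⟩
    · exact Finset.mem_biUnion.2 ⟨j, Finset.mem_range.2 (by omega), h⟩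
    · exact absurd (h.trans (hD.finite_complexity C hC))
        (not_le.2 (by exact_mod_cast Nat.lt_succ_self _))
  · calc _ ≤ ((∑ k ∈ Finset.range (c.complexity + 1), (hD.linkLevel x y S k).card : ℕ) : ℝ≥0∞) := by
          exact_mod_cast Finset.card_biUnion_le
      _ ≤ ∑ k ∈ Finset.range (c.complexity + 1), (linkConst c K₂ k : ℝ≥0∞) *
            ((∑' U, threshold K₂ (D.d U x y)) + 1) := by
          push_cast
          exact Finset.sum_le_sum fun k _ => hD.card_linkLevel_le x y S K₂ k
      _ = _ := by
          rw [← Finset.sum_mul, countConst]; push_cast; rfl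

end IsNormalizedHHS

/-! ### Hierarchy rays -/

/-- Replaces a point y by a point q that lies in the same direction as seen from z: the second
hypothesis excludes one of the alternatives of the four point inequality. -/
theorem IsHyperbolicSpace.gromovProduct_le_of_near {Z : Type*} [PseudoMetricSpace Z] {δ : ℝ}
    (hZ : IsHyperbolicSpace δ Z) (hδ : 0 ≤ δ) {z p q y : Z} {a : ℝ}
    (h : gromovProduct z p y ≤ a) (h' : a + 3 * δ < gromovProduct z q y) :
    gromovProduct z p q ≤ a + 3 * δ := by
  rcases min_le_iff.1 (hZ.min_le_gromovProduct hδ z p q y) with h1 | h1 <;> linarith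

theorem IsQIEmbeddingOn.gromovProduct_le {Z : Type*} [PseudoMetricSpace Z] {ε : ℝ} {γ : ℝ → Z}
    {S : Set ℝ} (h : IsQIEmbeddingOn 1 ε S γ) {a b s : ℝ} (ha : a ∈ S) (hb : b ∈ S) (hs : s ∈ S)
    (has : a ≤ s) (hsb : s ≤ b) : gromovProduct (γ s) (γ a) (γ b) ≤ 3 / 2 * ε := by
  have h1 := (h s hs a ha).2
  have h2 := (h s hs b hb).2
  have h3 := (h a ha b hb).1
  rw [Real.dist_eq, abs_of_nonneg (by linarith)] at h1
  rw [Real.dist_eq, abs_sub_comm, abs_of_nonneg (by linarith)] at h2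
  rw [Real.dist_eq, abs_sub_comm, abs_of_nonneg (by linarith)] at h3
  unfold gromovProduct
  linarith

namespace HHSConstants

/-- The Morse constant for the projections of `L`-hierarchy rays. -/
noncomputable def rayMorse (c : HHSConstants) (L : ℝ) : ℝ :=
  morseConst c.δ L (2 * L * L + L + 2 * c.ξ + 2) + 3 * (L * L + L)

/-- A bound for the distance between the coordinates of a hierarchy ray and the projections of its
points far out. -/
noncomputable def rayConst (c : HHSConstants) (L : ℝ) : ℝ :=
  2 * c.rayMorse L + 3 * c.ξ + 1 + 2 * c.E + c.cons + c.bgi + 4 * L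

theorem rayMorse_nonneg (c : HHSConstants) {L : ℝ} (hL : 1 ≤ L) : 0 ≤ c.rayMorse L := by
  have := c.ξ_nonneg
  have := morseConst_nonneg (δ := c.δ) (κ := L) (ε := 2 * L * L + L + 2 * c.ξ + 2)
    (by positivity) (by positivity)
  unfold rayMorse
  positivity

theorem rayConst_bounds (c : HHSConstants) {L : ℝ} (hL : 1 ≤ L) :
    c.ξ ≤ c.rayConst L ∧ 0 ≤ c.rayConst L := by
  have := c.ξ_nonneg
  have := c.rayMorse_nonneg hL
  have := c.E_pos
  have := c.cons_pos
  have := c.bgi_pos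
  unfold rayConst
  constructor <;> linarith

end HHSConstants

namespace IsNormalizedHHS

open Filter

variable {X : Type u} [MetricSpace X] {𝔖 : Type v} [PartialOrder 𝔖] {𝒞 : 𝔖 → Type w}
  [∀ U, MetricSpace (𝒞 U)] {c : HHSConstants} {D : HHSData X 𝔖 𝒞}
variable (hD : IsNormalizedHHS c D) {L : ℝ} {h : ℝ≥0 → X}
include hD

theorem exists_param (hL : 1 ≤ L) (hh : IsHierarchyRay D L h) (U : 𝔖) :
    ∃ σ : ℝ≥0 → ℝ, Monotone σ ∧
    (∀ s s', dist (hD.pr U (h s)) (hD.pr U (h s')) ≤ L * |σ s - σ s'| + L ∧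
      |σ s - σ s'| ≤ L * (dist (hD.pr U (h s)) (hD.pr U (h s')) + 2 * c.ξ + L)) ∧
    ∀ s, ∀ a ∈ Icc (σ 0) (σ s), ∃ s', |σ s' - a| ≤ L := by
  obtain ⟨σ, h1, h2, h3⟩ := hh.unparameterized U
  have hL0 : 0 < L := by linarith
  refine ⟨σ, h1, fun s s' => ⟨?_, ?_⟩, h3⟩
  · exact (ENNReal.ofReal_le_ofReal_iff (by positivity)).1
      ((hD.ofReal_dist_le_d U _ _).trans (h2 s s').2)
  · have h4 := (h2 s s').1.trans (hD.d_le U _ _)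
    rw [ENNReal.ofReal_le_ofReal_iff (by have := c.ξ_nonneg; positivity)] at h4
    rw [← inv_mul_le_iff₀ hL0]
    linarith

/-- A hierarchy ray diverges in the domains of its support. -/
theorem eventually_le_dist_of_mem_raySupp (hL : 1 ≤ L) (hh : IsHierarchyRay D L h) {U : 𝔖}
    (hU : U ∈ raySupp D h) (z : 𝒞 U) (B : ℝ) :
    ∀ᶠ t in atTop, B ≤ dist z (hD.pr U (h t)) := by
  obtain ⟨σ, hσ, hd, -⟩ := hD.exists_param hL hh U
  have hL0 : 0 < L := by linarith
  have hb : ¬ BddAbove (range σ) := by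
    rintro ⟨b, hb⟩
    have hfin : ∀ s, dist (hD.pr U (h s)) (hD.pr U (h 0)) ≤ L * (b - σ 0) + L := fun s => by
      refine (hd s 0).1.trans ?_
      rw [abs_of_nonneg (by linarith [hσ (zero_le (a := s))])]
      have := hb (mem_range_self s)
      gcongr
    have : Metric.ediam (⋃ s, D.proj U (h s)) ≤
        ENNReal.ofReal (2 * (c.ξ + (L * (b - σ 0) + L))) := by
      refine ediam_le_ofReal fun p hp q hq => ?_
      obtain ⟨s, hs⟩ := mem_iUnion.1 hp
      obtain ⟨s', hs'⟩ := mem_iUnion.1 hq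
      linarith [dist_triangle_right p q (hD.pr U (h 0)), hfin s, hfin s',
        dist_triangle p (hD.pr U (h s)) (hD.pr U (h 0)),
        dist_triangle q (hD.pr U (h s')) (hD.pr U (h 0)), hD.dist_pr_le hs, hD.dist_pr_le hs']
    rw [show Metric.ediam (⋃ s, D.proj U (h s)) = ⊤ from hU] at this
    exact absurd this (not_le.2 ENNReal.ofReal_lt_top)
  have ht := tendsto_atTop_atTop_of_monotone' hσ hb
  filter_upwards [ht.eventually_ge_atTop
    (σ 0 + L * (B + dist z (hD.pr U (h 0)) + 2 * c.ξ + L))] with t ht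
  have h1 := (hd 0 t).2
  have h2 : L * (B + dist z (hD.pr U (h 0)) + 2 * c.ξ + L) ≤
      L * (dist (hD.pr U (h 0)) (hD.pr U (h t)) + 2 * c.ξ + L) := by
    refine le_trans ?_ h1
    rw [abs_sub_comm]
    exact le_trans (by linarith) (le_abs_self _)
  have h3 := le_of_mul_le_mul_left h2 hL0
  linarith [dist_triangle_left (hD.pr U (h 0)) (hD.pr U (h t)) z]

/-- A hierarchy ray coarsely converges in the domains outside its support. -/
theorem exists_dist_le_of_notMem_raySupp (hL : 1 ≤ L) (hh : IsHierarchyRay D L h) {U : 𝔖}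
    (hU : U ∉ raySupp D h) :
    ∃ t₀, ∀ t ≥ t₀, ∀ t' ≥ t₀, dist (hD.pr U (h t)) (hD.pr U (h t')) ≤ 2 * L := by
  obtain ⟨σ, hσ, hd, -⟩ := hD.exists_param hL hh U
  have hL0 : 0 < L := by linarith
  have hb : BddAbove (range σ) := by
    by_contra hb
    apply hU
    have ht := tendsto_atTop_atTop_of_monotone' hσ hb
    refine ENNReal.eq_top_of_forall_nnreal_le fun B => ?_
    obtain ⟨t, ht⟩ := (ht.eventually_ge_atTop (σ 0 + L * (B + 2 * c.ξ + L))).exists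
    have h2 : L * (B + 2 * c.ξ + L) ≤
        L * (dist (hD.pr U (h 0)) (hD.pr U (h t)) + 2 * c.ξ + L) := by
      refine le_trans ?_ (hd 0 t).2
      rw [abs_sub_comm]
      exact le_trans (by linarith) (le_abs_self _)
    have h3 := le_of_mul_le_mul_left h2 hL0
    calc (B : ℝ≥0∞) = ENNReal.ofReal B := by simp
      _ ≤ edist (hD.pr U (h 0)) (hD.pr U (h t)) := by
          rw [edist_dist]; exact ENNReal.ofReal_le_ofReal (by linarith)
      _ ≤ _ := Metric.edist_le_ediam_of_mem (mem_iUnion.2 ⟨0, hD.pr_mem _ _⟩)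
          (mem_iUnion.2 ⟨t, hD.pr_mem _ _⟩)
  obtain ⟨_, ⟨t₀, rfl⟩, ht₀⟩ := exists_lt_of_lt_csSup (range_nonempty σ)
    (show sSup (range σ) - 1 < sSup (range σ) by linarith)
  refine ⟨t₀, fun t ht t' ht' => (hd t t').1.trans ?_⟩
  have : |σ t - σ t'| ≤ 1 := by
    rw [abs_le]
    constructor <;> linarith [hσ ht, hσ ht', le_csSup hb (mem_range_self t),
      le_csSup hb (mem_range_self t')]
  nlinarith

/-- The density clause for hierarchy rays provides a coarse inverse of the parameter σ, which makes
the projected ray an honest quasigeodesic on a real interval. Returning from it to h at three points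
after the Morse lemma gives the term 3(L² + L) of `rayMorse`. -/
theorem gromovProduct_ray_le (hL : 1 ≤ L) (hh : IsHierarchyRay D L h) (U : 𝔖) {s s' : ℝ≥0}
    (hs : s ≤ s') :
    gromovProduct (hD.pr U (h s)) (hD.pr U (h 0)) (hD.pr U (h s')) ≤ c.rayMorse L := by
  obtain ⟨σ, hσ, hd, hden⟩ := hD.exists_param hL hh U
  have hL0 : 0 < L := by linarith
  choose! g hg using hden s'
  set f : ℝ → 𝒞 U := fun a => hD.pr U (h (g a))
  have hf : IsQIEmbeddingOn L (2 * L * L + L + 2 * c.ξ + 2) (Icc (σ 0) (σ s')) f := by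
    intro a ha b hb
    have h1 := hd (g a) (g b)
    have h2 := hg a ha
    have h3 := hg b hb
    have hξ := c.ξ_nonneg
    rw [Real.dist_eq]
    rw [abs_le] at h2 h3
    have h4 : |σ (g a) - σ (g b)| ≤ |a - b| + 2 * L := by
      rw [abs_le]
      constructor <;> linarith [le_abs_self (a - b), neg_abs_le (a - b)]
    have h5 : |a - b| ≤ |σ (g a) - σ (g b)| + 2 * L := by
      rw [abs_le]
      constructor <;> linarith [le_abs_self (σ (g a) - σ (g b)), neg_abs_le (σ (g a) - σ (g b))]
    constructor
    · have h6 : L⁻¹ * |a - b| ≤ dist (f a) (f b) + 2 * c.ξ + L + 2 := by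
        rw [inv_mul_le_iff₀ hL0]
        linarith [h1.2]
      nlinarith
    · have h6 : L * |σ (g a) - σ (g b)| ≤ L * (|a - b| + 2 * L) := by gcongr
      linarith [h1.1]
  have h0 : σ 0 ≤ σ s := hσ zero_le
  have h1 : σ s ≤ σ s' := hσ hs
  have hnear : ∀ r, r ≤ s' → dist (f (σ r)) (hD.pr U (h r)) ≤ L * L + L := fun r hr => by
    refine (hd _ _).1.trans ?_
    have := hg (σ r) ⟨hσ zero_le, hσ hr⟩
    gcongr
  have hM := (hD.hyperbolic U).gromovProduct_le_morseConst c.δ_nonneg hL0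
    (by have := c.ξ_nonneg; positivity) ⟨h0, h1⟩ hf
  have e0 := hnear 0 zero_le
  have e1 := hnear s hs
  have e2 := hnear s' le_rfl
  have g1 := gromovProduct_base_le (hD.pr U (h s)) (f (σ s)) (hD.pr U (h 0)) (hD.pr U (h s'))
  have g2 := gromovProduct_left_le (f (σ s)) (hD.pr U (h 0)) (f (σ 0)) (hD.pr U (h s'))
  have g3 := gromovProduct_right_le (f (σ s)) (f (σ 0)) (hD.pr U (h s')) (f (σ s'))
  rw [dist_comm] at e0 e1 e2
  unfold HHSConstants.rayMorse
  linarith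

/-- The projection of h stays within some N of γ, and once h(t) is far from γ 0 the nearby γ s must
have a large parameter. N is not uniform, but it only affects how large t has to be. -/
theorem eventually_near_of_representsRay (hL : 1 ≤ L) (hh : IsHierarchyRay D L h) {U : 𝔖}
    (hU : U ∈ raySupp D h) {γ : ℝ≥0 → 𝒞 U} (hγ : RepresentsRay D c U h γ) (z : 𝒞 U) (B : ℝ)
    (s₁ : ℝ≥0) :
    ∀ᶠ t in atTop, ∃ s ≥ s₁, B ≤ gromovProduct z (hD.pr U (h t)) (γ s) := by
  obtain ⟨N, hN⟩ : ∃ N : ℝ, ∀ t, ∃ s, dist (hD.pr U (h t)) (γ s) ≤ N := by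
    have hlt := lt_top_iff_ne_top.2 hγ.2
    obtain ⟨N, hN⟩ := ENNReal.lt_iff_exists_nnreal_btwn.1 hlt
    refine ⟨N, fun t => ?_⟩
    rw [Metric.hausdorffEDist_comm] at hN
    obtain ⟨_, ⟨s, rfl⟩, hs⟩ := Metric.exists_edist_lt_of_hausdorffEDist_lt
      (mem_iUnion.2 ⟨t, hD.pr_mem U (h t)⟩) hN.1
    refine ⟨s, ?_⟩
    rw [edist_nndist] at hs
    exact_mod_cast hs.le
  filter_upwards [hD.eventually_le_dist_of_mem_raySupp hL hh hU (γ 0) (s₁ + 20 * c.δ + N + 1),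
    hD.eventually_le_dist_of_mem_raySupp hL hh hU z (B + N)] with t h1 h2
  obtain ⟨s, hs⟩ := hN t
  refine ⟨s, ?_, ?_⟩
  · have h3 := (hγ.1 0 (mem_univ _) s (mem_univ _)).2
    rw [NNReal.dist_eq, NNReal.coe_zero, zero_sub, abs_neg, abs_of_nonneg s.coe_nonneg] at h3
    have : (s₁ : ℝ) ≤ s := by
      linarith [dist_triangle_right (γ 0) (hD.pr U (h t)) (γ s)]
    exact_mod_cast this
  · linarith [dist_sub_dist_le_gromovProduct z (hD.pr U (h t)) (γ s)]

end IsNormalizedHHS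

theorem RepresentsRay.gromovProduct_le {X : Type u} [MetricSpace X] {𝔖 : Type v}
    {𝒞 : 𝔖 → Type w} [∀ U, MetricSpace (𝒞 U)] {D : HHSData X 𝔖 𝒞} {c : HHSConstants}
    {U : 𝔖} {h : ℝ≥0 → X} {γ : ℝ≥0 → 𝒞 U} (hγ : RepresentsRay D c U h γ) {s₀ s : ℝ≥0}
    (hs : s₀ ≤ s) : gromovProduct (γ s₀) (γ 0) (γ s) ≤ 30 * c.δ := by
  have h1 := (hγ.1 s₀ (mem_univ _) 0 (mem_univ _)).2
  have h2 := (hγ.1 s₀ (mem_univ _) s (mem_univ _)).2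
  have h3 := (hγ.1 0 (mem_univ _) s (mem_univ _)).1
  have h4 : (s₀ : ℝ) ≤ s := by exact_mod_cast hs
  rw [NNReal.dist_eq, NNReal.coe_zero, sub_zero, abs_of_nonneg s₀.coe_nonneg] at h1
  rw [NNReal.dist_eq, abs_sub_comm, abs_of_nonneg (by linarith)] at h2
  rw [NNReal.dist_eq, NNReal.coe_zero, zero_sub, abs_neg, abs_of_nonneg s.coe_nonneg] at h3
  unfold gromovProduct
  linarith

/-! ### Hulls: replacing rays by points -/

namespace HullInput

variable {X : Type u} [MetricSpace X] {𝔖 : Type v} {𝒞 : 𝔖 → Type w}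
  [∀ U, MetricSpace (𝒞 U)] {c : HHSConstants} {D : HHSData X 𝔖 𝒞} {L : ℝ}

/-- The elements of `F ∪ Λ`. -/
def idx (P : HullInput c D L) : Finset (X ⊕ (ℝ≥0 → X)) := P.F.disjSum P.Λ

theorem card_idx (P : HullInput c D L) : P.idx.card = P.card := Finset.card_disjSum _ _

theorem inl_mem_idx {P : HullInput c D L} {a : X} : Sum.inl a ∈ P.idx ↔ a ∈ P.F :=
  Finset.inl_mem_disjSum

theorem inr_mem_idx {P : HullInput c D L} {h : ℝ≥0 → X} : Sum.inr h ∈ P.idx ↔ h ∈ P.Λ :=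
  Finset.inr_mem_disjSum

end HullInput

/-- The point that stands for an element of `F ∪ Λ` at the time `t`: rays are replaced by their
points. -/
def approxPoint {X : Type*} (i : X ⊕ (ℝ≥0 → X)) (t : ℝ≥0) : X := i.elim id fun h => h t

namespace IsNormalizedHHS

open Filter

variable {X : Type u} [MetricSpace X] {𝔖 : Type v} [PartialOrder 𝔖] {𝒞 : 𝔖 → Type w}
  [∀ U, MetricSpace (𝒞 U)] {c : HHSConstants} {D : HHSData X 𝔖 𝒞}
variable (hD : IsNormalizedHHS c D) {L : ℝ} (P : HullInput c D L) {M K θ : ℝ}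
include hD

/-- The coordinates of a hierarchy ray are close to the projections of its points far out. -/
theorem eventually_dist_rayCoord_le (hL : 1 ≤ L) (hM : c.bgi + 33 * c.δ ≤ M) {h : ℝ≥0 → X}
    (hh : h ∈ P.Λ) {U : 𝔖} (hU : U ∉ raySupp D h) {p : 𝒞 U} (hp : p ∈ P.rayCoord M U h) :
    ∀ᶠ t in atTop, dist p (hD.pr U (h t)) ≤ c.rayConst L := by
  have hray := P.ray h hh
  have hξ := c.ξ_nonneg
  have hδ := c.δ_nonneg
  have hE := c.E_pos
  have hcons := c.cons_pos
  have hbgi := c.bgi_pos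
  have hmor := c.rayMorse_nonneg hL
  obtain ⟨t₀, ht₀⟩ := hD.exists_dist_le_of_notMem_raySupp hL hray hU
  -- After t₀ the projection of h moves by at most 2 * L, so one suitable time is enough.
  suffices hs : ∃ t ≥ t₀, dist p (hD.pr U (h t)) ≤ c.rayConst L - 2 * L by
    obtain ⟨t₁, h1, h2⟩ := hs
    filter_upwards [eventually_ge_atTop t₀] with t ht
    linarith [dist_triangle p (hD.pr U (h t₁)) (hD.pr U (h t)), ht₀ t₁ h1 t ht]
  unfold HullInput.rayCoord at hp
  split_ifs at hp with h1 h2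
  -- The point at time t₁ is coarsely between those at times 0 and t, and nearly maximizes the
  -- displacement from h(0). Hence the point at time t cannot be far from it.
  · set t₁ := P.time h U
    refine ⟨max t₀ t₁, le_max_left _ _, ?_⟩
    set t := max t₀ t₁
    have h3 := hD.gromovProduct_ray_le hL hray U (le_max_right t₀ t₁)
    have h4 : dist (hD.pr U (h 0)) (hD.pr U (h t)) ≤
        dist (hD.pr U (h 0)) (hD.pr U (h t₁)) + 2 * c.ξ + 1 := by
      have h5 := (hD.ofReal_dist_le_d U _ _).trans ((P.time_spec h hh U h1 t).trans
        (add_le_add_left (hD.d_le U _ _) 1))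
      rw [← ENNReal.ofReal_one, ← ENNReal.ofReal_add (by positivity) zero_le_one,
        ENNReal.ofReal_le_ofReal_iff (by positivity)] at h5
      exact h5
    unfold gromovProduct at h3
    have h6 := hD.dist_pr_le hp
    unfold HHSConstants.rayConst
    linarith [dist_triangle p (hD.pr U (h t₁)) (hD.pr U (h t)),
      dist_comm (hD.pr U (h 0)) (hD.pr U (h t₁))]
  · simp only [mem_iUnion, mem_ofPred_eq] at hp
    obtain ⟨V, ⟨hV, hUV⟩, q, ⟨γ, hγ, hγ0, ⟨s₀, rfl⟩, hfar⟩, hp⟩ := hp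
    have hfar' : c.E + M ≤ dist (γ s₀) (γ 0) := by
      have := hfar.trans (Metric.infEDist_le_edist_of_mem hγ0)
      rw [edist_dist] at this
      exact (ENNReal.ofReal_le_ofReal_iff dist_nonneg).1 this
    obtain ⟨t, ⟨s, hs, hB⟩, ht⟩ := ((hD.eventually_near_of_representsRay hL hray hV hγ (γ s₀)
      (33 * c.δ + 1) s₀).and (eventually_ge_atTop t₀)).exists
    refine ⟨t, ht, ?_⟩
    -- The ray continues from γ s₀ towards h(t), so the product of both based at γ 0 is at least E +
    -- M - 33δ. The lower bound on M makes this at least `bgi`.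
    have h3 := (hD.hyperbolic V).gromovProduct_le_of_near c.δ_nonneg (hγ.gromovProduct_le hs)
      (q := hD.pr V (h t)) (by linarith)
    have h4 := gromovProduct_add_swap (γ s₀) (γ 0) (hD.pr V (h t))
    have h5 := hD.dist_rhoMap_pr_le hUV hγ0 (z := γ s₀) (x := h t) (by linarith) hp
    unfold HHSConstants.rayConst
    linarith
  · simp only [mem_iUnion, mem_ofPred_eq] at hp
    obtain ⟨V, ⟨hV, hVU⟩, hp⟩ := hp
    rcases hVU with hT | hlt
    · obtain ⟨w', hw'⟩ := hD.rho_nonempty U V (Or.inr (hD.transverse_symm hT))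
      obtain ⟨t, h3, ht⟩ := ((hD.eventually_le_dist_of_mem_raySupp hL hray hV w' c.cons).and
        (eventually_ge_atTop t₀)).exists
      refine ⟨t, ht, ?_⟩
      rcases hD.transverse_dist_lt hT (h t) hp hw' with h4 | h4
      · rw [dist_comm] at h4
        unfold HHSConstants.rayConst
        linarith
      · rw [dist_comm] at h4
        linarith
    -- If h(t₀) projected far from ρ^V_U, bounded geodesic image would keep h within 3E of h(t₀) in
    -- 𝒞 V from then on, but h diverges there.
    · refine ⟨t₀, le_rfl, ?_⟩
      by_contra! hc
      obtain ⟨t, h3, ht⟩ := ((hD.eventually_le_dist_of_mem_raySupp hL hray hV (hD.pr V (h t₀))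
        (3 * c.E + 1)).and (eventually_ge_atTop t₀)).exists
      have h4 := dist_sub_dist_le_gromovProduct p (hD.pr U (h t₀)) (hD.pr U (h t))
      unfold HHSConstants.rayConst at hc
      have h5 := hD.dist_pr_pr_le hlt hp (x := h t₀) (y := h t)
        (by linarith [ht₀ t₀ le_rfl t ht])
      linarith

theorem exists_eventually_dist_marked_le (hL : 1 ≤ L) (hM : c.bgi + 33 * c.δ ≤ M) {U : 𝔖}
    {p : 𝒞 U} (hp : p ∈ P.marked M U) :
    ∃ i ∈ P.idx, ∀ᶠ t in atTop, dist p (hD.pr U (approxPoint i t)) ≤ c.rayConst L := by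
  rcases hp with hp | hp
  · simp only [mem_iUnion] at hp
    obtain ⟨a, ha, hp⟩ := hp
    exact ⟨Sum.inl a, HullInput.inl_mem_idx.2 ha,
      Eventually.of_forall fun t => (hD.dist_pr_le hp).trans (c.rayConst_bounds hL).1⟩
  · simp only [mem_iUnion, mem_ofPred_eq] at hp
    obtain ⟨h, ⟨hh, hU⟩, hp⟩ := hp
    exact ⟨Sum.inr h, HullInput.inr_mem_idx.2 hh,
      hD.eventually_dist_rayCoord_le P hL hM hh hU hp⟩

/-- Points of the hyperbolic hulls are close to geodesics between the points that replace the
elements of `F ∪ Λ`. -/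
theorem eventually_gromovProduct_hypHull_le (hL : 1 ≤ L) (hM : c.bgi + 33 * c.δ ≤ M) {U : 𝔖}
    {z : 𝒞 U} (hz : z ∈ P.hypHull M U) :
    ∀ᶠ t in atTop, ∃ i ∈ P.idx, ∃ j ∈ P.idx,
      gromovProduct z (hD.pr U (approxPoint i t)) (hD.pr U (approxPoint j t)) ≤
        2 * c.rayConst L + 36 * c.δ := by
  have hδ := c.δ_nonneg
  have hrc := (c.rayConst_bounds hL).2
  rcases hz with (⟨p, hp, p', hp', γ, hγ, hz⟩ | ⟨p, hp, h, hh, hU, γ, hγ, rfl, ⟨s₀, rfl⟩⟩) |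
    ⟨h, hh, h', hh', hU, hU', γ, hqi, hγ, hγ', ⟨s₀, rfl⟩⟩
  · obtain ⟨i, hi, h1⟩ := hD.exists_eventually_dist_marked_le P hL hM hp
    obtain ⟨j, hj, h2⟩ := hD.exists_eventually_dist_marked_le P hL hM hp'
    filter_upwards [h1, h2] with t h1 h2
    refine ⟨i, hi, j, hj, ?_⟩
    rw [dist_comm] at h1 h2
    have h3 := hγ.gromovProduct_le (w := z) hz
    rw [dist_self] at h3
    linarith [gromovProduct_left_le z (hD.pr U (approxPoint i t)) p (hD.pr U (approxPoint j t)),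
      gromovProduct_right_le z p (hD.pr U (approxPoint j t)) p']
  · obtain ⟨i, hi, h1⟩ := hD.exists_eventually_dist_marked_le P hL hM hp
    filter_upwards [h1, hD.eventually_near_of_representsRay hL (P.ray h hh) hU hγ (γ s₀)
      (33 * c.δ + 1) s₀] with t h1 ⟨s, hs, hB⟩
    refine ⟨i, hi, Sum.inr h, HullInput.inr_mem_idx.2 hh, ?_⟩
    rw [dist_comm] at h1
    have h3 := (hD.hyperbolic U).gromovProduct_le_of_near c.δ_nonneg (hγ.gromovProduct_le hs)
      (q := hD.pr U (h t)) (by linarith)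
    have h4 := gromovProduct_left_le (γ s₀) (hD.pr U (approxPoint i t)) (γ 0) (hD.pr U (h t))
    change gromovProduct (γ s₀) (hD.pr U (approxPoint i t)) (hD.pr U (h t)) ≤ _
    linarith
  · filter_upwards [hD.eventually_near_of_representsRay hL (P.ray h hh) hU hγ (γ s₀)
      (36 * c.δ + 1) s₀.toNNReal, hD.eventually_near_of_representsRay hL (P.ray h' hh') hU' hγ'
      (γ s₀) (36 * c.δ + 1) (-s₀).toNNReal] with t ⟨s, hs, hB⟩ ⟨s', hs', hB'⟩
    refine ⟨Sum.inr h, HullInput.inr_mem_idx.2 hh, Sum.inr h', HullInput.inr_mem_idx.2 hh', ?_⟩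
    have a1 : s₀ ≤ s := Real.toNNReal_le_iff_le_coe.1 hs
    have a2 : -s₀ ≤ s' := Real.toNNReal_le_iff_le_coe.1 hs'
    have h1 := hqi.gromovProduct_le (a := -(s' : ℝ)) (b := s) (s := s₀) (mem_univ _)
      (mem_univ _) (mem_univ _) (by linarith) a1
    have h2 := (hD.hyperbolic U).gromovProduct_le_of_near c.δ_nonneg
      (h1.trans (show _ ≤ 30 * c.δ by linarith)) (q := hD.pr U (h t)) (by linarith)
    rw [gromovProduct_comm] at h2
    have h3 := (hD.hyperbolic U).gromovProduct_le_of_near c.δ_nonneg h2 (q := hD.pr U (h' t))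
      (by linarith)
    change gromovProduct (γ s₀) (hD.pr U (h t)) (hD.pr U (h' t)) ≤ _
    linarith

theorem exists_dist_hypHull_lt {x : X} (hx : x ∈ P.hull M θ) (U : 𝔖) :
    ∃ z ∈ P.hypHull M U, dist (hD.pr U x) z < θ + c.ξ := by
  obtain ⟨a, ha, z, hz, haz⟩ := exists_dist_lt_of_setEDist_lt (hx U)
  exact ⟨z, hz, by linarith [dist_triangle_left (hD.pr U x) z a, hD.dist_pr_le ha]⟩

theorem eventually_gromovProduct_hull_le (hL : 1 ≤ L) (hM : c.bgi + 33 * c.δ ≤ M) {x : X}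
    (hx : x ∈ P.hull M θ) (U : 𝔖) :
    ∀ᶠ t in atTop, ∃ i ∈ P.idx, ∃ j ∈ P.idx,
      gromovProduct (hD.pr U x) (hD.pr U (approxPoint i t)) (hD.pr U (approxPoint j t)) ≤
        2 * c.rayConst L + 36 * c.δ + θ + c.ξ := by
  obtain ⟨z, hz, hd⟩ := hD.exists_dist_hypHull_lt P hx U
  filter_upwards [hD.eventually_gromovProduct_hypHull_le P hL hM hz] with t ⟨i, hi, j, hj, h⟩
  refine ⟨i, hi, j, hj, ?_⟩
  linarith [gromovProduct_base_le (hD.pr U x) z (hD.pr U (approxPoint i t))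
    (hD.pr U (approxPoint j t))]

/-- The points replacing the elements of `F ∪ Λ` are spread out in the relevant domains. -/
theorem lt_of_eventually_near (hL : 1 ≤ L) (hM : c.bgi + 33 * c.δ ≤ M) {U : 𝔖}
    (hU : U ∈ P.relevant M K) {l : Filter ℝ≥0} [l.NeBot] (hl : l ≤ atTop) {z : 𝒞 U} {B : ℝ}
    (hB : ∀ i ∈ P.idx, ∀ᶠ t in l, dist z (hD.pr U (approxPoint i t)) ≤ B) :
    K < 2 * (B + c.rayConst L) := by
  have hsupp : ∀ h ∈ P.Λ, U ∉ raySupp D h := by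
    intro h hh hU
    obtain ⟨t, h1, h2⟩ := (((hD.eventually_le_dist_of_mem_raySupp hL (P.ray h hh) hU z
      (B + 1)).filter_mono hl).and (hB (Sum.inr h) (HullInput.inr_mem_idx.2 hh))).exists
    have h3 : dist z (hD.pr U (h t)) ≤ B := h2
    linarith
  rcases hU with hU | ⟨h, hh, hU⟩
  · have hm : ∀ p ∈ P.marked M U, dist p z ≤ B + c.rayConst L := by
      intro p hp
      obtain ⟨i, hi, h1⟩ := hD.exists_eventually_dist_marked_le P hL hM hp
      obtain ⟨t, h1, h2⟩ := ((h1.filter_mono hl).and (hB i hi)).exists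
      linarith [dist_triangle_right p z (hD.pr U (approxPoint i t))]
    have h1 : Metric.ediam (P.marked M U) ≤ ENNReal.ofReal (2 * (B + c.rayConst L)) :=
      ediam_le_ofReal fun a ha b hb => by
        linarith [dist_triangle_right a b z, hm a ha, hm b hb]
    exact (ENNReal.ofReal_lt_ofReal_iff'.1 (hU.trans_le h1)).1
  · exact absurd hU (hsupp h hh)

end IsNormalizedHHS

/-! ### Collapsed trees -/

section CollapsedTrees

open MeasureTheory

variable {T : Type*} [MetricSpace T]

theorem Collapse.eDist_mk_le (A : Set T) (x y : T) :
    Collapse.eDist (Collapse.mk A x) (Collapse.mk A y) ≤ edist x y := by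
  unfold Collapse.eDist
  refine (iInf_le _ 0).trans ((iInf_le _ fun _ => x).trans ((iInf_le _ fun _ => y).trans
    (iInf_le_of_le ⟨rfl, rfl, by simp⟩ ?_)))
  simp

theorem Collapse.eDist_eq_zero_of_segment_subset (hT : IsMetricTree T) {A : Set T} {x y : T}
    (h : ∀ p, dist x p + dist p y = dist x y → p ∈ A) :
    Collapse.eDist (Collapse.mk A x) (Collapse.mk A y) = 0 := by
  obtain ⟨γ, hγ⟩ := hT.geodesic x y
  have h1 := hγ.isPreconnected.subset_connectedComponentIn hγ.left_mem
    (fun p hp => h p (hγ.dist_add hp))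
  have h2 : Collapse.mk A x = Collapse.mk A y := Quotient.sound (Or.inr (h1 hγ.right_mem))
  rw [← h2, ← nonpos_iff_eq_zero]
  simpa using Collapse.eDist_mk_le A x x

/-- Lower bounds for the quotient metric come from 1-Lipschitz functions that are constant on the
fibers: the jumps of a chain inside fibers cost nothing. -/
theorem Collapse.edist_le_eDist {A : Set T} {F : T → ℝ} (hF : LipschitzWith 1 F)
    (hA : ∀ x y, Collapse.mk A x = Collapse.mk A y → F x = F y) (x y : T) :
    edist (F x) (F y) ≤ Collapse.eDist (Collapse.mk A x) (Collapse.mk A y) := by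
  unfold Collapse.eDist
  refine le_iInf fun n => le_iInf fun p => le_iInf fun p' => le_iInf fun h => ?_
  obtain ⟨h0, hn, hs⟩ := h
  rw [← hA _ _ h0, ← hA _ _ hn]
  clear h0 hn
  induction n with
  | zero => simpa using hF (p 0) (p' 0)
  | succ n ih =>
    rw [Finset.sum_range_succ]
    refine (edist_triangle _ (F (p' n)) _).trans (add_le_add (ih fun i hi => hs i (by omega)) ?_)
    rw [hA _ _ (hs n (by omega))]
    simpa using hF (p (n + 1)) (p' (n + 1))

/-- In a tree, a point of a segment `[x, y]` separates the points that project to different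
sides of it. -/
theorem IsMetricTree.mem_of_gromovProduct_lt (hT : IsMetricTree T) {x y p y₁ y₂ : T}
    (hp : dist x p + dist p y = dist x y) {Y : Set T} (hY : IsPreconnected Y) (h₁ : y₁ ∈ Y)
    (h₂ : y₂ ∈ Y) (hlt₁ : gromovProduct x y₁ y < dist x p)
    (hlt₂ : dist x p < gromovProduct x y₂ y) : p ∈ Y := by
  by_contra hpY
  have hcont : Continuous fun t => gromovProduct p t x := by
    unfold gromovProduct; fun_prop
  -- A is the side of p that contains x, and B is the union of the other sides. Both are open, so a
  -- connected set that meets both must contain p.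
  set A : Set T := {t | 0 < gromovProduct p t x}
  set B : Set T := {t | t ≠ p ∧ gromovProduct p t x ≤ 0}
  have hA : IsOpen A := isOpen_lt continuous_const hcont
  have four : ∀ a b c, min (gromovProduct p a b) (gromovProduct p b c) ≤ gromovProduct p a c :=
    fun a b c => by simpa using IsHyperbolicSpace.min_le_gromovProduct hT le_rfl p a b c
  have hB : IsOpen B := by
    refine Metric.isOpen_iff.2 fun t ht => ⟨dist p t, dist_pos.2 ht.1.symm, fun s hs => ?_⟩
    rw [Metric.mem_ball] at hs
    refine ⟨fun h => by rw [h] at hs; exact lt_irrefl _ hs, ?_⟩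
    have h1 : 0 < gromovProduct p t s := by
      unfold gromovProduct
      have := dist_nonneg (x := p) (y := s)
      rw [dist_comm t s]; linarith
    rcases min_le_iff.1 ((four t s x).trans ht.2) with h2 | h2
    · linarith
    · exact h2
  have hcov : Y ⊆ A ∪ B := fun t ht => by
    rcases lt_or_ge 0 (gromovProduct p t x) with h | h
    · exact Or.inl h
    · exact Or.inr ⟨fun h' => hpY (h' ▸ ht), h⟩
  have m₁ : y₁ ∈ A := by
    unfold gromovProduct at hlt₁
    simp only [A, mem_ofPred_eq, gromovProduct]
    linarith [dist_triangle y₁ p y, dist_comm x y₁, dist_comm x p, dist_comm p y₁]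
  have m₂ : y₂ ∈ B := by
    refine ⟨fun h => ?_, ?_⟩
    · rw [h] at hlt₂
      unfold gromovProduct at hlt₂
      linarith
    · have h0 : gromovProduct p x y ≤ 0 := by
        unfold gromovProduct; linarith [dist_comm x p]
      rcases min_le_iff.1 ((four x y₂ y).trans h0) with h | h
      · rwa [gromovProduct_comm]
      · exfalso
        unfold gromovProduct at h hlt₂
        linarith [dist_triangle x p y₂]
  obtain ⟨t, -, ht, ht'⟩ := hY A B hA hB hcov ⟨y₁, h₁, m₁⟩ ⟨y₂, h₂, m₂⟩
  exact absurd ht'.2 (not_le.2 ht)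

/-- If the part of a segment of a tree that is collapsed is covered by finitely many sets of
bounded diameter, then the collapse changes the length of the segment by a bounded amount. -/
theorem IsMetricTree.dist_le_eDist_add (hT : IsMetricTree T) (A : Set T) {x y : T} {γ : Set T}
    (hγ : IsGeodesicSegment x y γ) {ι : Type*} (s : Finset ι) (B : ι → Set T) {c : ℝ}
    (hcov : ∀ p ∈ γ, p ∈ A → ∃ i ∈ s, p ∈ B i)
    (hdiam : ∀ i ∈ s, ∀ p ∈ B i, ∀ q ∈ B i, p ∈ γ → q ∈ γ → dist p q ≤ c) :
    ENNReal.ofReal (dist x y) ≤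
      Collapse.eDist (Collapse.mk A x) (Collapse.mk A y) + s.card * ENNReal.ofReal c := by
  obtain ⟨σ, h0, h1, hσ, rfl⟩ := id hγ
  set l := dist x y
  have hl : 0 ≤ l := dist_nonneg
  have hx : ∀ τ ∈ Icc 0 l, dist x (σ τ) = τ := fun τ hτ => by
    conv_lhs => rw [← h0]
    rw [hσ 0 ⟨le_rfl, hl⟩ τ hτ, zero_sub, abs_neg, abs_of_nonneg hτ.1]
  set S : Set ℝ := ⋃ i ∈ s, {τ ∈ Icc 0 l | σ τ ∈ B i}
  have hSfin : volume S ≤ s.card * ENNReal.ofReal c := by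
    refine (measure_biUnion_finset_le s _).trans ?_
    rw [← nsmul_eq_mul]
    refine Finset.sum_le_card_nsmul s _ _ fun i hi => ?_
    refine (Real.volume_le_diam _).trans (ediam_le_ofReal fun a ha b hb => ?_)
    rw [Real.dist_eq, ← hσ a ha.1 b hb.1]
    exact hdiam i hi _ ha.2 _ hb.2 (mem_image_of_mem _ ha.1)
      (mem_image_of_mem _ hb.1)
  have hIoc : ∀ a b : ℝ, volume (Ioc a b \ S) ≠ ⊤ := fun a b =>
    ((measure_mono sdiff_subset).trans_lt (by simp)).ne
  -- The uncovered length of [0, τ]. Monotonicity and subadditivity suffice below, so S need not be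
  -- measurable.
  set m : ℝ → ℝ := fun τ => volume.real (Ioc 0 τ \ S)
  have hmono : Monotone m := fun a b hab =>
    measureReal_mono (sdiff_subset_sdiff_left (Ioc_subset_Ioc_right hab)) (hIoc _ _)
  have hstep : ∀ a b, m b ≤ m a + volume.real (Ioc a b \ S) := fun a b => by
    refine (measureReal_mono (fun τ hτ => ?_)
      (measure_union_ne_top (hIoc 0 a) (hIoc a b))).trans (measureReal_union_le _ _)
    rcases le_or_gt τ a with h | h
    · exact Or.inl ⟨⟨hτ.1.1, h⟩, hτ.2⟩
    · exact Or.inr ⟨⟨h, hτ.1.2⟩, hτ.2⟩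
  have hlip : ∀ a b, a ≤ b → m b ≤ m a + (b - a) := fun a b hab => by
    have : volume.real (Ioc a b \ S) ≤ volume.real (Ioc a b) :=
      measureReal_mono sdiff_subset (by simp)
    rw [Real.volume_real_Ioc_of_le hab] at this
    linarith [hstep a b]
  have hconst : ∀ a b, a ≤ b → Ioo a b ⊆ S → m a = m b := fun a b hab hS => by
    refine le_antisymm (hmono hab) ?_
    have : volume.real (Ioc a b \ S) ≤ volume.real ({b} : Set ℝ) := by
      refine measureReal_mono (fun τ hτ => ?_) (by simp)
      rcases hτ.1.2.eq_or_lt with h | h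
      · exact h
      · exact absurd (hS ⟨hτ.1.1, h⟩) hτ.2
    have h2 : volume.real ({b} : Set ℝ) = 0 := by simp [measureReal_def]
    linarith [hstep a b]
  -- In a tree the product (t | y)_x is the distance from x to the projection of t to [x, y]. A
  -- component of A contains all points of the segment strictly between the projections of two of
  -- its points; these are covered, so F is constant on the component.
  set F : T → ℝ := fun t => m (gromovProduct x t y)
  have hF : LipschitzWith 1 F := by
    refine LipschitzWith.of_le_add fun a b => ?_
    have h2 := gromovProduct_left_le x a b y
    rcases le_total (gromovProduct x a y) (gromovProduct x b y) with h | h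
    · exact (hmono h).trans (le_add_of_nonneg_right dist_nonneg)
    · linarith [hlip _ _ h]
  have hle : ∀ t, gromovProduct x t y ≤ l := fun t => by
    rw [gromovProduct_comm]; exact gromovProduct_le_left x y t
  have hFA : ∀ a b, b ∈ connectedComponentIn A a → gromovProduct x a y ≤ gromovProduct x b y →
      F a = F b := fun a b hb hab => by
    have ha : a ∈ A := connectedComponentIn_nonempty_iff.1 ⟨b, hb⟩
    refine hconst _ _ hab fun τ hτ => ?_
    have hτ' : τ ∈ Icc 0 l :=
      ⟨(gromovProduct_nonneg _ _ _).trans hτ.1.le, hτ.2.le.trans (hle b)⟩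
    have hd := hγ.dist_add (mem_image_of_mem _ hτ')
    have := hT.mem_of_gromovProduct_lt hd isPreconnected_connectedComponentIn
      (mem_connectedComponentIn ha) hb (by rw [hx τ hτ']; exact hτ.1)
      (by rw [hx τ hτ']; exact hτ.2)
    obtain ⟨i, hi, hiB⟩ := hcov _ (mem_image_of_mem _ hτ') (connectedComponentIn_subset _ _ this)
    exact mem_biUnion (by exact_mod_cast hi) ⟨hτ', hiB⟩
  have hkey := Collapse.edist_le_eDist (A := A) hF (fun a b hab => by
    rcases Quotient.exact hab with h | h
    · rw [h]
    · rcases le_total (gromovProduct x a y) (gromovProduct x b y) with h' | h'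
      · exact hFA a b h h'
      · have ha : a ∈ A := connectedComponentIn_nonempty_iff.1 ⟨b, h⟩
        exact (hFA b a (connectedComponentIn_eq h ▸ mem_connectedComponentIn ha) h').symm) x y
  have hFx : F x = 0 := by
    simp [F, m, gromovProduct]
  have hFy : F y = volume.real (Ioc 0 l \ S) := by
    simp [F, m, gromovProduct, l]
  rw [hFx, hFy, edist_dist, Real.dist_eq, zero_sub, abs_neg, abs_of_nonneg measureReal_nonneg,
    ofReal_measureReal (hIoc _ _)] at hkey
  calc ENNReal.ofReal l = volume (Ioc 0 l) := by simp
    _ ≤ volume (Ioc 0 l \ S ∪ S) := measure_mono (fun τ hτ => by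
        by_cases h : τ ∈ S
        · exact Or.inr h
        · exact Or.inl ⟨hτ, h⟩)
    _ ≤ volume (Ioc 0 l \ S) + volume S := measure_union_le _ _
    _ ≤ _ := add_le_add hkey hSfin

theorem subset_clusterUnion {r : ℝ} {𝒩 : Set (Set T)} {A : Set T} (hA : A ∈ 𝒩) :
    A ⊆ clusterUnion r 𝒩 := by
  intro p hp
  refine ⟨{A}, by simpa using hA, ?_, p, by simpa using hp, p, by simpa using hp, by simp⟩
  rintro _ rfl _ rfl
  exact (setEDist_le_edist hp hp).trans (by simp)

/-- A point of the hull lies on a segment whose ends are in two members of the collection. These are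
r-close and of bounded diameter, so the size of the collection does not matter. -/
theorem exists_near_of_mem_clusterUnion {r a : ℝ} (hr : 0 ≤ r) {𝒩 : Set (Set T)}
    (ha : ∀ A ∈ 𝒩, ∀ p ∈ A, ∀ q ∈ A, dist p q ≤ a) {p : T} (hp : p ∈ clusterUnion r 𝒩) :
    ∃ A ∈ 𝒩, ∃ q ∈ A, dist p q ≤ 2 * a + r + 1 := by
  obtain ⟨𝒜, h𝒜, hd, x, ⟨A, hA, hx⟩, y, ⟨B, hB, hy⟩, hxy⟩ := hp
  obtain ⟨x', hx', y', hy', hlt⟩ := exists_dist_lt_of_setEDist_le hr (hd A hA B hB)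
  refine ⟨A, h𝒜 hA, x, hx, ?_⟩
  linarith [ha A (h𝒜 hA) x hx x' hx', ha B (h𝒜 hB) y' hy' y hy, dist_triangle4 x x' y' y,
    dist_nonneg (x := p) (y := y), dist_comm x p]

end CollapsedTrees

/-! ### Tree systems -/

namespace HHSConstants

/-- A bound for the distance between `π_U(x)` and `φ_U(ψ_U(x))`, for `x` in the hull. -/
noncomputable def treeConst (c : HHSConstants) (θ C : ℝ) : ℝ := |θ| + 3 * c.ξ + 2 * C + 1

/-- Two domains in which a point of the hull has at least this distance from all marked points and
all shadows are orthogonal. -/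
noncomputable def farConst (c : HHSConstants) (L θ : ℝ) : ℝ :=
  2 * c.cons + 2 * c.bgi + (2 * c.rayConst L + 36 * c.δ + |θ| + c.ξ) + 3 * c.E + 1

/-- The lower bound for `R`. -/
noncomputable def minR (c : HHSConstants) (L θ C : ℝ) : ℝ :=
  C * (c.E + 2 * c.treeConst θ C + C) +
    C * (c.farConst L θ + 2 * C + 1 + c.rayConst L + c.treeConst θ C)

variable (c : HHSConstants) {L θ C : ℝ}

theorem treeConst_nonneg (hC : 1 ≤ C) : 0 ≤ c.treeConst θ C := by
  have := c.ξ_nonneg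
  unfold treeConst; positivity

theorem farConst_bounds (hL : 1 ≤ L) : 2 * c.cons ≤ c.farConst L θ ∧
    2 * c.bgi + (2 * c.rayConst L + 36 * c.δ + θ + c.ξ) ≤ c.farConst L θ ∧
    3 * c.E + 1 ≤ c.farConst L θ := by
  have := c.cons_pos
  have := c.bgi_pos
  have := c.δ_nonneg
  have := c.ξ_nonneg
  have := c.E_pos
  have := (c.rayConst_bounds hL).2
  have := le_abs_self θ
  have := abs_nonneg θ
  unfold farConst
  refine ⟨?_, ?_, ?_⟩ <;> linarith

theorem minR_bounds (hL : 1 ≤ L) (hC : 1 ≤ C) :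
    0 ≤ c.minR L θ C ∧ C * (c.E + 2 * c.treeConst θ C + C) ≤ c.minR L θ C ∧
    C * (c.farConst L θ + 2 * C + 1 + c.rayConst L + c.treeConst θ C) ≤ c.minR L θ C := by
  have h1 := c.treeConst_nonneg (θ := θ) hC
  have h2 := (c.rayConst_bounds hL).2
  have h3 := (c.farConst_bounds (θ := θ) hL).1
  have h4 := c.cons_pos
  have h5 := c.E_pos
  have h6 : 0 ≤ C * (c.E + 2 * c.treeConst θ C + C) := by positivity
  have h7 : 0 ≤ C * (c.farConst L θ + 2 * C + 1 + c.rayConst L + c.treeConst θ C) :=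
    mul_nonneg (by linarith) (by linarith)
  unfold minR
  refine ⟨?_, ?_, ?_⟩ <;> linarith

end HHSConstants

namespace ReducedTreeSystem

open Filter

variable {X : Type u} [MetricSpace X] {𝔖 : Type v} [PartialOrder 𝔖] {𝒞 : 𝔖 → Type w}
  [∀ U, MetricSpace (𝒞 U)] {c : HHSConstants} {D : HHSData X 𝔖 𝒞} {L : ℝ}
  {P : HullInput c D L} {M K C R r θ : ℝ} (𝒯 : ReducedTreeSystem.{u, v, w, t} P M K C)
  (hD : IsNormalizedHHS c D)

include hD in
theorem dist_φ_ψ_le (hC : 1 ≤ C) {x : X} (hx : x ∈ P.hull M θ) (U : P.relevant M K) :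
    dist (hD.pr U x) (𝒯.φ U (𝒯.ψ U x)) ≤ c.treeConst θ C := by
  obtain ⟨z, hz, hd⟩ := hD.exists_dist_hypHull_lt P hx U.1
  obtain ⟨p, hp, hmin⟩ := 𝒯.ψ_spec U x
  have h1 := 𝒯.φ_hull U
  rw [Metric.hausdorffEDist_comm] at h1
  obtain ⟨_, ⟨s, rfl⟩, hs⟩ := exists_dist_lt_of_infEDist_le (by linarith)
    ((Metric.infEDist_le_hausdorffEDist_of_mem hz).trans h1)
  unfold HHSConstants.treeConst
  linarith [hD.dist_pr_le hp, hmin s, dist_triangle4 p (hD.pr U x) z (𝒯.φ U s), le_abs_self θ,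
    dist_triangle_left (hD.pr U x) (𝒯.φ U (𝒯.ψ U x)) p]

theorem dist_ψ_le (hC : 1 ≤ C) {x y : X} (hx : x ∈ P.hull M θ) (hy : y ∈ P.hull M θ)
    (U : P.relevant M K) : dist (𝒯.ψ U x) (𝒯.ψ U y) ≤
      C * (dist (hD.pr U x) (hD.pr U y) + 2 * c.treeConst θ C + C) := by
  refine ((𝒯.φ_qi U).dist_le (by linarith) (mem_univ _) (mem_univ _)).trans ?_
  gcongr
  linarith [𝒯.dist_φ_ψ_le hD hC hx U, 𝒯.dist_φ_ψ_le hD hC hy U,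
    dist_triangle4_left (hD.pr U x) (hD.pr U y) (𝒯.φ U (𝒯.ψ U x)) (𝒯.φ U (𝒯.ψ U y))]

theorem dist_pr_le (hC : 1 ≤ C) {x y : X} (hx : x ∈ P.hull M θ) (hy : y ∈ P.hull M θ)
    (U : P.relevant M K) : dist (hD.pr U x) (hD.pr U y) ≤
      C * dist (𝒯.ψ U x) (𝒯.ψ U y) + C + 2 * c.treeConst θ C := by
  linarith [(𝒯.φ_qi U (𝒯.ψ U x) (mem_univ _) (𝒯.ψ U y) (mem_univ _)).2,
    𝒯.dist_φ_ψ_le hD hC hx U, 𝒯.dist_φ_ψ_le hD hC hy U,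
    dist_triangle4_right (hD.pr U x) (hD.pr U y) (𝒯.φ U (𝒯.ψ U x)) (𝒯.φ U (𝒯.ψ U y))]

include hD in
theorem exists_shadow_near (hC : 1 ≤ C) {U V : P.relevant M K} (hV : V.1 < U.1) {q : 𝒞 U}
    (hq : q ∈ D.rho V.1 U) : ∃ m ∈ 𝒯.shadow U V, dist (𝒯.φ U m) q ≤ C + 1 + c.ξ := by
  obtain ⟨_, ⟨m, hm, rfl⟩, q', hq', hlt⟩ :=
    exists_dist_lt_of_setEDist_le (by linarith) (𝒯.shadow_spec U V (Or.inl hV))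
  exact ⟨m, hm, by linarith [dist_triangle (𝒯.φ U m) q' q, hD.dist_rho_le (Or.inl hV) hq' hq]⟩

/-- A description of the neighborhoods of which the clusters consist. -/
theorem exists_near_of_mem_nbhds (hR : 0 ≤ R) {U : P.relevant M K} {A : Set (𝒯.T U)}
    (hA : A ∈ 𝒯.nbhds R U) {q : 𝒯.T U} (hq : q ∈ A) :
    (∃ V : P.relevant M K, V.1 < U.1 ∧ ∃ s ∈ 𝒯.shadow U V, dist q s < 2 * R + 1) ∨
    (∃ a ∈ P.F, dist q (𝒯.mark U a) < 2 * R + 1) ∨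
    ∃ h ∈ P.Λ, U.1 ∉ raySupp D h ∧ dist q (𝒯.rayMark U h) < 2 * R + 1 := by
  have hR' : 0 ≤ 2 * R := by linarith
  rcases hA with (⟨V, hV, rfl⟩ | ⟨a, ha, rfl⟩) | ⟨h, hh, hU, rfl⟩
  · exact Or.inl ⟨V, hV, exists_dist_lt_of_infEDist_le hR' (Metric.mem_cthickening_iff.1 hq)⟩
  · obtain ⟨_, rfl, h1⟩ := exists_dist_lt_of_infEDist_le hR' (Metric.mem_cthickening_iff.1 hq)
    exact Or.inr (Or.inl ⟨a, ha, h1⟩)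
  · obtain ⟨_, rfl, h1⟩ := exists_dist_lt_of_infEDist_le hR' (Metric.mem_cthickening_iff.1 hq)
    exact Or.inr (Or.inr ⟨h, hh, hU, h1⟩)

theorem dist_le_of_mem_nbhds (hC : 1 ≤ C) (hR : 0 ≤ R) {U : P.relevant M K} {A : Set (𝒯.T U)}
    (hA : A ∈ 𝒯.nbhds R U) {p q : 𝒯.T U} (hp : p ∈ A) (hq : q ∈ A) :
    dist p q ≤ 4 * R + 2 + C := by
  have hR' : 0 ≤ 2 * R := by linarith
  rcases hA with (⟨V, hV, rfl⟩ | ⟨a, ha, rfl⟩) | ⟨h, hh, hU, rfl⟩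
  all_goals
    obtain ⟨s, hs, h1⟩ := exists_dist_lt_of_infEDist_le hR' (Metric.mem_cthickening_iff.1 hp)
    obtain ⟨s', hs', h2⟩ := exists_dist_lt_of_infEDist_le hR' (Metric.mem_cthickening_iff.1 hq)
    have h4 := dist_triangle4_right p q s s'
  · linarith [dist_le_of_ediam_le (by linarith) (𝒯.shadow_diam U V (Or.inl hV)) hs hs']
  · rw [hs, hs', dist_self] at *; linarith
  · rw [hs, hs', dist_self] at *; linarith

/-- Points outside the clusters are far from the shadows and the marked points. -/
theorem lt_dist_of_notMem_clusters {U : P.relevant M K} {p : 𝒯.T U}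
    (hp : p ∉ 𝒯.clusters R r U) {A : Set (𝒯.T U)}
    (hA : Metric.cthickening (2 * R) A ∈ 𝒯.nbhds R U) {s : 𝒯.T U} (hs : s ∈ A) :
    2 * R < dist p s := by
  by_contra! h
  exact hp (subset_clusterUnion hA (Metric.mem_cthickening_of_dist_le _ _ _ _ hs h))

/-- `x` projects to `𝒞 U` far from the elements of `F ∪ Λ` and from the relevant domains properly
nested in `U`. -/
def IsFar (P : HullInput c D L) (M K R' : ℝ) (hD : IsNormalizedHHS c D) (x : X) (U : 𝔖) : Prop :=
  (∀ i ∈ P.idx, ∀ᶠ t in atTop, R' ≤ dist (hD.pr U x) (hD.pr U (approxPoint i t))) ∧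
    ∀ V ∈ P.relevant M K, V < U → ∀ q ∈ D.rho V U, R' ≤ dist (hD.pr U x) q

/-- A segment inside the clusters collapses to a point, so here some p on the segment is outside
them and more than 2R away from shadows and marked points. Then ψ_U(x), within R of p, is still R
away, and `minR` translates this to 𝒞 U. Rays supported on U diverge from x there anyway. -/
theorem isFar_of_eDist_ne_zero (hL : 1 ≤ L) (hC : 1 ≤ C) (hM : c.bgi + 33 * c.δ ≤ M)
    (hR : c.minR L θ C ≤ R) {x y : X} (hx : x ∈ P.hull M θ)
    {U : P.relevant M K} (hxy : dist (𝒯.ψ U x) (𝒯.ψ U y) ≤ R)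
    (he : Collapse.eDist (𝒯.hat R r U x) (𝒯.hat R r U y) ≠ 0) :
    IsFar P M K (c.farConst L θ) hD x U := by
  obtain ⟨hR0, -, hR2⟩ := c.minR_bounds (θ := θ) hL hC
  have hrc := c.rayConst_bounds hL
  obtain ⟨p, hp, hpc⟩ : ∃ p, dist (𝒯.ψ U x) p + dist p (𝒯.ψ U y) = dist (𝒯.ψ U x) (𝒯.ψ U y) ∧
      p ∉ 𝒯.clusters R r U := by
    by_contra! h
    exact he (Collapse.eDist_eq_zero_of_segment_subset (𝒯.tree U) h)
  have hxp : dist (𝒯.ψ U x) p ≤ R := by linarith [dist_nonneg (x := p) (y := 𝒯.ψ U y)]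
  have key : ∀ A : Set (𝒯.T U), Metric.cthickening (2 * R) A ∈ 𝒯.nbhds R U → ∀ m ∈ A,
      ∀ q : 𝒞 U, dist (𝒯.φ U m) q ≤ C + 1 + c.rayConst L →
      c.farConst L θ ≤ dist (hD.pr U x) q := by
    intro A hA m hm q hq
    have h1 := 𝒯.lt_dist_of_notMem_clusters hpc hA hm
    have h2 : R ≤ dist (𝒯.ψ U x) m := by linarith [dist_triangle_left p m (𝒯.ψ U x)]
    have h3 := (𝒯.φ_qi U).dist_le (by linarith) (mem_univ (𝒯.ψ U x)) (mem_univ m)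
    have h4 := le_of_mul_le_mul_left (hR2.trans (hR.trans (h2.trans h3))) (by linarith)
    linarith [dist_triangle4 (𝒯.φ U (𝒯.ψ U x)) (hD.pr U x) q (𝒯.φ U m),
      𝒯.dist_φ_ψ_le hD hC hx U, dist_comm (𝒯.φ U (𝒯.ψ U x)) (hD.pr U x),
      dist_comm q (𝒯.φ U m)]
  refine ⟨?_, ?_⟩
  · rintro (a | h) hi
    · rw [HullInput.inl_mem_idx] at hi
      refine Eventually.of_forall fun t => key {𝒯.mark U a} (Or.inl (Or.inr ⟨a, hi, rfl⟩)) _ rfl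
        _ ?_
      obtain ⟨q, hq, hlt⟩ := exists_dist_lt_of_infEDist_le (by linarith) (𝒯.mark_spec U a hi)
      change dist (𝒯.φ U (𝒯.mark U a)) (hD.pr U a) ≤ _
      linarith [dist_triangle (𝒯.φ U (𝒯.mark U a)) q (hD.pr U a), hD.dist_pr_le hq]
    · rw [HullInput.inr_mem_idx] at hi
      by_cases hU : U.1 ∈ raySupp D h
      · exact hD.eventually_le_dist_of_mem_raySupp hL (P.ray h hi) hU _ _
      · obtain ⟨q, hq, hlt⟩ := exists_dist_lt_of_infEDist_le (by linarith)
          (𝒯.rayMark_spec U h hi hU)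
        filter_upwards [hD.eventually_dist_rayCoord_le P hL hM hi hU hq] with t ht
        refine key {𝒯.rayMark U h} (Or.inr ⟨h, hi, hU, rfl⟩) _ rfl _ ?_
        change dist (𝒯.φ U (𝒯.rayMark U h)) (hD.pr U (h t)) ≤ _
        linarith [dist_triangle (𝒯.φ U (𝒯.rayMark U h)) q (hD.pr U (h t))]
  · intro V hVr hV q hq
    obtain ⟨m, hm, hd⟩ := 𝒯.exists_shadow_near hD hC (V := ⟨V, hVr⟩) hV hq
    exact key _ (Or.inl (Or.inl ⟨⟨V, hVr⟩, hV, rfl⟩)) m hm q (by linarith)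

end ReducedTreeSystem

/-! ### Orthogonality of the domains where a hull point is far from marks and shadows -/

namespace IsNormalizedHHS

open Filter ReducedTreeSystem

variable {X : Type u} [MetricSpace X] {𝔖 : Type v} [PartialOrder 𝔖] {𝒞 : 𝔖 → Type w}
  [∀ U, MetricSpace (𝒞 U)] {c : HHSConstants} {D : HHSData X 𝔖 𝒞} {L : ℝ}
  {P : HullInput c D L} {M K θ : ℝ} (hD : IsNormalizedHHS c D)

include hD

/-- If x were near ρ^{U'}_U, the points that replace F ∪ Λ, being far from x in 𝒞 U, would be far
from ρ^{U'}_U. By consistency all of them would gather at ρ^U_{U'}, contrary to the relevance of U'.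
-/
theorem not_dist_lt_of_isFar (hL : 1 ≤ L) (hM : c.bgi + 33 * c.δ ≤ M)
    (hK : 2 * (c.cons + c.rayConst L) ≤ K) {x : X} {U U' : 𝔖}
    (hf : IsFar P M K (c.farConst L θ) hD x U) (hU' : U' ∈ P.relevant M K)
    (hT : D.Transverse U' U) {q : 𝒞 U} (hq : q ∈ D.rho U' U) :
    ¬ dist (hD.pr U x) q < c.cons := by
  intro hlt
  obtain ⟨q', hq'⟩ := hD.rho_nonempty U U' (Or.inr (hD.transverse_symm hT))
  have h1 : ∀ i ∈ P.idx, ∀ᶠ t in atTop, dist q' (hD.pr U' (approxPoint i t)) ≤ c.cons := by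
    intro i hi
    filter_upwards [hf.1 i hi] with t ht
    rcases hD.transverse_dist_lt hT (approxPoint i t) hq hq' with h2 | h2
    · linarith [(c.farConst_bounds (θ := θ) hL).1,
        dist_triangle_right (hD.pr U x) (hD.pr U (approxPoint i t)) q]
    · rw [dist_comm]; exact h2.le
  linarith [hD.lt_of_eventually_near P hL hM hU' le_rfl h1]

/-- In 𝒞 U the point x is coarsely on a geodesic between some i and j, and ρ^{U'}_U is far from x,
so it can be close to at most one half. Bounded geodesic image along the other half puts x near i or
j in 𝒞 U', where x is far from both. -/
theorem not_lt_of_isFar (hL : 1 ≤ L) (hM : c.bgi + 33 * c.δ ≤ M) {x : X}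
    (hx : x ∈ P.hull M θ) {U U' : 𝔖} (hf : IsFar P M K (c.farConst L θ) hD x U)
    (hf' : IsFar P M K (c.farConst L θ) hD x U') (hU' : U' ∈ P.relevant M K) : ¬ U' < U := by
  intro hlt
  obtain ⟨q, hq⟩ := hD.rho_nonempty U' U (Or.inl hlt)
  have hfar := hf.2 U' hU' hlt q hq
  obtain ⟨t, ⟨i, hi, j, hj, hg⟩, h2⟩ := ((hD.eventually_gromovProduct_hull_le P hL hM hx U).and
    ((Filter.eventually_all_finset P.idx).2 hf'.1)).exists
  obtain ⟨-, b2, b3⟩ := c.farConst_bounds (θ := θ) hL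
  -- The two products sum to at least d(q, x) - (i | j)_x, so one of them reaches `bgi`.
  have hsum : dist (hD.pr U x) q - (2 * c.rayConst L + 36 * c.δ + θ + c.ξ) ≤
      gromovProduct q (hD.pr U x) (hD.pr U (approxPoint i t)) +
        gromovProduct q (hD.pr U x) (hD.pr U (approxPoint j t)) := by
    unfold gromovProduct at hg ⊢
    linarith [dist_triangle_left (hD.pr U (approxPoint i t)) (hD.pr U (approxPoint j t)) q,
      dist_comm q (hD.pr U x)]
  rcases le_or_gt c.bgi (gromovProduct q (hD.pr U x) (hD.pr U (approxPoint i t))) with h | h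
  · linarith [hD.dist_pr_pr_le hlt hq h, h2 i hi]
  · linarith [hD.dist_pr_pr_le hlt hq (x := x) (y := approxPoint j t) (by linarith), h2 j hj]

/-- The relevant domains in which a point of the hull is far from all marked points and shadows are
pairwise orthogonal. -/
theorem pairwise_orth_isFar (hL : 1 ≤ L) (hM : c.bgi + 33 * c.δ ≤ M)
    (hK : 2 * (c.cons + c.rayConst L) ≤ K) {x : X} (hx : x ∈ P.hull M θ) :
    {U | U ∈ P.relevant M K ∧ IsFar P M K (c.farConst L θ) hD x U}.Pairwise D.Orth := by
  rintro U ⟨hU, hf⟩ U' ⟨hU', hf'⟩ hne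
  by_contra ho
  have hT : D.Transverse U U' := ⟨ho,
    fun h => hD.not_lt_of_isFar hL hM hx hf' hf hU (lt_of_le_of_ne h hne),
    fun h => hD.not_lt_of_isFar hL hM hx hf hf' hU' (lt_of_le_of_ne h hne.symm)⟩
  have hT' := hD.transverse_symm hT
  obtain ⟨q, hq⟩ := hD.rho_nonempty U U' (Or.inr hT)
  obtain ⟨q', hq'⟩ := hD.rho_nonempty U' U (Or.inr hT')
  rcases hD.transverse_dist_lt hT x hq hq' with h | h
  · exact hD.not_dist_lt_of_isFar hL hM hK hf' hU hT hq h
  · exact hD.not_dist_lt_of_isFar hL hM hK hf hU' hT' hq' h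

end IsNormalizedHHS

/-! ### The upper bound for the distance in the model -/

namespace HHSConstants

/-- The bound for `d_{T_U}(ψ_U(x), ψ_U(y))` in terms of `d_U(x, y)`, additive part. -/
noncomputable def addConst (c : HHSConstants) (θ C : ℝ) : ℝ≥0 :=
  (C * (2 * c.treeConst θ C + C)).toNNReal

/-- The multiplicative constant of the upper bound for the distance in the model. -/
noncomputable def upperMul (c : HHSConstants) (θ C K₂ : ℝ) : ℝ≥0 :=
  C.toNNReal + (C.toNNReal * K₂.toNNReal + c.addConst θ C) * countConst c K₂

/-- The additive constant of the upper bound for the distance in the model. -/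
noncomputable def upperAdd (c : HHSConstants) (θ C K₂ : ℝ) : ℝ≥0 :=
  (C.toNNReal * K₂.toNNReal + c.addConst θ C) * countConst c K₂ +
    c.complexity * (C.toNNReal * c.E.toNNReal + c.addConst θ C)

end HHSConstants

namespace ReducedTreeSystem

variable {X : Type u} [MetricSpace X] {𝔖 : Type v} [PartialOrder 𝔖] {𝒞 : 𝔖 → Type w}
  [∀ U, MetricSpace (𝒞 U)] {c : HHSConstants} {D : HHSData X 𝔖 𝒞} {L : ℝ}
  {P : HullInput c D L} {M K C R r θ : ℝ} (𝒯 : ReducedTreeSystem.{u, v, w, t} P M K C)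
  (hD : IsNormalizedHHS c D)

include hD in
theorem eDist_hat_le (hC : 1 ≤ C) {x y : X} (hx : x ∈ P.hull M θ) (hy : y ∈ P.hull M θ)
    (U : P.relevant M K) : Collapse.eDist (𝒯.hat R r U x) (𝒯.hat R r U y) ≤
      C.toNNReal * D.d U x y + c.addConst θ C := by
  have hC0 : 0 ≤ C := by linarith
  have htc := c.treeConst_nonneg (θ := θ) hC
  refine (Collapse.eDist_mk_le _ _ _).trans ?_
  rw [edist_dist]
  refine (ENNReal.ofReal_le_ofReal (𝒯.dist_ψ_le hD hC hx hy U)).trans ?_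
  rw [add_assoc, mul_add, ENNReal.ofReal_add (by positivity) (by positivity),
    ENNReal.ofReal_mul hC0]
  exact add_le_add (mul_le_mul_right (hD.ofReal_dist_le_d U x y) _) le_rfl

include hD in
theorem modelDist_le (hL : 1 ≤ L) (hC : 1 ≤ C) (hM : c.bgi + 33 * c.δ ≤ M)
    (hR : c.minR L θ C ≤ R) (hK : 2 * (c.cons + c.rayConst L) ≤ K) (K₂ : ℝ) {x y : X}
    (hx : x ∈ P.hull M θ) (hy : y ∈ P.hull M θ) :
    𝒯.modelDist R r x y ≤ c.upperMul θ C K₂ * (∑' U, threshold K₂ (D.d U x y)) +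
      c.upperAdd θ C K₂ := by
  classical
  obtain ⟨s, hs, hcard⟩ := hD.exists_finset_large x y K₂
  set Q := ∑' U, threshold K₂ (D.d U x y)
  set O : Set 𝔖 := {U | U ∈ P.relevant M K ∧ IsFar P M K (c.farConst L θ) hD x U}
  have hO := hD.encard_le_of_orth (hD.pairwise_orth_isFar hL hM hK hx)
  have hOfin : O.Finite := Set.finite_of_encard_le_coe hO
  have hOcard : (hOfin.toFinset.card : ℝ≥0∞) ≤ c.complexity := by
    have h1 : O.encard ≤ c.complexity := hO
    rw [hOfin.encard_eq_coe_toFinset_card] at h1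
    exact_mod_cast h1
  set a : ℝ≥0∞ := ENNReal.ofReal C with ha
  set b : ℝ≥0∞ := ENNReal.ofNNReal (c.addConst θ C) with hb
  set e : ℝ≥0∞ := ENNReal.ofReal c.E with he
  -- g₁ pays for a finite set containing all domains with d_U ≥ E, g₂ for the orthogonal domains in
  -- which x is far; all other summands vanish.
  set g₁ : 𝔖 → ℝ≥0∞ := fun U => if U ∈ s then a * D.d U x y + b else 0
  set g₂ : 𝔖 → ℝ≥0∞ := fun U => if U ∈ hOfin.toFinset then a * e + b else 0
  have hpt : ∀ U : P.relevant M K,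
      Collapse.eDist (𝒯.hat R r U x) (𝒯.hat R r U y) ≤ g₁ U + g₂ U := by
    intro U
    have h1 := 𝒯.eDist_hat_le hD (R := R) (r := r) hC hx hy U
    by_cases hU : U.1 ∈ s
    · refine le_trans ?_ le_self_add
      simp only [g₁, hU, if_true]
      exact h1
    by_cases h0 : Collapse.eDist (𝒯.hat R r U x) (𝒯.hat R r U y) = 0
    · rw [h0]; exact zero_le
    have hlt : D.d U.1 x y < e := not_le.1 fun h => hU (hs U.1 h)
    have hd : dist (hD.pr U.1 x) (hD.pr U.1 y) ≤ c.E :=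
      (ENNReal.ofReal_le_ofReal_iff c.E_pos.le).1 ((hD.ofReal_dist_le_d U.1 x y).trans hlt.le)
    have hfar := 𝒯.isFar_of_eDist_ne_zero hD hL hC hM hR hx (U := U)
      ((𝒯.dist_ψ_le hD hC hx hy U).trans ((mul_le_mul_of_nonneg_left (by linarith)
        (by linarith)).trans ((c.minR_bounds hL hC).2.1.trans hR))) h0
    have hmem : U.1 ∈ hOfin.toFinset := hOfin.mem_toFinset.2 ⟨U.2, hfar⟩
    refine le_trans ?_ le_add_self
    simp only [g₂, hmem, if_true]
    exact h1.trans (add_le_add (mul_le_mul' le_rfl hlt.le) le_rfl)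
  calc 𝒯.modelDist R r x y ≤ ∑' U : P.relevant M K, (g₁ U + g₂ U) := ENNReal.tsum_le_tsum hpt
    _ ≤ ∑' U, (g₁ U + g₂ U) :=
        ENNReal.tsum_comp_le_tsum_of_injective Subtype.val_injective (fun U => g₁ U + g₂ U)
    _ = ∑ U ∈ s, (a * D.d U x y + b) + hOfin.toFinset.card * (a * e + b) := by
        rw [ENNReal.tsum_add, tsum_eq_sum (s := s) (fun U hU => by simp [g₁, hU]),
          tsum_eq_sum (s := hOfin.toFinset) (fun U hU => by simp only [g₂, hU, if_false])]
        congr 1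
        · exact Finset.sum_congr rfl fun U hU => by simp [g₁, hU]
        · rw [Finset.sum_congr rfl (fun U hU => if_pos hU), Finset.sum_const, nsmul_eq_mul]
    _ ≤ ∑ U ∈ s, (a * threshold K₂ (D.d U x y) + (a * ENNReal.ofReal K₂ + b)) +
          c.complexity * (a * e + b) := by
        refine add_le_add (Finset.sum_le_sum fun U _ => ?_) (mul_le_mul' hOcard le_rfl)
        rw [← add_assoc, ← mul_add]
        gcongr
        exact le_threshold_add _ _
    _ = a * ∑ U ∈ s, threshold K₂ (D.d U x y) + s.card * (a * ENNReal.ofReal K₂ + b) +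
          c.complexity * (a * e + b) := by
        rw [Finset.sum_add_distrib, Finset.mul_sum, Finset.sum_const, nsmul_eq_mul]
    _ ≤ a * Q + (countConst c K₂ * (Q + 1)) * (a * ENNReal.ofReal K₂ + b) +
          c.complexity * (a * e + b) := by
        gcongr
        exact ENNReal.sum_le_tsum s
    _ = _ := by
        simp only [HHSConstants.upperMul, HHSConstants.upperAdd, ha, hb, he, ENNReal.ofReal]
        push_cast
        ring

end ReducedTreeSystem

/-! ### Charging collapsed segments to nested domains -/

/-- The coarse center of a geodesic triangle is coarsely unique. -/
theorem IsHyperbolicSpace.dist_le_of_centers {Z : Type*} [PseudoMetricSpace Z] {δ κ : ℝ}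
    (hZ : IsHyperbolicSpace δ Z) (hδ : 0 ≤ δ) {z₁ z₂ a w w' : Z}
    (h₁ : gromovProduct w z₁ z₂ ≤ κ) (h₂ : gromovProduct w z₁ a ≤ κ)
    (h₃ : gromovProduct w z₂ a ≤ κ) (h₁' : gromovProduct w' z₁ z₂ ≤ κ)
    (h₂' : gromovProduct w' z₁ a ≤ κ) (h₃' : gromovProduct w' z₂ a ≤ κ) :
    dist w w' ≤ 5 * κ + 6 * δ := by
  have h4 := hZ.min_le_gromovProduct hδ z₁ w z₂ w'
  have e1 := gromovProduct_add_swap z₁ w z₂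
  have e2 := gromovProduct_add_swap z₁ w' z₂
  rw [gromovProduct_comm z₁ z₂ w'] at h4
  have t1 := dist_triangle z₂ w a
  have t2 := dist_triangle z₂ w' a
  have t3 := dist_triangle z₁ w z₂
  have t4 := dist_triangle z₁ w' z₂
  have t5 := dist_triangle z₁ w a
  have t6 := dist_triangle z₁ w' a
  have c1 := dist_comm w z₁
  have c2 := dist_comm w z₂
  have c3 := dist_comm w' z₁
  have c4 := dist_comm w' z₂
  unfold gromovProduct at *
  rcases min_le_iff.1 h4 with h | h <;> linarith

namespace HHSConstants

/-- A bound for the distance between points of a cluster and shadows or marked points. -/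
noncomputable def coverRad (R r C : ℝ) : ℝ := 2 * (4 * R + 2 + C) + r + 1 + (2 * R + 1)

/-- A bound for the distance between `φ_U(p)` and `ρ^V_U` for `p` at distance at most `a` from the
shadow of `V`. -/
noncomputable def shadowConst (c : HHSConstants) (C a : ℝ) : ℝ :=
  C * (a + C) + C + (C + 1 + c.ξ)

/-- A bound for the distance between the sides of a triangle and its centers. -/
noncomputable def centerConst (c : HHSConstants) (θ C a : ℝ) : ℝ :=
  c.bgi + c.shadowConst C a + morseConst c.δ C C + 2 * c.treeConst θ C

/-- The radius of the ball about an end of a segment that is disregarded. -/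
noncomputable def endRad (c : HHSConstants) (θ C a : ℝ) : ℝ :=
  C * (c.shadowConst C a + 2 * c.cons + c.treeConst θ C + C)

/-- The diameters of the sets by which the collapsed parts of a segment are covered. -/
noncomputable def coverConst (c : HHSConstants) (θ C a : ℝ) : ℝ :=
  2 * a + C + 2 * c.endRad θ C a +
    C * (2 * c.shadowConst C a + (5 * c.centerConst θ C a + 6 * c.δ) + C)

variable (c : HHSConstants) {θ C a : ℝ}

theorem shadowConst_nonneg (hC : 1 ≤ C) (ha : 0 ≤ a) : 0 ≤ c.shadowConst C a := by
  have := c.ξ_nonneg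
  unfold shadowConst; positivity

theorem centerConst_bounds (hC : 1 ≤ C) (ha : 0 ≤ a) : c.bgi ≤ c.centerConst θ C a ∧
    c.shadowConst C a + morseConst c.δ C C + 2 * c.treeConst θ C ≤ c.centerConst θ C a := by
  have h1 := c.shadowConst_nonneg hC ha
  have h2 := morseConst_nonneg (δ := c.δ) (κ := C) (ε := C) (by linarith) (by linarith)
  have h3 := c.treeConst_nonneg (θ := θ) hC
  have h4 := c.bgi_pos
  unfold centerConst
  constructor <;> linarith

theorem coverConst_bounds (hC : 1 ≤ C) (ha : 0 ≤ a) : 0 ≤ c.coverConst θ C a ∧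
    2 * a + C ≤ c.coverConst θ C a ∧ 2 * c.endRad θ C a ≤ c.coverConst θ C a ∧
    C * (2 * c.shadowConst C a + (5 * c.centerConst θ C a + 6 * c.δ) + C) ≤
      c.coverConst θ C a := by
  have h1 := c.shadowConst_nonneg hC ha
  have h2 := (c.centerConst_bounds (θ := θ) hC ha).1
  have h3 := c.treeConst_nonneg (θ := θ) hC
  have h4 := c.bgi_pos
  have h5 := c.cons_pos
  have h6 := c.δ_nonneg
  have h7 : 0 ≤ C * (2 * c.shadowConst C a + (5 * c.centerConst θ C a + 6 * c.δ) + C) :=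
    mul_nonneg (by linarith) (by linarith)
  have h8 : 0 ≤ c.endRad θ C a := mul_nonneg (by linarith) (by linarith)
  unfold coverConst
  refine ⟨?_, ?_, ?_, ?_⟩ <;> linarith

end HHSConstants

namespace ReducedTreeSystem

open Filter

variable {X : Type u} [MetricSpace X] {𝔖 : Type v} [PartialOrder 𝔖] {𝒞 : 𝔖 → Type w}
  [∀ U, MetricSpace (𝒞 U)] {c : HHSConstants} {D : HHSData X 𝔖 𝒞} {L : ℝ}
  {P : HullInput c D L} {M K C R r θ a : ℝ} (𝒯 : ReducedTreeSystem.{u, v, w, t} P M K C)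
  (hD : IsNormalizedHHS c D)

include hD in
theorem dist_φ_rho_le (hC : 1 ≤ C) {U V : P.relevant M K} (hV : V.1 < U.1) {p s : 𝒯.T U}
    (hs : s ∈ 𝒯.shadow U V) (hps : dist p s ≤ a) {q : 𝒞 U} (hq : q ∈ D.rho V.1 U) :
    dist (𝒯.φ U p) q ≤ c.shadowConst C a := by
  obtain ⟨m, hm, hd⟩ := 𝒯.exists_shadow_near hD hC hV hq
  have h1 := dist_le_of_ediam_le (by linarith) (𝒯.shadow_diam U V (Or.inl hV)) hs hm
  have h2 : dist p m ≤ a + C := by linarith [dist_triangle p s m]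
  have h3 := (𝒯.φ_qi U p (mem_univ _) m (mem_univ _)).2
  have h4 : C * dist p m ≤ C * (a + C) := by gcongr
  unfold HHSConstants.shadowConst
  linarith [dist_triangle (𝒯.φ U p) (𝒯.φ U m) q]

/-- φ_U maps the tree segment to a quasigeodesic, so by the Morse lemma φ_U(p), and with it the
nearby ρ^V_U, is coarsely between π_U(x) and π_U(y). -/
theorem gromovProduct_rho_le (hC : 1 ≤ C) {x y : X} (hx : x ∈ P.hull M θ)
    (hy : y ∈ P.hull M θ) {U V : P.relevant M K} (hV : V.1 < U.1) {γ : Set (𝒯.T U)}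
    (hγ : IsGeodesicSegment (𝒯.ψ U x) (𝒯.ψ U y) γ) {p s : 𝒯.T U} (hp : p ∈ γ)
    (hs : s ∈ 𝒯.shadow U V) (hps : dist p s ≤ a) {q : 𝒞 U} (hq : q ∈ D.rho V.1 U) :
    gromovProduct q (hD.pr U x) (hD.pr U y) ≤
      c.shadowConst C a + morseConst c.δ C C + 2 * c.treeConst θ C := by
  obtain ⟨σ, h0, h1, hσ, rfl⟩ := hγ
  obtain ⟨τ, hτ, rfl⟩ := hp
  have hqi : IsQIEmbeddingOn C C (Icc 0 (dist (𝒯.ψ U x) (𝒯.ψ U y))) (fun τ => 𝒯.φ U (σ τ)) := by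
    intro b hb b' hb'
    rw [Real.dist_eq, ← hσ b hb b' hb']
    exact 𝒯.φ_qi U _ (mem_univ _) _ (mem_univ _)
  have hM := (hD.hyperbolic U).gromovProduct_le_morseConst c.δ_nonneg (by linarith)
    (by linarith) hτ hqi
  simp only [h0, h1] at hM
  have e1 := 𝒯.dist_φ_rho_le hD hC hV hs hps hq
  rw [dist_comm] at e1
  linarith [gromovProduct_base_le q (𝒯.φ U (σ τ)) (hD.pr U x) (hD.pr U y),
    gromovProduct_left_le (𝒯.φ U (σ τ)) (hD.pr U x) (𝒯.φ U (𝒯.ψ U x)) (hD.pr U y),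
    gromovProduct_right_le (𝒯.φ U (σ τ)) (𝒯.φ U (𝒯.ψ U x)) (hD.pr U y) (𝒯.φ U (𝒯.ψ U y)),
    𝒯.dist_φ_ψ_le hD hC hx U, 𝒯.dist_φ_ψ_le hD hC hy U]

/-- The points of `T_U` near the shadow of a domain which is a coarse center of the triangle
spanned by `x`, `y` and the element `i` of `F ∪ Λ`. -/
def centers (a : ℝ) (l : Filter ℝ≥0) (x y : X) (U : P.relevant M K) (i : X ⊕ (ℝ≥0 → X)) :
    Set (𝒯.T U) :=
  {p | ∃ V : P.relevant M K, V.1 < U.1 ∧ (∃ s ∈ 𝒯.shadow U V, dist p s ≤ a) ∧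
    ∃ q ∈ D.rho V.1 U, ∀ᶠ t in l,
      gromovProduct q (hD.pr U x) (hD.pr U (approxPoint i t)) < c.bgi ∧
      gromovProduct q (hD.pr U y) (hD.pr U (approxPoint i t)) < c.bgi}

/-- At a common time t both relative projections are coarse centers of the same triangle, hence
close together, and φ_U reflects closeness. -/
theorem dist_le_of_mem_centers (hC : 1 ≤ C) (ha : 0 ≤ a) {x y : X} (hx : x ∈ P.hull M θ)
    (hy : y ∈ P.hull M θ) {l : Filter ℝ≥0} [l.NeBot] {U : P.relevant M K} {γ : Set (𝒯.T U)}
    (hγ : IsGeodesicSegment (𝒯.ψ U x) (𝒯.ψ U y) γ) {i : X ⊕ (ℝ≥0 → X)} {p p' : 𝒯.T U}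
    (hp : p ∈ 𝒯.centers hD a l x y U i) (hp' : p' ∈ 𝒯.centers hD a l x y U i) (hpγ : p ∈ γ)
    (hpγ' : p' ∈ γ) :
    dist p p' ≤ C * (2 * c.shadowConst C a + (5 * c.centerConst θ C a + 6 * c.δ) + C) := by
  obtain ⟨V, hV, ⟨s, hs, hps⟩, q, hq, he⟩ := hp
  obtain ⟨V', hV', ⟨s', hs', hps'⟩, q', hq', he'⟩ := hp'
  obtain ⟨t, ⟨h1, h2⟩, h1', h2'⟩ := (he.and he').exists
  obtain ⟨b1, b2⟩ := c.centerConst_bounds (θ := θ) hC ha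
  have hd := (hD.hyperbolic U).dist_le_of_centers c.δ_nonneg
    ((𝒯.gromovProduct_rho_le hD hC hx hy hV hγ hpγ hs hps hq).trans b2) (h1.le.trans b1)
    (h2.le.trans b1) ((𝒯.gromovProduct_rho_le hD hC hx hy hV' hγ hpγ' hs' hps' hq').trans b2)
    (h1'.le.trans b1) (h2'.le.trans b1)
  refine ((𝒯.φ_qi U).dist_le (by linarith) (mem_univ _) (mem_univ _)).trans ?_
  have e1 := 𝒯.dist_φ_rho_le hD hC hV hs hps hq
  have e2 := 𝒯.dist_φ_rho_le hD hC hV' hs' hps' hq'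
  gcongr
  linarith [dist_triangle4 (𝒯.φ U p) q q' (𝒯.φ U p'), dist_comm q' (𝒯.φ U p')]

/-- Along an ultrafilter the failure to be a center holds eventually, hence for all i at common
times. Bounded geodesic image then puts each i within 3E of x or of y in 𝒞 V. If x and y were close
there, everything would be close to x and V would not be relevant. -/
theorem lt_dist_of_notMem_centers (hL : 1 ≤ L) (hM : c.bgi + 33 * c.δ ≤ M) {x y : X}
    {l : Ultrafilter ℝ≥0} (hl : (l : Filter ℝ≥0) ≤ atTop) {U V : P.relevant M K}
    (hV : V.1 < U.1) {p s : 𝒯.T U} (hs : s ∈ 𝒯.shadow U V) (hps : dist p s ≤ a)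
    (hp : ∀ i ∈ P.idx, p ∉ 𝒯.centers hD a l x y U i) :
    K / 2 - 3 * c.E - c.rayConst L < dist (hD.pr V x) (hD.pr V y) := by
  obtain ⟨q, hq⟩ := hD.rho_nonempty V.1 U.1 (Or.inl hV)
  have h1 : ∀ i ∈ P.idx, ∀ᶠ t in (l : Filter ℝ≥0), dist (hD.pr V x) (hD.pr V (approxPoint i t)) ≤
      dist (hD.pr V x) (hD.pr V y) + 3 * c.E := by
    intro i hi
    have h2 : ¬ ∀ᶠ t in (l : Filter ℝ≥0),
        gromovProduct q (hD.pr U x) (hD.pr U (approxPoint i t)) < c.bgi ∧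
        gromovProduct q (hD.pr U y) (hD.pr U (approxPoint i t)) < c.bgi :=
      fun h => hp i hi ⟨V, hV, ⟨s, hs, hps⟩, q, hq, h⟩
    rw [← Ultrafilter.eventually_not] at h2
    filter_upwards [h2] with t ht
    rcases not_and_or.1 ht with h | h
    · linarith [hD.dist_pr_pr_le hV hq (not_lt.1 h), dist_nonneg (x := hD.pr V x) (y := hD.pr V y)]
    · linarith [hD.dist_pr_pr_le hV hq (not_lt.1 h),
        dist_triangle (hD.pr V x) (hD.pr V y) (hD.pr V (approxPoint i t))]
  linarith [hD.lt_of_eventually_near P hL hM V.2 hl h1]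

open Classical in
/-- The collapse decreases distances by at most a multiple of the number of nested domains with
large projections. -/
theorem dist_ψ_le_eDist_add (hL : 1 ≤ L) (hC : 1 ≤ C) (hM : c.bgi + 33 * c.δ ≤ M)
    (hR : 0 ≤ R) (hr : 0 ≤ r) {x y : X} (hx : x ∈ P.hull M θ) (hy : y ∈ P.hull M θ)
    (U : P.relevant M K) (G : Finset (P.relevant M K))
    (hG : ∀ V : P.relevant M K,
      K / 2 - 3 * c.E - c.rayConst L < dist (hD.pr V x) (hD.pr V y) → V ∈ G) :
    ENNReal.ofReal (dist (𝒯.ψ U x) (𝒯.ψ U y)) ≤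
      Collapse.eDist (𝒯.hat R r U x) (𝒯.hat R r U y) +
        (({V ∈ G | V.1 < U.1 ∧ ∀ q ∈ D.rho V.1 U.1, 2 * c.cons ≤ dist (hD.pr U x) q}.card +
          (2 * P.card + 1) : ℕ) : ℝ≥0∞) *
        ENNReal.ofReal (c.coverConst θ C (HHSConstants.coverRad R r C)) := by
  obtain ⟨γ, hγ⟩ := (𝒯.tree U).geodesic (𝒯.ψ U x) (𝒯.ψ U y)
  set a := HHSConstants.coverRad R r C with ha_def
  have ha : 0 ≤ a := by rw [ha_def]; unfold HHSConstants.coverRad; positivity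
  obtain ⟨b0, b1, b2, b3⟩ := c.coverConst_bounds (θ := θ) hC ha
  set l : Ultrafilter ℝ≥0 := Ultrafilter.of atTop
  have hl : (l : Filter ℝ≥0) ≤ atTop := Ultrafilter.of_le _
  set G' := {V ∈ G | V.1 < U.1 ∧ ∀ q ∈ D.rho V.1 U.1, 2 * c.cons ≤ dist (hD.pr U x) q}
  -- The cover has one set for each charged V, n balls about marked points, n sets of centers and a
  -- ball about ψ_U(x). The ball of a ray supported on U is superfluous but harmless.
  set s : Finset (P.relevant M K ⊕ (X ⊕ (ℝ≥0 → X)) ⊕ (X ⊕ (ℝ≥0 → X)) ⊕ Unit) :=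
    G'.disjSum (P.idx.disjSum (P.idx.disjSum {()}))
  have hcard : s.card = G'.card + (2 * P.card + 1) := by
    simp only [s, Finset.card_disjSum, HullInput.card_idx, Finset.card_singleton]
    omega
  rw [← hcard]
  refine (𝒯.tree U).dist_le_eDist_add (𝒯.clusters R r U) hγ s
    (Sum.elim (fun V => {p | V.1 < U.1 ∧ ∃ s ∈ 𝒯.shadow U V, dist p s ≤ a})
      (Sum.elim (fun i => Metric.closedBall (i.elim (𝒯.mark U) (𝒯.rayMark U)) a)
        (Sum.elim (𝒯.centers hD a l x y U)
          (fun _ => Metric.closedBall (𝒯.ψ U x) (c.endRad θ C a))))) ?_ ?_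
  · intro p hp hpc
    obtain ⟨A, hA, q, hq, hpq⟩ := exists_near_of_mem_clusterUnion hr
      (fun A hA p hp q hq => 𝒯.dist_le_of_mem_nbhds hC hR hA hp hq) hpc
    have hle : ∀ m, dist q m < 2 * R + 1 → dist p m ≤ a := fun m hm => by
      rw [ha_def]; unfold HHSConstants.coverRad
      linarith [dist_triangle p q m]
    rcases 𝒯.exists_near_of_mem_nbhds hR hA hq with ⟨V, hV, m, hm, hd⟩ | ⟨b, hb, hd⟩ |
      ⟨h, hh, -, hd⟩
    · have hpm := hle m hd
      -- Points near ψ_U(x) are set aside, because V may be charged only if x is far from ρ^V_U.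
      -- This is what later makes the domains charging V a chain.
      by_cases hend : dist p (𝒯.ψ U x) ≤ c.endRad θ C a
      · exact ⟨Sum.inr (Sum.inr (Sum.inr ())), by simp [s], hend⟩
      by_cases hcen : ∃ i ∈ P.idx, p ∈ 𝒯.centers hD a l x y U i
      · obtain ⟨i, hi, hpi⟩ := hcen
        exact ⟨Sum.inr (Sum.inr (Sum.inl i)), by simp [s, hi], hpi⟩
      push Not at hcen
      have hlt := 𝒯.lt_dist_of_notMem_centers hD hL hM hl hV hm hpm hcen
      have hfar : ∀ q ∈ D.rho V.1 U.1, 2 * c.cons ≤ dist (hD.pr U x) q := by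
        intro q hq
        by_contra! hc
        refine hend (((𝒯.φ_qi U).dist_le (by linarith) (mem_univ p)
          (mem_univ (𝒯.ψ U x))).trans ?_)
        unfold HHSConstants.endRad
        gcongr
        linarith [𝒯.dist_φ_rho_le hD hC hV hm hpm hq, 𝒯.dist_φ_ψ_le hD hC hx U,
          dist_triangle4 (𝒯.φ U p) q (hD.pr U x) (𝒯.φ U (𝒯.ψ U x)), dist_comm q (hD.pr U x)]
      refine ⟨Sum.inl V, ?_, hV, m, hm, hpm⟩
      simp only [s, Finset.inl_mem_disjSum, G', Finset.mem_filter]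
      exact ⟨hG V hlt, hV, hfar⟩
    · exact ⟨Sum.inr (Sum.inl (Sum.inl b)), by simp [s, HullInput.inl_mem_idx, hb], hle _ hd⟩
    · exact ⟨Sum.inr (Sum.inl (Sum.inr h)), by simp [s, HullInput.inr_mem_idx, hh], hle _ hd⟩
  · rintro (V | i | i | _) - p hp q hq hpγ hqγ
    · obtain ⟨hlt, m, hm, hpm⟩ := hp
      obtain ⟨_, m', hm', hqm⟩ := hq
      have := dist_le_of_ediam_le (by linarith) (𝒯.shadow_diam U V (Or.inl hlt)) hm hm'
      linarith [dist_triangle4_right p q m m']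
    · simp only [Sum.elim_inr, Sum.elim_inl, Metric.mem_closedBall] at hp hq
      linarith [dist_triangle_right p q (i.elim (𝒯.mark U) (𝒯.rayMark U))]
    · exact (𝒯.dist_le_of_mem_centers hD hC ha hx hy hγ hp hq hpγ hqγ).trans b3
    · simp only [Sum.elim_inr, Metric.mem_closedBall] at hp hq
      linarith [dist_triangle_right p q (𝒯.ψ U x)]

end ReducedTreeSystem

/-! ### The lower bound for the distance in the model -/

open Classical in
/-- If the lengths `ℓ U` are bounded by `e U` up to a charge for each of the `V ∈ G` related to `U`,
and each `V` is charged a bounded number of times, then the total length is bounded by the sum of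
the numbers `e U`. -/
theorem sum_le_of_charging {ι : Type*} (G : Finset ι) (r : ι → ι → Prop) (e ℓ : ι → ℝ) (N m : ℕ)
    {b : ℝ} (hb : 0 ≤ b) (he : ∀ U ∈ G, 0 ≤ e U)
    (h₁ : ∀ U ∈ G, ℓ U ≤ e U + (({V ∈ G | r V U}.card + m : ℕ) : ℝ) * b)
    (h₂ : ∀ V ∈ G, {U ∈ G | r V U}.card ≤ N) (h₃ : ∀ U ∈ G, 1 + (2 * N + m) * b ≤ ℓ U)
    (hN : G.Nonempty → 1 ≤ N) :
    ∑ U ∈ G, ℓ U ≤ (1 + 2 * b * (N + m)) * ∑ U ∈ G, e U := by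
  have hdc : ∑ U ∈ G, {V ∈ G | r V U}.card = ∑ V ∈ G, {U ∈ G | r V U}.card :=
    (Finset.sum_card_bipartiteAbove_eq_sum_card_bipartiteBelow r).symm
  have hcount : ∑ U ∈ G, {V ∈ G | r V U}.card ≤ N * G.card := by
    rw [hdc, mul_comm, ← smul_eq_mul]
    exact Finset.sum_le_card_nsmul G _ _ h₂
  set G₀ := {U ∈ G | 1 ≤ e U}
  set G₁ := {U ∈ G | ¬ 1 ≤ e U}
  have hsplit : G₀.card + G₁.card = G.card := Finset.card_filter_add_card_filter_not _
  -- If e U < 1, the length in `h₃` forces at least 2 * N charges at U. There are at most N * |G|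
  -- charges, so these U form at most half of G.
  have hG₁ : 2 * N * G₁.card ≤ N * G.card := by
    refine le_trans ?_ hcount
    rw [mul_comm, ← smul_eq_mul]
    refine (Finset.card_nsmul_le_sum G₁ _ _ fun U hU => ?_).trans
      (Finset.sum_le_sum_of_subset (Finset.filter_subset _ _))
    obtain ⟨hU, hlt⟩ := Finset.mem_filter.1 hU
    by_contra! hc
    have h4 := h₁ U hU
    have h5 := h₃ U hU
    have h6 : ((({V ∈ G | r V U}.card + m : ℕ) : ℝ)) * b ≤ (2 * N + m) * b := by
      gcongr
      have : (({V ∈ G | r V U}.card : ℕ) : ℝ) ≤ 2 * N := by exact_mod_cast hc.le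
      push_cast; linarith
    linarith
  have hcardG : (G.card : ℝ) ≤ 2 * ∑ U ∈ G, e U := by
    have h0 : (G₀.card : ℝ) ≤ ∑ U ∈ G, e U := by
      calc (G₀.card : ℝ) = ∑ U ∈ G₀, (1 : ℝ) := by simp
        _ ≤ ∑ U ∈ G₀, e U := Finset.sum_le_sum fun U hU => (Finset.mem_filter.1 hU).2
        _ ≤ ∑ U ∈ G, e U := Finset.sum_le_sum_of_subset_of_nonneg (Finset.filter_subset _ _)
            fun U hU _ => he U hU
    have h1 : G₁.card ≤ G₀.card := by
      rcases G.eq_empty_or_nonempty with h | h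
      · simp [G₁, h]
      · have hN' := hN h
        have : N * (2 * G₁.card) ≤ N * G.card := by linarith
        have := Nat.le_of_mul_le_mul_left this hN'
        omega
    have h2 : (G.card : ℝ) ≤ 2 * G₀.card := by exact_mod_cast (by omega : G.card ≤ 2 * G₀.card)
    linarith
  have hcount' : ((∑ U ∈ G, {V ∈ G | r V U}.card : ℕ) : ℝ) ≤ N * G.card := by exact_mod_cast hcount
  calc ∑ U ∈ G, ℓ U ≤ ∑ U ∈ G, (e U + (({V ∈ G | r V U}.card + m : ℕ) : ℝ) * b) :=
        Finset.sum_le_sum h₁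
    _ = ∑ U ∈ G, e U + ((∑ U ∈ G, {V ∈ G | r V U}.card : ℕ) + G.card * m : ℝ) * b := by
        push_cast
        rw [Finset.sum_add_distrib, ← Finset.sum_mul, Finset.sum_add_distrib, Finset.sum_const,
          nsmul_eq_mul]
    _ ≤ ∑ U ∈ G, e U + (N * G.card + G.card * m : ℝ) * b := by gcongr
    _ = ∑ U ∈ G, e U + b * (N + m) * G.card := by ring
    _ ≤ ∑ U ∈ G, e U + b * (N + m) * (2 * ∑ U ∈ G, e U) := by gcongr
    _ = _ := by ring

namespace HHSConstants

/-- The lower bound for the lengths of the segments to which the charging argument is applied. -/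
noncomputable def minLength (c : HHSConstants) (θ C R r : ℝ) (n : ℕ) : ℝ :=
  1 + (2 * c.complexity + (2 * n + 1)) * c.coverConst θ C (coverRad R r C)

/-- The lower bound for `K`. -/
noncomputable def minK (c : HHSConstants) (L θ C R r : ℝ) (n : ℕ) : ℝ :=
  2 * (c.cons + c.rayConst L) + 2 * (4 * c.E + c.rayConst L +
    (C * c.minLength θ C R r n + C + 2 * c.treeConst θ C))

/-- The lower bound for the threshold in the distance formula. -/
noncomputable def minThreshold (c : HHSConstants) (θ K : ℝ) : ℝ := 3 * K + 2 * |θ| + 4 * c.ξ + 1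

/-- The multiplicative constant of the lower bound for the distance in the model. -/
noncomputable def lowerMul (c : HHSConstants) (θ C R r : ℝ) (n : ℕ) : ℝ :=
  (2 * C + 2 * c.treeConst θ C + 2 * c.ξ) *
    (1 + 2 * c.coverConst θ C (coverRad R r C) * (c.complexity + (2 * n + 1)))

variable (c : HHSConstants) {L θ C R r : ℝ} {n : ℕ}

theorem coverConst_coverRad_nonneg (hC : 1 ≤ C) (hR : 0 ≤ R) (hr : 0 ≤ r) :
    0 ≤ c.coverConst θ C (coverRad R r C) :=
  (c.coverConst_bounds hC (by unfold coverRad; positivity)).1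

theorem one_le_minLength (hC : 1 ≤ C) (hR : 0 ≤ R) (hr : 0 ≤ r) :
    1 ≤ c.minLength θ C R r n := by
  have := c.coverConst_coverRad_nonneg (θ := θ) hC hR hr
  unfold minLength
  exact le_add_of_nonneg_right (by positivity)

/-- The second bound serves the orthogonality argument. The third places the domains with large
projections among the finitely many with d_U ≥ E, and the fourth makes their tree segments at least
`minLength` long. -/
theorem minK_bounds (hL : 1 ≤ L) (hC : 1 ≤ C) (hR : 0 ≤ R) (hr : 0 ≤ r) {K : ℝ}
    (hK : c.minK L θ C R r n ≤ K) : 0 ≤ K ∧ 2 * (c.cons + c.rayConst L) ≤ K ∧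
      c.E ≤ K / 2 - 3 * c.E - c.rayConst L ∧
      C * c.minLength θ C R r n + C + 2 * c.treeConst θ C ≤ K / 2 - 3 * c.E - c.rayConst L := by
  have h1 := c.one_le_minLength (θ := θ) (n := n) hC hR hr
  have h2 := c.treeConst_nonneg (θ := θ) hC
  have h3 := (c.rayConst_bounds hL).2
  have h4 := c.E_pos
  have h5 := c.cons_pos
  have h6 : 0 ≤ C * c.minLength θ C R r n := mul_nonneg (by linarith) (by linarith)
  unfold minK at hK
  refine ⟨?_, ?_, ?_, ?_⟩ <;> linarith

end HHSConstants

namespace IsNormalizedHHS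

variable {X : Type u} [MetricSpace X] {𝔖 : Type v} [PartialOrder 𝔖] {𝒞 : 𝔖 → Type w}
  [∀ U, MetricSpace (𝒞 U)] {c : HHSConstants} {D : HHSData X 𝔖 𝒞} {L : ℝ}
  (P : HullInput c D L) {M K θ : ℝ} (hD : IsNormalizedHHS c D)
include hD

/-- Domains in which two points of the hull have distant projections are relevant. -/
theorem mem_relevant_of_lt_dist (hK : 0 ≤ K) {x y : X} (hx : x ∈ P.hull M θ)
    (hy : y ∈ P.hull M θ) {U : 𝔖}
    (hxy : 2 * (θ + c.ξ) + 3 * K < dist (hD.pr U x) (hD.pr U y)) : U ∈ P.relevant M K := by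
  by_contra hU
  simp only [HullInput.relevant, mem_ofPred_eq, not_or, not_lt] at hU
  obtain ⟨hdiam, hsupp⟩ := hU
  push Not at hsupp
  have key : ∀ z ∈ P.hypHull M U, ∃ p ∈ P.marked M U, dist z p ≤ K := by
    rintro z ((⟨p, hp, p', hp', γ, hγ, hz⟩ | ⟨p, hp, h, hh, hU, -⟩) | ⟨h, hh, h', hh', hU, -⟩)
    · refine ⟨p, hp, ?_⟩
      linarith [hγ.dist_add hz, dist_le_of_ediam_le hK hdiam hp hp', dist_comm z p,
        dist_nonneg (x := z) (y := p')]
    · exact absurd hU (hsupp h hh)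
    · exact absurd hU (hsupp h hh)
  obtain ⟨z, hz, hxz⟩ := hD.exists_dist_hypHull_lt P hx U
  obtain ⟨z', hz', hyz⟩ := hD.exists_dist_hypHull_lt P hy U
  obtain ⟨p, hp, hzp⟩ := key z hz
  obtain ⟨p', hp', hzp'⟩ := key z' hz'
  linarith [dist_le_of_ediam_le hK hdiam hp hp',
    dist_triangle4_right (hD.pr U x) (hD.pr U y) z z', dist_triangle4_right z z' p p']

theorem one_le_complexity (U : 𝔖) : 1 ≤ c.complexity := by
  have := hD.finite_complexity {U} (by simp)
  rw [Set.encard_singleton] at this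
  exact_mod_cast this

end IsNormalizedHHS

namespace ReducedTreeSystem

variable {X : Type u} [MetricSpace X] {𝔖 : Type v} [PartialOrder 𝔖] {𝒞 : 𝔖 → Type w}
  [∀ U, MetricSpace (𝒞 U)] {c : HHSConstants} {D : HHSData X 𝔖 𝒞} {L : ℝ}
  {P : HullInput c D L} {M K C R r θ : ℝ} (𝒯 : ReducedTreeSystem.{u, v, w, t} P M K C)
  (hD : IsNormalizedHHS c D)

-- Above the threshold, U is relevant and its tree segment is long, so d_U is at most a multiple of
-- the length of the segment. The charging argument bounds the sum of these lengths by the collapsed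
-- lengths.
include hD in
theorem tsum_threshold_le (hL : 1 ≤ L) (hC : 1 ≤ C) (hM : c.bgi + 33 * c.δ ≤ M) (hR : 0 ≤ R)
    (hr : 0 ≤ r) (hK : c.minK L θ C R r P.card ≤ K) {K₂ : ℝ} (hK₂ : c.minThreshold θ K ≤ K₂)
    {x y : X} (hx : x ∈ P.hull M θ) (hy : y ∈ P.hull M θ) :
    (∑' U, threshold K₂ (D.d U x y)) ≠ ⊤ ∧
    (∑' U, threshold K₂ (D.d U x y)) ≤
      ENNReal.ofReal (c.lowerMul θ C R r P.card) * 𝒯.modelDist R r x y := by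
  classical
  have hξ := c.ξ_nonneg
  have hE := c.E_pos
  have hrc := (c.rayConst_bounds hL).2
  have htc := c.treeConst_nonneg (θ := θ) hC
  obtain ⟨hK0, -, hK2, hK3⟩ := c.minK_bounds hL hC hR hr hK
  have hcc := c.coverConst_coverRad_nonneg (θ := θ) hC hR hr
  have hml := c.one_le_minLength (θ := θ) (n := P.card) hC hR hr
  set b := c.coverConst θ C (HHSConstants.coverRad R r C)
  -- Only the finiteness of `s` is needed, so the threshold 0 is an arbitrary choice.
  obtain ⟨s, hs, -⟩ := hD.exists_finset_large x y 0
  set G : Finset (P.relevant M K) := {U ∈ s.subtype (· ∈ P.relevant M K) |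
    K / 2 - 3 * c.E - c.rayConst L < dist (hD.pr U.1 x) (hD.pr U.1 y)}
  have hG : ∀ U : P.relevant M K,
      K / 2 - 3 * c.E - c.rayConst L < dist (hD.pr U x) (hD.pr U y) → U ∈ G := fun U hU => by
    refine Finset.mem_filter.2 ⟨Finset.mem_subtype.2 (hs _ ?_), hU⟩
    exact (ENNReal.ofReal_le_ofReal (by linarith)).trans (hD.ofReal_dist_le_d U.1 x y)
  have hsum : ∑' U, threshold K₂ (D.d U x y) = ∑ U ∈ G, threshold K₂ (D.d U.1 x y) := by
    rw [tsum_eq_sum (s := G.map (Function.Embedding.subtype _)), Finset.sum_map]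
    · rfl
    intro U hU
    unfold threshold
    rw [if_neg]
    intro hle
    have h1 := (ENNReal.ofReal_le_ofReal_iff (by positivity)).1 (hle.trans (hD.d_le U x y))
    unfold HHSConstants.minThreshold at hK₂
    have h2 := le_abs_self θ
    have hU' := hD.mem_relevant_of_lt_dist P hK0 hx hy (U := U) (by linarith)
    exact hU (Finset.mem_map.2 ⟨⟨U, hU'⟩, hG _ (by
      change _ < dist (hD.pr U x) (hD.pr U y)
      linarith [abs_nonneg θ]), rfl⟩)
  set ℓ : P.relevant M K → ℝ := fun U => dist (𝒯.ψ U x) (𝒯.ψ U y)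
  set e : P.relevant M K → ℝ≥0∞ := fun U => Collapse.eDist (𝒯.hat R r U x) (𝒯.hat R r U y)
  have he : ∀ U, e U ≠ ⊤ := fun U =>
    ((Collapse.eDist_mk_le _ _ _).trans_lt (edist_lt_top _ _)).ne
  have hℓ : ∀ U ∈ G, c.minLength θ C R r P.card ≤ ℓ U := fun U hU => by
    have h1 := (Finset.mem_filter.1 hU).2
    have h2 := 𝒯.dist_pr_le hD hC hx hy U
    have h3 : C * c.minLength θ C R r P.card ≤ C * ℓ U := by linarith
    exact le_of_mul_le_mul_left h3 (by linarith)
  have hd : ∀ U ∈ G, D.d U.1 x y ≤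
      ENNReal.ofReal ((2 * C + 2 * c.treeConst θ C + 2 * c.ξ) * ℓ U) := fun U hU => by
    refine (hD.d_le U.1 x y).trans (ENNReal.ofReal_le_ofReal ?_)
    have h1 : 1 ≤ ℓ U := hml.trans (hℓ U hU)
    have h2 := 𝒯.dist_pr_le hD hC hx hy U
    have h3 : C + 2 * c.treeConst θ C + 2 * c.ξ ≤
        (C + 2 * c.treeConst θ C + 2 * c.ξ) * ℓ U := le_mul_of_one_le_right (by positivity) h1
    calc _ ≤ C * ℓ U + (C + 2 * c.treeConst θ C + 2 * c.ξ) := by linarith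
      _ ≤ _ := by linarith
  have hcharge := sum_le_of_charging G
    (fun V U => V.1 < U.1 ∧ ∀ q ∈ D.rho V.1 U.1, 2 * c.cons ≤ dist (hD.pr U.1 x) q)
    (fun U => (e U).toReal) ℓ c.complexity (2 * P.card + 1) hcc
    (fun U _ => ENNReal.toReal_nonneg) ?_ ?_ ?_ ?_
  · refine ⟨?_, ?_⟩
    · rw [hsum]
      exact (ENNReal.sum_lt_top.2 fun U _ =>
        ((threshold_le _ _).trans_lt (lt_top_iff_ne_top.2 (hD.d_ne_top _ _ _)))).ne
    · calc ∑' U, threshold K₂ (D.d U x y)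
          ≤ ∑ U ∈ G, ENNReal.ofReal ((2 * C + 2 * c.treeConst θ C + 2 * c.ξ) * ℓ U) := by
            rw [hsum]
            exact Finset.sum_le_sum fun U hU => (threshold_le _ _).trans (hd U hU)
        _ = ENNReal.ofReal ((2 * C + 2 * c.treeConst θ C + 2 * c.ξ) * ∑ U ∈ G, ℓ U) := by
            rw [Finset.mul_sum, ENNReal.ofReal_sum_of_nonneg]
            exact fun U _ => by positivity
        _ ≤ ENNReal.ofReal (c.lowerMul θ C R r P.card * ∑ U ∈ G, (e U).toReal) := by
            refine ENNReal.ofReal_le_ofReal ?_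
            unfold HHSConstants.lowerMul
            rw [mul_assoc]
            gcongr
            push_cast at hcharge
            exact hcharge
        _ = ENNReal.ofReal (c.lowerMul θ C R r P.card) * ∑ U ∈ G, e U := by
            rw [ENNReal.ofReal_mul (by unfold HHSConstants.lowerMul; positivity),
              ENNReal.ofReal_sum_of_nonneg fun U _ => ENNReal.toReal_nonneg]
            congr 1
            exact Finset.sum_congr rfl fun U _ => ENNReal.ofReal_toReal (he U)
        _ ≤ _ := by
            gcongr
            exact ENNReal.sum_le_tsum G
  · intro U _
    have h1 := 𝒯.dist_ψ_le_eDist_add hD hL hC hM hR hr hx hy U G hG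
    change ENNReal.ofReal (ℓ U) ≤ e U + _ at h1
    rw [← ENNReal.ofReal_toReal (he U), ← ENNReal.ofReal_natCast,
      ← ENNReal.ofReal_mul (Nat.cast_nonneg _),
      ← ENNReal.ofReal_add ENNReal.toReal_nonneg (by positivity),
      ENNReal.ofReal_le_ofReal_iff (by positivity)] at h1
    convert h1
    rfl
  · intro V _
    set S : Set 𝔖 := {U | V.1 < U ∧ ∀ q ∈ D.rho V.1 U, 2 * c.cons ≤ dist (hD.pr U x) q}
    have hchain := hD.finite_complexity _ (hD.isChain_of_far V.1 x (s := S) fun U hU => hU)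
    set G' : Finset (P.relevant M K) := {U ∈ G |
      V.1 < U.1 ∧ ∀ q ∈ D.rho V.1 U.1, 2 * c.cons ≤ dist (hD.pr U.1 x) q}
    have h1 : ((G'.map (Function.Embedding.subtype _) : Finset 𝔖) : Set 𝔖).encard ≤
        c.complexity := by
      refine le_trans (Set.encard_le_encard ?_) hchain
      intro U hU
      obtain ⟨U', hU', rfl⟩ := Finset.mem_map.1 (Finset.mem_coe.1 hU)
      exact (Finset.mem_filter.1 hU').2
    rw [Set.encard_coe_eq_coe_finsetCard, Finset.card_map] at h1
    convert (by exact_mod_cast h1 : G'.card ≤ c.complexity)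
  · intro U hU
    refine le_trans (le_of_eq ?_) (hℓ U hU)
    unfold HHSConstants.minLength
    push_cast
    rfl
  · rintro ⟨U, _⟩
    exact hD.one_le_complexity U.1

end ReducedTreeSystem

theorem mainTheorem8 (c : HHSConstants) (L θ C : ℝ) (hL : 1 ≤ L) (hC : 1 ≤ C) (n : ℕ) :
    ∃ M₀ : ℝ, ∀ M ≥ M₀, ∃ R₀ : ℝ, ∀ R ≥ R₀, ∃ r₀ : ℝ, ∀ r ≥ r₀, ∃ K₀ : ℝ, ∀ K ≥ K₀,
    ∃ K₁ : ℝ, 0 < K₁ ∧ ∀ K₂ ≥ K₁, ∃ A B : ℝ, 1 ≤ A ∧ 0 ≤ B ∧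
      ∀ (X : Type u) [MetricSpace X] (𝔖 : Type v) [PartialOrder 𝔖] (𝒞 : 𝔖 → Type w)
        [∀ U, MetricSpace (𝒞 U)] (D : HHSData X 𝔖 𝒞), IsNormalizedHHS c D →
      ∀ P : HullInput c D L, P.card = n →
      ∀ 𝒯 : ReducedTreeSystem.{u, v, w, t} P M K C,
      ∀ x ∈ P.hull M θ, ∀ y ∈ P.hull M θ,
        (∑' U : 𝔖, threshold K₂ (D.d U x y)) ≠ ⊤ ∧
        (∑' U : 𝔖, threshold K₂ (D.d U x y))
          ≤ ENNReal.ofReal A * 𝒯.modelDist R r x y + ENNReal.ofReal B ∧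
        𝒯.modelDist R r x y
          ≤ ENNReal.ofReal A * (∑' U : 𝔖, threshold K₂ (D.d U x y)) + ENNReal.ofReal B := by
  -- K depends on R and r because the covering sets grow with the clusters. K₂ affects only the
  -- upper bound for the model, through the count of domains with d_U ≥ E.
  refine ⟨c.bgi + 33 * c.δ, fun M hM => ⟨c.minR L θ C, fun R hR => ⟨0, fun r hr =>
    ⟨c.minK L θ C R r n, fun K hK => ?_⟩⟩⟩⟩
  have hR0 : 0 ≤ R := (c.minR_bounds hL hC).1.trans hR
  obtain ⟨hK0, hK1, -, -⟩ := c.minK_bounds hL hC hR0 hr hK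
  refine ⟨c.minThreshold θ K, ?_, fun K₂ hK₂ =>
    ⟨max (c.lowerMul θ C R r n) (max (c.upperMul θ C K₂) 1), c.upperAdd θ C K₂,
      (le_max_right _ _).trans (le_max_right _ _), NNReal.coe_nonneg _, ?_⟩⟩
  · have := c.ξ_nonneg
    unfold HHSConstants.minThreshold; positivity
  intro X _ 𝔖 _ 𝒞 _ D hD P hP 𝒯 x hx y hy
  subst hP
  obtain ⟨h1, h2⟩ := 𝒯.tsum_threshold_le hD hL hC hM hR0 hr hK hK₂ hx hy
  have h3 := 𝒯.modelDist_le hD (r := r) hL hC hM hR hK1 K₂ hx hy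
  refine ⟨h1, h2.trans (le_add_right (mul_le_mul' (ENNReal.ofReal_le_ofReal (le_max_left _ _))
    le_rfl)), h3.trans (add_le_add (mul_le_mul' ?_ le_rfl) (ENNReal.ofReal_coe_nnreal).ge)⟩
  rw [← ENNReal.ofReal_coe_nnreal]
  exact ENNReal.ofReal_le_ofReal ((le_max_left _ _).trans (le_max_right _ _))
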